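/- An instance of \emph{1DLAD with dichotomous utilities} consists of $n$ agents, $n$ divisible goods (one unit of each), utilities $u_{ij}\in\{0,1\}$ and disagreement utilities $c_i\ge 0$. An allocation $x$ gives agent $i$ the utility $v_i(x)=\sum_j u_{ij}x_{ij}$. The instance is \emph{feasible} if some fractional perfect matching $x$ has $v_i(x)>c_i$ for all $i$. A \emph{Nash-bargaining solution} is a fractional perfect matching $x$ with $v_i(x)>c_i$ for all $i$ that maximizes $\sum_i\log(v_i(x)-c_i)$ over all $x\ge 0$ with $\sum_j x_{ij}\le 1$ for all $i$, $\sum_i x_{ij}\le 1$ for all $j$ and $v_i(x)>c_i$ for all $i$. An \emph{equilibrium of the variable-budget market} is a triple $(x,p,q)$ of a fractional perfect matching $x$ with $v_i(x)>c_i$ for all $i$, prices $p_j\ge 0$ and price-offsets $q_i\ge 0$ such that every agent $i$ is allocated only goods $j$ of maximum price-adjusted bang-per-buck, i.e. $u_{ik}(p_j+q_i)\le u_{ij}(p_k+q_i)$ for all goods $k$ whenever $x_{ij}>0$, and spends exactly her money, $\sum_j (p_j+q_i)x_{ij}=v_i(x)/(v_i(x)-c_i)$. \textbf{Theorem.} There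 is a strongly polynomial algorithm which, for every $n$ and every feasible instance of 1DLAD with dichotomous utilities, computes an equilibrium $(x,p,q)$ of the variable-budget market whose allocation $x$ is a Nash-bargaining solution of the instance. Here an algorithm is a fixed program, independent of $n$, for a random access machine with finitely many arrays of natural numbers and of real numbers, in which additions, subtractions, multiplications, comparisons, memory accesses and, for real numbers, divisions cost one step each (there is no rounding operation). It is \emph{strongly polynomial} if there are polynomials $P$ and $Q$ such that on every feasible instance with $n$ agents it halts after at most $P(n)$ steps, all natural numbers in its memory are at most $P(n)$, and, if all $c_i$ are rational, all numbers in its memory are rational and have at most $Q(L)$ bits, where $L$ is the number of bits of the instance. -/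

import Mathlib

/-! ### The market: `n` agents, `n` goods, disagreement utilities -/

/-- An instance of the matching market with disagreement point: `n` agents and `n` divisible goods
(one unit of each), `u i j` is the utility of agent `i` for one unit of good `j`, and `c i` is the
disagreement utility of agent `i`. -/
structure Market (n : ℕ) where
  u : Fin n → Fin n → ℝ
  c : Fin n → ℝ

/-- `x` is a fractional perfect matching of agents to goods. -/
def IsFractionalPerfectMatching {n : ℕ} (x : Fin n → Fin n → ℝ) : Prop :=
  (∀ i j, 0 ≤ x i j) ∧ (∀ i, ∑ j, x i j = 1) ∧ (∀ j, ∑ i, x i j = 1)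

/-- `x` is a fractional (not necessarily perfect) matching: the constraints of the convex
program. -/
def IsFractionalMatching {n : ℕ} (x : Fin n → Fin n → ℝ) : Prop :=
  (∀ i j, 0 ≤ x i j) ∧ (∀ i, ∑ j, x i j ≤ 1) ∧ (∀ j, ∑ i, x i j ≤ 1)

namespace Market

variable {n : ℕ}

/-- The utility `v i` of agent `i` from the allocation `x`. -/
noncomputable def utility (I : Market n) (x : Fin n → Fin n → ℝ) (i : Fin n) : ℝ :=
  ∑ j, I.u i j * x i j

/-- Dichotomous utilities. -/
def Dichotomous (I : Market n) : Prop := ∀ i j, I.u i j = 0 ∨ I.u i j = 1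

/-- Some fractional perfect matching gives every agent strictly more than her disagreement
utility. -/
def Feasible (I : Market n) : Prop :=
  ∃ x, IsFractionalPerfectMatching x ∧ ∀ i, I.c i < I.utility x i

/-- The fractional perfect matching `x` is a Nash-bargaining solution: an optimal solution of
`max ∑ i, log (v i - c i)` over all fractional matchings. The program forces `v i > c i`; this is
written out, because `Real.log` is a junk value elsewhere. -/
def IsNashBargainingSolution (I : Market n) (x : Fin n → Fin n → ℝ) : Prop :=
  IsFractionalPerfectMatching x ∧ (∀ i, I.c i < I.utility x i) ∧
    ∀ y, IsFractionalMatching y → (∀ i, I.c i < I.utility y i) →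
      ∑ i, Real.log (I.utility y i - I.c i) ≤ ∑ i, Real.log (I.utility x i - I.c i)

/-- Good `j` maximizes the price-adjusted bang-per-buck `u i k / (p k + q i)` of agent `i` over all
goods `k`. The comparison of the ratios is written without division, so that a good which is free
for `i` counts as optimal even if `i` has utility `0` for it. -/
def IsMaxBangPerBuck (I : Market n) (p q : Fin n → ℝ) (i j : Fin n) : Prop :=
  ∀ k, I.u i k * (p j + q i) ≤ I.u i j * (p k + q i)

/-- The money of agent `i` in the variable-budget market, as a function of her utility. -/
noncomputable def money (I : Market n) (x : Fin n → Fin n → ℝ) (i : Fin n) : ℝ :=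
  I.utility x i / (I.utility x i - I.c i)

/-- `(x, p, q)` is an equilibrium of the variable-budget market, with prices `p` of goods and
price-offsets `q` of agents. -/
structure IsEquilibrium (I : Market n) (x : Fin n → Fin n → ℝ) (p q : Fin n → ℝ) : Prop where
  price_nonneg : ∀ j, 0 ≤ p j
  offset_nonneg : ∀ i, 0 ≤ q i
  /-- every good is fully sold, and every agent gets one unit of goods in total -/
  perfect : IsFractionalPerfectMatching x
  /-- `c i` is a strict lower bound on the utility of agent `i` -/
  above_disagreement : ∀ i, I.c i < I.utility x i
  /-- every agent gets only goods of maximum price-adjusted bang-per-buck ... -/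
  optimal : ∀ i j, 0 < x i j → I.IsMaxBangPerBuck p q i j
  /-- ... and her money is fully spent -/
  spends : ∀ i, ∑ j, (p j + q i) * x i j = I.money x i

end Market

/-! ### The machine model: a random access machine over the reals

Programs are finite objects. The memory consists of arrays (named by numerals in the program, with
two indices) of natural numbers and of real numbers. Each arithmetic operation, comparison, memory
access and control step costs one unit. There is no rounding operation. -/

namespace RealRAM

/-- The contents of the memory: cell `(i, j)` of array number `a`. -/
structure State where
  nat : ℕ → ℕ → ℕ → ℕ
  num : ℕ → ℕ → ℕ → ℝ

namespace State

def setNat (s : State) (a i j v : ℕ) : State :=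
  { s with nat := fun a' i' j' => if a' = a ∧ i' = i ∧ j' = j then v else s.nat a' i' j' }

noncomputable def setNum (s : State) (a i j : ℕ) (v : ℝ) : State :=
  { s with num := fun a' i' j' => if a' = a ∧ i' = i ∧ j' = j then v else s.num a' i' j' }

end State

/-- Expressions for indices and counters. -/
inductive NatExp where
  | const (k : ℕ)
  | load (a : ℕ) (i j : NatExp)
  | add (e f : NatExp)
  | sub (e f : NatExp)
  | mul (e f : NatExp)

namespace NatExp

/-- The value of an expression; subtraction is truncated. -/
def eval (s : State) : NatExp → ℕ
  | const k => k
  | load a i j => s.nat a (i.eval s) (j.eval s)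
  | add e f => e.eval s + f.eval s
  | sub e f => e.eval s - f.eval s
  | mul e f => e.eval s * f.eval s

def cost : NatExp → ℕ
  | const _ => 1
  | load _ i j => 1 + i.cost + j.cost
  | add e f => 1 + e.cost + f.cost
  | sub e f => 1 + e.cost + f.cost
  | mul e f => 1 + e.cost + f.cost

end NatExp

/-- Expressions for real numbers. -/
inductive NumExp where
  | load (a : ℕ) (i j : NatExp)
  | ofNat (e : NatExp)
  | add (e f : NumExp)
  | sub (e f : NumExp)
  | mul (e f : NumExp)
  | div (e f : NumExp)

namespace NumExp

/-- The value of an expression; a division by zero returns zero. -/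
noncomputable def eval (s : State) : NumExp → ℝ
  | load a i j => s.num a (i.eval s) (j.eval s)
  | ofNat e => (e.eval s : ℝ)
  | add e f => e.eval s + f.eval s
  | sub e f => e.eval s - f.eval s
  | mul e f => e.eval s * f.eval s
  | div e f => e.eval s / f.eval s

def cost : NumExp → ℕ
  | load _ i j => 1 + i.cost + j.cost
  | ofNat e => 1 + e.cost
  | add e f => 1 + e.cost + f.cost
  | sub e f => 1 + e.cost + f.cost
  | mul e f => 1 + e.cost + f.cost
  | div e f => 1 + e.cost + f.cost

end NumExp

inductive Test where
  | natLe (e f : NatExp)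
  | numLe (e f : NumExp)
  | not (b : Test)
  | and (b d : Test)

namespace Test

def Holds (s : State) : Test → Prop
  | natLe e f => e.eval s ≤ f.eval s
  | numLe e f => e.eval s ≤ f.eval s
  | not b => ¬ b.Holds s
  | and b d => b.Holds s ∧ d.Holds s

def cost : Test → ℕ
  | natLe e f => 1 + e.cost + f.cost
  | numLe e f => 1 + e.cost + f.cost
  | not b => 1 + b.cost
  | and b d => 1 + b.cost + d.cost

end Test

inductive Prog where
  | skip
  | setNat (a : ℕ) (i j e : NatExp)
  | setNum (a : ℕ) (i j : NatExp) (e : NumExp)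
  | seq (c d : Prog)
  | branch (b : Test) (c d : Prog)
  | loop (b : Test) (c : Prog)

/-- `Exec Ok c s k t`: the program `c`, started with memory `s`, halts after `k` steps with memory
`t`, and after every assignment in between the memory satisfies `Ok`. -/
inductive Exec (Ok : State → Prop) : Prog → State → ℕ → State → Prop
  | skip (s : State) : Exec Ok Prog.skip s 1 s
  | setNat (s : State) (a : ℕ) (i j e : NatExp)
      (h : Ok (s.setNat a (i.eval s) (j.eval s) (e.eval s))) :
      Exec Ok (Prog.setNat a i j e) s (1 + i.cost + j.cost + e.cost)
        (s.setNat a (i.eval s) (j.eval s) (e.eval s))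
  | setNum (s : State) (a : ℕ) (i j : NatExp) (e : NumExp)
      (h : Ok (s.setNum a (i.eval s) (j.eval s) (e.eval s))) :
      Exec Ok (Prog.setNum a i j e) s (1 + i.cost + j.cost + e.cost)
        (s.setNum a (i.eval s) (j.eval s) (e.eval s))
  | seq {c d : Prog} {s t r : State} {k l : ℕ}
      (hc : Exec Ok c s k t) (hd : Exec Ok d t l r) :
      Exec Ok (Prog.seq c d) s (k + l) r
  | branchTrue {b : Test} {c d : Prog} {s t : State} {k : ℕ}
      (hb : b.Holds s) (hc : Exec Ok c s k t) :
      Exec Ok (Prog.branch b c d) s (1 + b.cost + k) t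
  | branchFalse {b : Test} {c d : Prog} {s t : State} {k : ℕ}
      (hb : ¬ b.Holds s) (hd : Exec Ok d s k t) :
      Exec Ok (Prog.branch b c d) s (1 + b.cost + k) t
  | loopTrue {b : Test} {c : Prog} {s t r : State} {k l : ℕ}
      (hb : b.Holds s) (hc : Exec Ok c s k t) (hl : Exec Ok (Prog.loop b c) t l r) :
      Exec Ok (Prog.loop b c) s (1 + b.cost + k + l) r
  | loopFalse {b : Test} {c : Prog} {s : State} (hb : ¬ b.Holds s) :
      Exec Ok (Prog.loop b c) s (1 + b.cost) s

/-- Programs are deterministic: the number of steps and the result are determined by the input. -/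
theorem Exec.unique {Ok Ok' : State → Prop} {c : Prog} {s t : State} {k : ℕ}
    (h : Exec Ok c s k t) : ∀ {k' : ℕ} {t' : State}, Exec Ok' c s k' t' → k = k' ∧ t = t' := by
  induction h with
  | skip s => intro k' t' h'; cases h'; exact ⟨rfl, rfl⟩
  | setNat s a i j e h => intro k' t' h'; cases h'; exact ⟨rfl, rfl⟩
  | setNum s a i j e h => intro k' t' h'; cases h'; exact ⟨rfl, rfl⟩
  | seq _ _ ih1 ih2 =>
    intro k' t' h'
    cases h' with
    | seq h1 h2 =>
      obtain ⟨rfl, rfl⟩ := ih1 h1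
      obtain ⟨rfl, rfl⟩ := ih2 h2
      exact ⟨rfl, rfl⟩
  | branchTrue hb _ ih =>
    intro k' t' h'
    cases h' with
    | branchTrue _ h1 => obtain ⟨rfl, rfl⟩ := ih h1; exact ⟨rfl, rfl⟩
    | branchFalse hb' _ => exact absurd hb hb'
  | branchFalse hb _ ih =>
    intro k' t' h'
    cases h' with
    | branchTrue hb' _ => exact absurd hb' hb
    | branchFalse _ h1 => obtain ⟨rfl, rfl⟩ := ih h1; exact ⟨rfl, rfl⟩
  | loopTrue hb _ _ ih1 ih2 =>
    intro k' t' h'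
    cases h' with
    | loopTrue _ h1 h2 =>
      obtain ⟨rfl, rfl⟩ := ih1 h1
      obtain ⟨rfl, rfl⟩ := ih2 h2
      exact ⟨rfl, rfl⟩
    | loopFalse hb' => exact absurd hb hb'
  | loopFalse hb =>
    intro k' t' h'
    cases h' with
    | loopTrue hb' _ _ => exact absurd hb' hb
    | loopFalse _ => exact ⟨rfl, rfl⟩

end RealRAM

/-! ### Input, output and strongly polynomial resource bounds -/

/-- The number of bits needed to write a rational number as a fraction in lowest terms. -/
def ratBits (r : ℚ) : ℕ := 1 + r.num.natAbs.size + r.den.size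

namespace Market

variable {n : ℕ}

/-- The initial memory: `n` is in cell `(0, 0)` of the natural-number array `0`, the utilities are
in the real array `0`, the disagreement utilities are in column `0` of the real array `1`, and all
other cells are zero. -/
noncomputable def input (I : Market n) : RealRAM.State where
  nat a i j := if a = 0 ∧ i = 0 ∧ j = 0 then n else 0
  num a i j :=
    if h : i < n ∧ j < n ∧ a = 0 then I.u ⟨i, h.1⟩ ⟨j, h.2.1⟩
    else if h : i < n ∧ j = 0 ∧ a = 1 then I.c ⟨i, h.1⟩
    else 0

/-- The memory `s` meets the space requirements of a strongly polynomial algorithm on the input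
`I`: its counters are at most `N`, and if the disagreement utilities are rational numbers `c'`
(so that the input is written with `n ^ 2 + ∑ i, ratBits (c' i)` bits up to a constant factor),
then all its numbers are rational, with at most `Q (n ^ 2 + ∑ i, ratBits (c' i))` bits. -/
def WithinSpace (I : Market n) (N : ℕ) (Q : Polynomial ℕ) (s : RealRAM.State) : Prop :=
  (∀ a i j, s.nat a i j ≤ N) ∧
    ∀ c' : Fin n → ℚ, (∀ i, I.c i = (c' i : ℝ)) →
      ∀ a i j, ∃ r : ℚ, s.num a i j = (r : ℝ) ∧
        ratBits r ≤ Q.eval (n ^ 2 + ∑ i, ratBits (c' i))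

end Market

/-- The output allocation, in the real array `2`. -/
noncomputable def outputAllocation (n : ℕ) (s : RealRAM.State) (i j : Fin n) : ℝ := s.num 2 i j

/-- The output prices, in column `0` of the real array `3`. -/
noncomputable def outputPrices (n : ℕ) (s : RealRAM.State) (j : Fin n) : ℝ := s.num 3 j 0

/-- The output price-offsets, in column `0` of the real array `4`. -/
noncomputable def outputOffsets (n : ℕ) (s : RealRAM.State) (i : Fin n) : ℝ := s.num 4 i 0

/-!
For dichotomous utilities, let `x` be a fractional matching that uses only goods which the agents
like, and let `v i = ∑ j, x i j`. The optimality conditions of the convex program ask for prices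
`p ≥ 0` and offsets `q ≥ 0` with `1 / (v i - c i) ≤ p j + q i` for every good `j` that `i` likes,
with equality where `0 < x i j`, such that `q i = 0` unless `v i = 1` and `p j = 0` unless `j` is
sold out (`Market.Optimal`). They give an equilibrium and a Nash-bargaining solution once `x` has
been completed to a perfect matching (`Market.isEquilibrium_completion`).

Such `x`, `p`, `q` are found by water filling. A common surplus level `t` is raised from a low
value, and agent `i` demands `min (c i + t) 1` units. Agents with `c i + t < 1` are *uncapped*; when
`t` reaches `1 - c i`, agent `i` becomes *capped* and gets the offset `1 / (1 - c i)`
(`Market.Settled.cap`). When a set `S` of agents comes to demand as much as there is of the set `G`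
of all goods on sale that `S` likes, the *bottleneck* `S`, `G` is *settled*: its goods get the price
`1 / t`, and `1 / t` is subtracted from the offsets of its capped agents (`Market.Settled.settle`).
The level never goes down from one such event to the next, so the prices `1 / t` never rise: an
agent prefers the goods with which she is settled to those settled earlier, and she does not like
any good that is still on sale. There are at most `n` events, each of which decreases the number of
uncapped agents. When none is left, the capped agents keep their offsets and the goods still on sale
are free (`Market.Settled.optimal_of_complete`).

The level of the next event is found by a discrete Newton method from above. It starts at the lowest
level at which some uncapped agent demands one unit. A preflow algorithm with labels at most
`2 * n + 1` either meets all demands at the present level or leaves some excess on the highest label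
only. In the second case some label is not used by any of the `n` agents and `n` goods
(`Market.Config.exists_gap`), and what lies above it is a bottleneck of maximum deficiency
(`Market.Preflow.sum_demand_above`, `Market.Preflow.sum_demand_le`). The level is lowered to where
this bottleneck is tight. The demand of `S` is affine in `t` with slope the number of uncapped
agents in `S`, and this number strictly decreases from one bottleneck to the next
(`Market.Preflow.newton`), so that at most `n + 1` levels are tried for each event. For one level
the number of pushes and lifts is bounded by `Market.Config.potential`.

No rounding is needed to keep the numbers short. A level is either `1 - c i` or an integral
combination of `1` and the `c i`, divided by a positive integer `m ≤ n`. Hence all levels, and all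
flows, which start from zero at each level, are multiples of `1 / (D * n!)`, where `D` is the
product of the denominators of the `c i` (`Market.lattice`). All values assigned are of the form
`(a * b + c * d) / (e * f)` with such numbers of absolute value at most `n + 1` (`Market.Regular`,
`Market.short_of_regular`).

The program is verified in a weakest-precondition calculus (`RealRAM.Prog.wp`) that also bounds the
assigned values and the number of iterations of each loop by one number `N`. A program that
satisfies it runs in time polynomial in `N` (`RealRAM.Prog.wp.sound`). The main loop decreases
`Market.Config.rank`, which is at most a polynomial in `n`.
-/

/-! ### A weakest-precondition calculus for the machine -/

namespace RealRAM

/-- All counters are at most `N`, and all numbers satisfy `R`. -/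
def State.Bounded (N : ℕ) (R : ℝ → Prop) (s : State) : Prop :=
  (∀ a i j, s.nat a i j ≤ N) ∧ ∀ a i j, R (s.num a i j)

namespace Prog

/-- A bound for the running time of a program in which no loop is iterated more than `X` times
per entry. -/
noncomputable def time : Prog → Polynomial ℕ
  | skip => 1
  | setNat _ i j e => ((1 + i.cost + j.cost + e.cost : ℕ) : Polynomial ℕ)
  | setNum _ i j e => ((1 + i.cost + j.cost + e.cost : ℕ) : Polynomial ℕ)
  | seq c d => c.time + d.time
  | branch b c d => ((1 + b.cost : ℕ) : Polynomial ℕ) + (c.time + d.time)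
  | loop b c => (Polynomial.X + 1) * (((1 + b.cost : ℕ) : Polynomial ℕ) + c.time)

/-- The arrays of counters that a program may change. -/
def natArrays : Prog → List ℕ
  | skip => []
  | setNat a _ _ _ => [a]
  | setNum _ _ _ _ => []
  | seq c d => c.natArrays ++ d.natArrays
  | branch _ c d => c.natArrays ++ d.natArrays
  | loop _ c => c.natArrays

/-- The arrays of real numbers that a program may change. -/
def numArrays : Prog → List ℕ
  | skip => []
  | setNat _ _ _ _ => []
  | setNum a _ _ _ => [a]
  | seq c d => c.numArrays ++ d.numArrays
  | branch _ c d => c.numArrays ++ d.numArrays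
  | loop _ c => c.numArrays

/-- The states `s` from which the program halts in a state with property `Q`, every value assigned
on the way respecting the bounds `N` and `R` and every loop being iterated at most `N` times. A loop
is described by an invariant indexed by a bound on the number of iterations that remain. -/
def wp (N : ℕ) (R : ℝ → Prop) : Prog → (State → Prop) → State → Prop
  | skip, Q, s => Q s
  | setNat a i j e, Q, s =>
      e.eval s ≤ N ∧ Q (s.setNat a (i.eval s) (j.eval s) (e.eval s))
  | setNum a i j e, Q, s =>
      R (e.eval s) ∧ Q (s.setNum a (i.eval s) (j.eval s) (e.eval s))
  | seq c d, Q, s => wp N R c (wp N R d Q) s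
  | branch b c d, Q, s => (b.Holds s → wp N R c Q s) ∧ (¬ b.Holds s → wp N R d Q s)
  | loop b c, Q, s => ∃ Inv : ℕ → State → Prop, (∃ m ≤ N, Inv m s) ∧
      ∀ m s', Inv m s' → (¬ b.Holds s' → Q s') ∧
        (b.Holds s' → ∃ m', m = m' + 1 ∧ wp N R c (Inv m') s')

variable {N : ℕ} {R : ℝ → Prop}

theorem wp.mono {c : Prog} : ∀ {Q Q' : State → Prop} {s : State}, (∀ t, Q t → Q' t) →
    c.wp N R Q s → c.wp N R Q' s := by
  induction c with
  | skip => intro Q Q' s h hw; exact h _ hw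
  | setNat => intro Q Q' s h hw; exact ⟨hw.1, h _ hw.2⟩
  | setNum => intro Q Q' s h hw; exact ⟨hw.1, h _ hw.2⟩
  | seq c d ihc ihd => intro Q Q' s h hw; exact ihc (fun t ht => ihd h ht) hw
  | branch b c d ihc ihd =>
    intro Q Q' s h hw; exact ⟨fun hb => ihc h (hw.1 hb), fun hb => ihd h (hw.2 hb)⟩
  | loop b c ih =>
    rintro Q Q' s h ⟨Inv, h0, h1⟩
    exact ⟨Inv, h0, fun m s' hm => ⟨fun hb => h _ ((h1 m s' hm).1 hb), (h1 m s' hm).2⟩⟩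

/-- `t` agrees with `s` on all arrays that the program `c` does not change. -/
structure Agree (c : Prog) (s t : State) : Prop where
  nat : ∀ a, a ∉ c.natArrays → t.nat a = s.nat a
  num : ∀ a, a ∉ c.numArrays → t.num a = s.num a

theorem Agree.refl (c : Prog) (s : State) : c.Agree s s := ⟨fun _ _ => rfl, fun _ _ => rfl⟩

theorem Agree.trans {c : Prog} {s t r : State} (h : c.Agree s t) (h' : c.Agree t r) :
    c.Agree s r :=
  ⟨fun a ha => (h'.nat a ha).trans (h.nat a ha), fun a ha => (h'.num a ha).trans (h.num a ha)⟩

theorem Agree.weaken {c d : Prog} {s t : State} (h : c.Agree s t)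
    (hn : ∀ a ∈ c.natArrays, a ∈ d.natArrays) (hr : ∀ a ∈ c.numArrays, a ∈ d.numArrays) :
    d.Agree s t :=
  ⟨fun a ha => h.nat a fun h' => ha (hn a h'), fun a ha => h.num a fun h' => ha (hr a h')⟩

/-- The frame rule: a program leaves all arrays alone that it does not assign to. -/
theorem wp.agree {c : Prog} : ∀ {Q : State → Prop} {s : State}, c.wp N R Q s →
    c.wp N R (fun t => c.Agree s t ∧ Q t) s := by
  induction c with
  | skip => intro Q s hw; exact ⟨Agree.refl _ _, hw⟩
  | setNat a i j e =>
    refine fun {Q s} hw => ⟨hw.1, ⟨fun b hb => ?_, fun _ _ => rfl⟩, hw.2⟩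
    funext i' j'
    simp only [natArrays, List.mem_singleton] at hb
    simp [State.setNat, hb]
  | setNum a i j e =>
    refine fun {Q s} hw => ⟨hw.1, ⟨fun _ _ => rfl, fun b hb => ?_⟩, hw.2⟩
    funext i' j'
    simp only [numArrays, List.mem_singleton] at hb
    simp [State.setNum, hb]
  | seq c d ihc ihd =>
    intro Q s hw
    change c.wp N R (d.wp N R _) s
    refine (ihc hw).mono fun t ⟨ht, hd⟩ => (ihd hd).mono fun r ⟨hr, hq⟩ => ⟨Agree.trans
      (ht.weaken ?_ ?_) (hr.weaken ?_ ?_), hq⟩ <;> intro a ha <;> simp [natArrays, numArrays, ha]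
  | branch b c d ihc ihd =>
    intro Q s hw
    refine ⟨fun hb => (ihc (hw.1 hb)).mono fun t ⟨ht, hq⟩ => ⟨ht.weaken ?_ ?_, hq⟩,
      fun hb => (ihd (hw.2 hb)).mono fun t ⟨ht, hq⟩ => ⟨ht.weaken ?_ ?_, hq⟩⟩ <;>
      intro a ha <;> simp [natArrays, numArrays, ha]
  | loop b c ih =>
    rintro Q s ⟨Inv, ⟨m, hm, h0⟩, h1⟩
    refine ⟨fun m t => c.Agree s t ∧ Inv m t, ⟨m, hm, Agree.refl _ _, h0⟩, ?_⟩
    rintro m s' ⟨hs, hi⟩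
    refine ⟨fun hb => ⟨⟨hs.nat, hs.num⟩, (h1 m s' hi).1 hb⟩, fun hb => ?_⟩
    obtain ⟨m', rfl, hw⟩ := (h1 m s' hi).2 hb
    exact ⟨m', rfl, (ih hw).mono fun t ⟨ht, hi'⟩ => ⟨hs.trans ht, hi'⟩⟩

/-- A program that satisfies its specification halts after at most `c.time.eval N` steps and
respects the bounds `N` and `R` on the way. -/
theorem wp.sound {Ok : State → Prop} (hOk : ∀ s : State, s.Bounded N R → Ok s) {c : Prog} :
    ∀ {Q : State → Prop} {s : State}, s.Bounded N R → c.wp N R Q s →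
      ∃ k t, Exec Ok c s k t ∧ k ≤ c.time.eval N ∧ Q t ∧ t.Bounded N R := by
  induction c with
  | skip => intro Q s hs hw; exact ⟨_, _, Exec.skip s, by simp [time], hw, hs⟩
  | setNat a i j e =>
    intro Q s hs hw
    have hb : (s.setNat a (i.eval s) (j.eval s) (e.eval s)).Bounded N R := by
      refine ⟨fun a' i' j' => ?_, hs.2⟩
      simp only [State.setNat]
      split_ifs
      · exact hw.1
      · exact hs.1 _ _ _
    exact ⟨_, _, Exec.setNat s a i j e (hOk _ hb), by simp [time], hw.2, hb⟩
  | setNum a i j e =>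
    intro Q s hs hw
    have hb : (s.setNum a (i.eval s) (j.eval s) (e.eval s)).Bounded N R := by
      refine ⟨hs.1, fun a' i' j' => ?_⟩
      simp only [State.setNum]
      split_ifs
      · exact hw.1
      · exact hs.2 _ _ _
    exact ⟨_, _, Exec.setNum s a i j e (hOk _ hb), by simp [time], hw.2, hb⟩
  | seq c d ihc ihd =>
    intro Q s hs hw
    obtain ⟨k, t, h1, h2, h3, h4⟩ := ihc hs hw
    obtain ⟨k', t', h1', h2', h3', h4'⟩ := ihd h4 h3
    exact ⟨_, _, Exec.seq h1 h1', by simp only [time, Polynomial.eval_add]; omega, h3', h4'⟩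
  | branch b c d ihc ihd =>
    intro Q s hs hw
    by_cases hb : b.Holds s
    · obtain ⟨k, t, h1, h2, h3, h4⟩ := ihc hs (hw.1 hb)
      exact ⟨_, _, Exec.branchTrue hb h1, by
        simp only [time, Polynomial.eval_add, Polynomial.eval_natCast]; grind, h3, h4⟩
    · obtain ⟨k, t, h1, h2, h3, h4⟩ := ihd hs (hw.2 hb)
      exact ⟨_, _, Exec.branchFalse hb h1, by
        simp only [time, Polynomial.eval_add, Polynomial.eval_natCast]; grind, h3, h4⟩
  | loop b c ih =>
    rintro Q s hs ⟨Inv, ⟨m, hm, h0⟩, h1⟩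
    -- the number of iterations that remain bounds the time that remains
    have key : ∀ m s, s.Bounded N R → Inv m s → ∃ k t, Exec Ok (loop b c) s k t ∧
        k ≤ (m + 1) * (1 + b.cost + c.time.eval N) ∧ Q t ∧ t.Bounded N R := by
      intro m
      induction m with
      | zero =>
        intro s hs hi
        by_cases hb : b.Holds s
        · obtain ⟨m', h, -⟩ := (h1 _ s hi).2 hb
          omega
        · exact ⟨_, _, Exec.loopFalse hb, by omega, (h1 _ s hi).1 hb, hs⟩
      | succ m ihm =>
        intro s hs hi
        by_cases hb : b.Holds s
        · obtain ⟨m', h, hw⟩ := (h1 _ s hi).2 hb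
          obtain rfl : m = m' := by omega
          obtain ⟨k, t, g1, g2, g3, g4⟩ := ih hs hw
          obtain ⟨k', t', g1', g2', g3', g4'⟩ := ihm t g4 g3
          exact ⟨_, _, Exec.loopTrue hb g1 g1', by linarith, g3', g4'⟩
        · exact ⟨_, _, Exec.loopFalse hb, by nlinarith, (h1 _ s hi).1 hb, hs⟩
    obtain ⟨k, t, g1, g2, g3, g4⟩ := key m s hs h0
    refine ⟨k, t, g1, g2.trans ?_, g3, g4⟩
    simp only [time, Polynomial.eval_add, Polynomial.eval_mul, Polynomial.eval_X,
      Polynomial.eval_one, Polynomial.eval_natCast, Nat.cast_id]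
    gcongr

end Prog

/-! ### Counting loops -/

/-- The natural number in cell `(0, 0)` of array `a`. -/
abbrev NatExp.cell (a : ℕ) : NatExp := .load a (.const 0) (.const 0)

/-- `for v in 0, ..., b - 1 do c`, where `v` names the array whose cell `(0, 0)` is the loop
variable. -/
def Prog.forLoop (v : ℕ) (b : NatExp) (c : Prog) : Prog :=
  .seq (.setNat v (.const 0) (.const 0) (.const 0))
    (.loop (.not (.natLe b (.cell v)))
      (.seq c (.setNat v (.const 0) (.const 0) (.add (.cell v) (.const 1)))))

@[simp] theorem State.nat_setNat_of_ne {s : State} {a b i j v : ℕ} (h : b ≠ a) :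
    (s.setNat a i j v).nat b = s.nat b := by
  funext i' j'; simp [State.setNat, h]

@[simp] theorem State.nat_setNat_self {s : State} {a i j v i' j' : ℕ} :
    (s.setNat a i j v).nat a i' j' = if i' = i ∧ j' = j then v else s.nat a i' j' := by
  simp [State.setNat]

@[simp] theorem State.num_setNat {s : State} {a i j v : ℕ} :
    (s.setNat a i j v).num = s.num := rfl

@[simp] theorem State.num_setNum_of_ne {s : State} {a b i j : ℕ} {v : ℝ} (h : b ≠ a) :
    (s.setNum a i j v).num b = s.num b := by
  funext i' j'; simp [State.setNum, h]

@[simp] theorem State.num_setNum_self {s : State} {a i j i' j' : ℕ} {v : ℝ} :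
    (s.setNum a i j v).num a i' j' = if i' = i ∧ j' = j then v else s.num a i' j' := by
  simp [State.setNum]

@[simp] theorem State.nat_setNum {s : State} {a i j : ℕ} {v : ℝ} :
    (s.setNum a i j v).nat = s.nat := rfl

/-- The rule for counting loops. The invariant `Inv i` holds before the `i`-th iteration; `M` is
the number of iterations. -/
theorem Prog.wp_forLoop {N : ℕ} {R : ℝ → Prop} {v M : ℕ} {b : NatExp} {c : Prog}
    {Q : State → Prop} {s : State} (Inv : ℕ → State → Prop)
    (hv : v ∉ c.natArrays) (hM : M ≤ N)
    (hb : ∀ t, (forLoop v b c).Agree s t → b.eval t = M)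
    (init : Inv 0 (s.setNat v 0 0 0))
    (step : ∀ i < M, ∀ t, (forLoop v b c).Agree s t → t.nat v 0 0 = i → Inv i t →
      c.wp N R (fun t => Inv (i + 1) (t.setNat v 0 0 (i + 1))) t)
    (post : ∀ t, (forLoop v b c).Agree s t → Inv M t → Q t) :
    (forLoop v b c).wp N R Q s := by
  have hmem : v ∈ (forLoop v b c).natArrays := by simp [forLoop, natArrays]
  have hset : ∀ {t k}, (forLoop v b c).Agree s t → (forLoop v b c).Agree s (t.setNat v 0 0 k) := by
    intro t k h
    refine ⟨fun a ha => ?_, h.num⟩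
    rw [State.nat_setNat_of_ne (by rintro rfl; exact ha hmem)]
    exact h.nat a ha
  refine ⟨by simp [NatExp.eval], fun m t => m + t.nat v 0 0 = M ∧ (forLoop v b c).Agree s t ∧
    Inv (t.nat v 0 0) t, ⟨M, hM, ?_, ?_, ?_⟩, ?_⟩
  · simp [NatExp.eval]
  · exact hset (Agree.refl _ _)
  · simpa [NatExp.eval] using init
  · rintro m t ⟨h1, h2, h3⟩
    simp only [Test.Holds, NatExp.eval, hb t h2, not_le]
    refine ⟨fun h => post t h2 ?_, fun h => ⟨m - 1, by omega, ?_⟩⟩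
    · rwa [show t.nat v 0 0 = M by omega] at h3
    · refine (step _ h t h2 rfl h3).agree.mono ?_
      rintro r ⟨hr, hi⟩
      have hn : r.nat v 0 0 = t.nat v 0 0 := by rw [hr.nat v hv]
      have hr' : (forLoop v b c).Agree s r :=
        h2.trans (hr.weaken (by simp +contextual [forLoop, natArrays])
          (by simp +contextual [forLoop, numArrays]))
      refine ⟨by simp only [NatExp.eval, hn]; omega, ?_, ?_, ?_⟩
      · simp only [NatExp.eval, hn, State.nat_setNat_self, and_self, if_true]; omega
      · exact hset hr'
      · simp only [NatExp.eval, hn, State.nat_setNat_self, and_self, if_true]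
        exact hi

end RealRAM

/-! ### The size of the numbers -/

theorem ratBits_div_le {a b : ℤ} {B : ℕ} (ha : a.natAbs < 2 ^ B) (hb : b.natAbs < 2 ^ B) :
    ratBits ((a : ℚ) / b) ≤ 2 * B + 2 := by
  by_cases h0 : b = 0
  · subst h0
    simp only [ratBits, Int.cast_zero, div_zero, Rat.num_zero, Int.natAbs_zero, Nat.size_zero,
      Rat.den_zero, Nat.size_one]
    omega
  have e : (a : ℚ) / b = Rat.divInt a b := (Rat.divInt_eq_div a b).symm
  have h1 : ((a : ℚ) / b).num.natAbs < 2 ^ B := by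
    rcases eq_or_ne a 0 with rfl | h
    · simp
    · refine lt_of_le_of_lt (Nat.le_of_dvd (Int.natAbs_pos.2 h) ?_) ha
      rw [e]
      exact Int.natAbs_dvd_natAbs.2 (Rat.num_dvd a h0)
  have h2 : ((a : ℚ) / b).den < 2 ^ B := by
    refine lt_of_le_of_lt (Nat.le_of_dvd (Int.natAbs_pos.2 h0) ?_) hb
    rw [e]
    exact Int.natCast_dvd.1 (Rat.den_dvd a b)
  rw [ratBits]
  have := Nat.size_le.2 h1
  have := Nat.size_le.2 h2
  omega

namespace Market

variable {n : ℕ}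

/-- The multiples of `1 / (D * m)`, where `D` is the product of the denominators of the disagreement
utilities. If these are not all rational, no bound on the size of the numbers has to be respected,
and this is the group of all real numbers. -/
def lattice (I : Market n) (m : ℕ) : AddSubgroup ℝ where
  carrier := {r | ∀ c' : Fin n → ℚ, (∀ i, I.c i = (c' i : ℝ)) →
    ∃ k : ℤ, r * (∏ i, (c' i).den : ℕ) * m = k}
  zero_mem' := fun c' _ => ⟨0, by simp⟩
  add_mem' := by
    intro a b ha hb c' hc
    obtain ⟨k, hk⟩ := ha c' hc
    obtain ⟨l, hl⟩ := hb c' hc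
    exact ⟨k + l, by push_cast at *; rw [← hk, ← hl]; ring⟩
  neg_mem' := by
    intro a ha c' hc
    obtain ⟨k, hk⟩ := ha c' hc
    exact ⟨-k, by push_cast at *; rw [← hk]; ring⟩

theorem one_mem_lattice (I : Market n) (m : ℕ) : (1 : ℝ) ∈ I.lattice m :=
  fun c' _ => ⟨((∏ i, (c' i).den : ℕ) : ℤ) * m, by push_cast; ring⟩

theorem c_mem_lattice (I : Market n) (m : ℕ) (i : Fin n) : I.c i ∈ I.lattice m := by
  intro c' hc
  obtain ⟨d, hd⟩ := Finset.dvd_prod_of_mem (fun i => (c' i).den) (Finset.mem_univ i)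
  refine ⟨(c' i).num * d * m, ?_⟩
  have h : (c' i : ℝ) * (c' i).den = (c' i).num := by
    exact_mod_cast Rat.mul_den_eq_num (c' i)
  rw [hd, hc]
  push_cast
  rw [← h]
  ring

theorem lattice_mono (I : Market n) {m m' : ℕ} (h : m ∣ m') : I.lattice m ≤ I.lattice m' := by
  intro r hr c' hc
  obtain ⟨k, hk⟩ := hr c' hc
  obtain ⟨d, rfl⟩ := h
  exact ⟨k * d, by push_cast at *; rw [← hk]; ring⟩

/-- The levels are quotients of multiples of `1 / D` by the number of uncapped agents in a
bottleneck, so that they are multiples of `1 / (D * n!)`. -/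
theorem div_mem_lattice (I : Market n) {m m' : ℕ} (hm : m ≠ 0) (h : m ∣ m') {r : ℝ}
    (hr : r ∈ I.lattice 1) : r / m ∈ I.lattice m' := by
  refine I.lattice_mono h fun c' hc => ?_
  obtain ⟨k, hk⟩ := hr c' hc
  refine ⟨k, ?_⟩
  have : (m : ℝ) ≠ 0 := by exact_mod_cast hm
  rw [← hk]
  field_simp
  simp

/-- A bound for the size of the numbers in the memory. -/
noncomputable def bitBound : Polynomial ℕ := 12 * Polynomial.X + 8

/-- The number `r` meets the space requirements. -/
def Short (I : Market n) (r : ℝ) : Prop :=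
  ∀ c' : Fin n → ℚ, (∀ i, I.c i = (c' i : ℝ)) →
    ∃ r' : ℚ, r = (r' : ℝ) ∧ ratBits r' ≤ bitBound.eval (n ^ 2 + ∑ i, ratBits (c' i))

/-- The amounts of goods and the levels that the algorithm works with are multiples of a common
fraction, of absolute value at most `n + 1`. -/
def Regular (I : Market n) (r : ℝ) : Prop :=
  r ∈ I.lattice n.factorial ∧ |r| ≤ n + 1

/-- A regular number is `k / (D * n!)` for an integer `k` with `O(L)` bits, because `n + 1`, `D` and
`n! ≤ n ^ n` are at most `2 ^ L`, where `L` is the number of bits of the instance. -/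
theorem Regular.exists_int {I : Market n} {r : ℝ} (h : I.Regular r) {c' : Fin n → ℚ}
    (hc : ∀ i, I.c i = (c' i : ℝ)) :
    ∃ k : ℤ, r * (((∏ i, (c' i).den) * n.factorial : ℕ) : ℝ) = k ∧
      k.natAbs < 2 ^ (3 * (n ^ 2 + ∑ i, ratBits (c' i)) + 1) := by
  obtain ⟨k, hk⟩ := h.1 c' hc
  refine ⟨k, by rw [← hk]; push_cast; ring, ?_⟩
  set D := ∏ i, (c' i).den with hD
  have h1 : k.natAbs ≤ (n + 1) * (D * n.factorial) := by
    have : (k.natAbs : ℝ) ≤ (n + 1) * (D * n.factorial) := by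
      rw [Nat.cast_natAbs, Int.cast_abs, ← hk, mul_assoc, abs_mul]
      gcongr
      · exact h.2
      · rw [abs_of_nonneg (by positivity)]
    exact_mod_cast this
  have hDp : 0 < D := Finset.prod_pos fun i _ => (c' i).den_pos
  -- for `n = 0` the number of bits of the instance is zero and `D = 1`
  have h2 : D < 2 ^ (n ^ 2 + ∑ i, ratBits (c' i)) ∨ n = 0 := by
    rcases Nat.eq_zero_or_pos n with h0 | h0
    · exact Or.inr h0
    left
    refine lt_of_le_of_lt (b := 2 ^ ∑ i, ratBits (c' i)) ?_
      (Nat.pow_lt_pow_right (by norm_num) (by have := Nat.pow_pos (n := 2) h0; omega))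
    rw [hD, ← Finset.prod_pow_eq_pow_sum]
    refine Finset.prod_le_prod' fun i _ => ?_
    refine (Nat.lt_size_self (c' i).den).le.trans (Nat.pow_le_pow_right (by norm_num) ?_)
    rw [ratBits]
    omega
  rcases h2 with h2 | rfl
  · have h3 : n + 1 ≤ 2 ^ (n ^ 2 + ∑ i, ratBits (c' i)) := by
      refine (Nat.lt_two_pow_self (n := n)).trans_le (Nat.pow_le_pow_right (by norm_num) ?_)
      nlinarith [Nat.zero_le (∑ i, ratBits (c' i)), Nat.le_self_pow (n := 2) (by norm_num) n]
    have h4 : n.factorial ≤ 2 ^ (n ^ 2 + ∑ i, ratBits (c' i)) := by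
      refine (Nat.factorial_le_pow n).trans ?_
      refine (Nat.pow_le_pow_left (Nat.lt_two_pow_self (n := n)).le n).trans ?_
      rw [← pow_mul]
      refine Nat.pow_le_pow_right (by norm_num) ?_
      nlinarith [Nat.zero_le (∑ i, ratBits (c' i))]
    refine h1.trans_lt ?_
    set T := 2 ^ (n ^ 2 + ∑ i, ratBits (c' i)) with hT
    have : 2 ^ (3 * (n ^ 2 + ∑ i, ratBits (c' i)) + 1) = T * (T * T) * 2 := by
      rw [hT]; ring
    rw [this]
    have hf := n.factorial_pos
    calc (n + 1) * (D * n.factorial) < (n + 1) * (T * n.factorial) := by gcongr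
      _ ≤ T * (T * T) := by gcongr
      _ ≤ T * (T * T) * 2 := Nat.le_mul_of_pos_right _ (by norm_num)
  · simp only [Finset.univ_eq_empty, Finset.prod_empty] at hD
    simp [hD] at h1 ⊢
    omega

/-- All numbers that are assigned in the algorithm can be written in this form. -/
theorem short_of_regular {I : Market n} {p₁ p₂ p₃ p₄ p₅ p₆ : ℝ} (h₁ : I.Regular p₁)
    (h₂ : I.Regular p₂) (h₃ : I.Regular p₃) (h₄ : I.Regular p₄) (h₅ : I.Regular p₅)
    (h₆ : I.Regular p₆) : I.Short ((p₁ * p₂ + p₃ * p₄) / (p₅ * p₆)) := by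
  intro c' hc
  obtain ⟨k₁, e₁, l₁⟩ := h₁.exists_int hc
  obtain ⟨k₂, e₂, l₂⟩ := h₂.exists_int hc
  obtain ⟨k₃, e₃, l₃⟩ := h₃.exists_int hc
  obtain ⟨k₄, e₄, l₄⟩ := h₄.exists_int hc
  obtain ⟨k₅, e₅, l₅⟩ := h₅.exists_int hc
  obtain ⟨k₆, e₆, l₆⟩ := h₆.exists_int hc
  have hpos : 0 < (∏ i, (c' i).den) * n.factorial :=
    Nat.mul_pos (Finset.prod_pos fun i _ => (c' i).den_pos) n.factorial_pos
  set d : ℝ := (((∏ i, (c' i).den) * n.factorial : ℕ) : ℝ) with hd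
  have hd0 : d ≠ 0 := by rw [hd]; exact_mod_cast hpos.ne'
  set L := n ^ 2 + ∑ i, ratBits (c' i)
  set T := 2 ^ (3 * L + 1) with hT
  have hTT : 2 ^ (6 * L + 3) = 2 * (T * T) := by rw [hT]; ring
  refine ⟨((k₁ * k₂ + k₃ * k₄ : ℤ) : ℚ) / ((k₅ * k₆ : ℤ) : ℚ), ?_, ?_⟩
  · push_cast
    rw [← e₁, ← e₂, ← e₃, ← e₄, ← e₅, ← e₆]
    rw [show p₁ * d * (p₂ * d) + p₃ * d * (p₄ * d) = (p₁ * p₂ + p₃ * p₄) * (d * d) by ring,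
      show p₅ * d * (p₆ * d) = p₅ * p₆ * (d * d) by ring, mul_div_mul_right _ _ (by positivity)]
  · refine (ratBits_div_le (B := 6 * L + 3) ?_ ?_).trans ?_
    · rw [hTT]
      refine (Int.natAbs_add_le _ _).trans_lt ?_
      rw [Int.natAbs_mul, Int.natAbs_mul, two_mul]
      exact add_lt_add (Nat.mul_lt_mul'' l₁ l₂) (Nat.mul_lt_mul'' l₃ l₄)
    · rw [hTT, Int.natAbs_mul]
      have := Nat.mul_lt_mul'' l₅ l₆
      omega
    · simp [bitBound]
      omega

theorem regular_zero (I : Market n) : I.Regular 0 :=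
  ⟨zero_mem _, by simp; positivity⟩

theorem regular_one (I : Market n) : I.Regular 1 :=
  ⟨I.one_mem_lattice _, by simp⟩

theorem Regular.neg {I : Market n} {r : ℝ} (h : I.Regular r) : I.Regular (-r) :=
  ⟨neg_mem h.1, by rw [abs_neg]; exact h.2⟩

theorem Regular.short {I : Market n} {r : ℝ} (h : I.Regular r) : I.Short r := by
  have := short_of_regular h I.regular_one I.regular_zero I.regular_zero I.regular_one I.regular_one
  simpa using this

theorem Regular.short_one_div {I : Market n} {r : ℝ} (h : I.Regular r) : I.Short (1 / r) := by
  have := short_of_regular I.regular_one I.regular_one I.regular_zero I.regular_zero h I.regular_one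
  simpa using this

end Market

/-! ### Optimality conditions -/

namespace Market

variable {n : ℕ}

/-- The optimality conditions of the convex program suffice for an equilibrium and for a
Nash-bargaining solution. The latter follows from `log a - log b ≤ a / b - 1`: with respect to the
prices and offsets, no fractional matching is worth more than the perfect matching `x`. -/
theorem isEquilibrium_and_isNashBargainingSolution {I : Market n} (hu : I.Dichotomous)
    {x : Fin n → Fin n → ℝ} {p q : Fin n → ℝ} (hx : IsFractionalPerfectMatching x)
    (hp : ∀ j, 0 ≤ p j) (hq : ∀ i, 0 ≤ q i) (hc : ∀ i, I.c i < I.utility x i)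
    (hle : ∀ i j, I.u i j / (I.utility x i - I.c i) ≤ p j + q i)
    (heq : ∀ i j, 0 < x i j → I.u i j / (I.utility x i - I.c i) = p j + q i) :
    I.IsEquilibrium x p q ∧ I.IsNashBargainingSolution x := by
  have hu0 : ∀ i j, 0 ≤ I.u i j := fun i j => by rcases hu i j with h | h <;> simp [h]
  have heq' : ∀ i j, (p j + q i) * x i j = I.u i j / (I.utility x i - I.c i) * x i j := by
    intro i j
    rcases (hx.1 i j).eq_or_lt with h | h
    · simp [← h]
    · rw [heq i j h]
  have hspend : ∀ i, ∑ j, (p j + q i) * x i j = I.money x i := by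
    intro i
    simp only [heq', money]
    generalize I.utility x i - I.c i = d
    rw [utility, Finset.sum_div]
    exact Finset.sum_congr rfl fun j _ => by ring
  refine ⟨⟨hp, hq, hx, hc, fun i j hij k => ?_, hspend⟩, hx, hc, fun y hy hyc => ?_⟩
  · rw [← heq i j hij]
    have := mul_le_mul_of_nonneg_left (hle i k) (hu0 i j)
    calc _ = I.u i j * (I.u i k / (I.utility x i - I.c i)) := by ring
      _ ≤ _ := this
  · have h1 : ∀ i, Real.log (I.utility y i - I.c i) - Real.log (I.utility x i - I.c i) ≤
        I.utility y i / (I.utility x i - I.c i) - I.money x i := by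
      intro i
      have hd : 0 < I.utility x i - I.c i := sub_pos.2 (hc i)
      have hd' : 0 < I.utility y i - I.c i := sub_pos.2 (hyc i)
      rw [← Real.log_div hd'.ne' hd.ne']
      refine (Real.log_le_sub_one_of_pos (div_pos hd' hd)).trans (le_of_eq ?_)
      rw [money]
      field_simp
      ring
    have h2 : ∀ i, I.utility y i / (I.utility x i - I.c i) ≤ ∑ j, (p j + q i) * y i j := by
      intro i
      rw [utility, Finset.sum_div]
      refine Finset.sum_le_sum fun j _ => ?_
      have := mul_le_mul_of_nonneg_right (hle i j) (hy.1 i j)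
      calc _ = I.u i j / (I.utility x i - I.c i) * y i j := by ring
        _ ≤ _ := this
    have h3 : ∀ z : Fin n → Fin n → ℝ, ∑ i, ∑ j, (p j + q i) * z i j =
        ∑ j, p j * ∑ i, z i j + ∑ i, q i * ∑ j, z i j := by
      intro z
      simp only [add_mul, Finset.sum_add_distrib, Finset.mul_sum]
      rw [Finset.sum_comm]
    have h4 : ∑ i, ∑ j, (p j + q i) * y i j ≤ ∑ i, ∑ j, (p j + q i) * x i j := by
      rw [h3, h3]
      refine add_le_add (Finset.sum_le_sum fun j _ => ?_) (Finset.sum_le_sum fun i _ => ?_)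
      · rw [hx.2.2 j]
        exact mul_le_mul_of_nonneg_left (hy.2.2 j) (hp j)
      · rw [hx.2.1 i]
        exact mul_le_mul_of_nonneg_left (hy.2.1 i) (hq i)
    have h5 := Finset.sum_le_sum fun i (_ : i ∈ Finset.univ) => h1 i
    have h6 := Finset.sum_le_sum fun i (_ : i ∈ Finset.univ) => h2 i
    simp only [Finset.sum_sub_distrib] at h5
    simp only [hspend] at h4
    linarith

/-- The optimality conditions of agent `i`, for an allocation that uses only goods that the agents
like. -/
structure Optimal (I : Market n) (x : Fin n → Fin n → ℝ) (p q : Fin n → ℝ) (i : Fin n) : Prop where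
  lt : I.c i < ∑ j, x i j
  le_one : ∑ j, x i j ≤ 1
  offset_nonneg : 0 ≤ q i
  offset_eq : ∑ j, x i j < 1 → q i = 0
  le : ∀ j, I.u i j = 1 → 1 / (∑ j, x i j - I.c i) ≤ p j + q i
  eq : ∀ j, 0 < x i j → 1 / (∑ j, x i j - I.c i) = p j + q i

/-- An optimal partial allocation is completed to a perfect matching by spreading what is left of
the goods over the agents with less than one unit: these have offset zero and those goods are free,
so no such agent likes such a good. Here `o j ≤ 0` is minus what is left of good `j`, and `r i` is
what agent `i` lacks. If nothing is left, the quotient is zero by convention, as it should be. -/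
theorem isEquilibrium_completion {I : Market n} (hu : I.Dichotomous)
    {x x' : Fin n → Fin n → ℝ} {p q r o : Fin n → ℝ} (hx : ∀ i j, 0 ≤ x i j)
    (hl : ∀ i j, 0 < x i j → I.u i j = 1) (ho : ∀ j, o j + 1 = ∑ i, x i j) (ho' : ∀ j, o j ≤ 0)
    (hr : ∀ i, r i = 1 - ∑ j, x i j) (hp : ∀ j, 0 ≤ p j) (hpo : ∀ j, o j < 0 → p j = 0)
    (hopt : ∀ i, I.Optimal x p q i)
    (hx' : ∀ i j, x' i j = x i j - r i * o j / (- ∑ k, o k)) :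
    I.IsEquilibrium x' p q ∧ I.IsNashBargainingSolution x' := by
  have hr0 : ∀ i, 0 ≤ r i := fun i => by rw [hr]; linarith [(hopt i).le_one]
  have hs : ∑ i, r i = - ∑ k, o k := by
    have : ∀ k, o k = ∑ i, x i k - 1 := fun k => by linarith [ho k]
    simp only [hr, this, Finset.sum_sub_distrib]
    rw [Finset.sum_comm]
    ring
  have hs0 : 0 ≤ - ∑ k, o k := by rw [← hs]; exact Finset.sum_nonneg fun i _ => hr0 i
  have hadd : ∀ i j, 0 ≤ - (r i * o j / (- ∑ k, o k)) := fun i j => by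
    rw [← neg_div]
    exact div_nonneg (by nlinarith [hr0 i, ho' j]) hs0
  -- an agent that lacks something does not like a good of which something is left
  have hzero : ∀ i j, I.u i j = 1 → r i * o j = 0 := by
    intro i j hij
    by_contra hne
    have h1 : r i ≠ 0 := fun h => hne (by simp [h])
    have h2 : o j ≠ 0 := fun h => hne (by simp [h])
    have h3 := (hopt i).offset_eq (by
      have := lt_of_le_of_ne (hr0 i) h1.symm
      rw [hr] at this
      linarith)
    have h4 := hpo j (lt_of_le_of_ne (ho' j) h2)
    have h5 := (hopt i).le j hij
    rw [h3, h4] at h5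
    have := one_div_pos.2 (sub_pos.2 (hopt i).lt)
    linarith
  have hutil : ∀ i, I.utility x' i = ∑ j, x i j := by
    intro i
    refine Finset.sum_congr rfl fun j _ => ?_
    rw [hx']
    rcases hu i j with h | h
    · rcases (hx i j).eq_or_lt with h' | h'
      · rw [h, ← h', zero_mul]
      · rw [hl i j h'] at h
        exact absurd h one_ne_zero
    · rw [hzero i j h, h]
      simp
  have hrow : ∀ i, ∑ j, x' i j = 1 := by
    intro i
    simp only [hx', Finset.sum_sub_distrib, ← Finset.sum_div, ← Finset.mul_sum]
    rcases eq_or_ne (∑ k, o k) 0 with h | h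
    · have : r i = 0 := by
        rw [h, neg_zero] at hs
        exact (Finset.sum_eq_zero_iff_of_nonneg fun i _ => hr0 i).1 hs i (Finset.mem_univ i)
      rw [h, mul_zero, zero_div]
      rw [hr] at this
      linarith
    · rw [mul_div_assoc, div_neg, div_self h, hr]
      ring
  have hcol : ∀ j, ∑ i, x' i j = 1 := by
    intro j
    simp only [hx', Finset.sum_sub_distrib, ← Finset.sum_div, ← Finset.sum_mul]
    rw [hs, ← ho]
    rcases eq_or_ne (∑ k, o k) 0 with h | h
    · have : o j = 0 :=
        (Finset.sum_eq_zero_iff_of_nonpos fun i _ => ho' i).1 h j (Finset.mem_univ j)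
      simp [this]
    · field_simp
      ring
  refine isEquilibrium_and_isNashBargainingSolution hu ⟨fun i j => ?_, hrow, hcol⟩ hp
    (fun i => (hopt i).offset_nonneg) (fun i => ?_) (fun i j => ?_) (fun i j hij => ?_)
  · rw [hx']
    linarith [hx i j, hadd i j]
  · rw [hutil]
    exact (hopt i).lt
  · rw [hutil]
    rcases hu i j with h | h
    · rw [h, zero_div]
      exact add_nonneg (hp j) (hopt i).offset_nonneg
    · rw [h]
      exact (hopt i).le j h
  · rw [hutil]
    rcases (hx i j).eq_or_lt with h | h
    · have hne : r i * o j ≠ 0 := fun h' => by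
        rw [hx', ← h, h'] at hij
        simp at hij
      have h1 : r i ≠ 0 := fun h => hne (by simp [h])
      have h2 : o j ≠ 0 := fun h => hne (by simp [h])
      have h3 := (hopt i).offset_eq (by
        have := lt_of_le_of_ne (hr0 i) h1.symm
        rw [hr] at this
        linarith)
      rcases hu i j with h0 | h0
      · rw [h0, h3, hpo j (lt_of_le_of_ne (ho' j) h2)]
        simp
      · exact absurd (hzero i j h0) hne
    · rw [hl i j h]
      exact (hopt i).eq j h

end Market

/-! ### Preflows -/

namespace Market

variable {n : ℕ}

/-- The contents of the memory that matter to the algorithm. Agent `i` is uncapped (`st i = 0`): she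
demands `c i + t` units; or capped (`st i = 1`): she demands one unit; or settled (`2 ≤ st i`). Good
`j` is on sale (`g j = 0`) or settled. The labels of agents and goods are `a` and `b`, and `S`, `G`
are the agents and the goods of the last bottleneck (the entries that are not zero). `x` is the
allocation, `e` is the unsatisfied demand of the agents, and `o` is the amount by which the goods
are oversold. `p` are the prices, `q` the offsets, and `t` is the current level. -/
@[ext] structure Config (n : ℕ) where
  st : Fin n → ℕ
  g : Fin n → ℕ
  a : Fin n → ℕ
  b : Fin n → ℕ
  S : Fin n → ℕ
  G : Fin n → ℕ
  x : Fin n → Fin n → ℝ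
  e : Fin n → ℝ
  o : Fin n → ℝ
  p : Fin n → ℝ
  q : Fin n → ℝ
  t : ℝ

/-- The demand of an agent at level `t`, unless she is settled. -/
noncomputable def demand (I : Market n) (C : Config n) (t : ℝ) (i : Fin n) : ℝ :=
  if C.st i = 0 then I.c i + t else 1

/-- The part of the invariant that is not affected when the current allocation of the unsettled
agents is discarded. -/
structure Partial (I : Market n) (C : Config n) : Prop where
  x_nonneg : ∀ i j, 0 ≤ C.x i j
  likes : ∀ i j, 0 < C.x i j → I.u i j = 1
  settled_iff : ∀ i j, 0 < C.x i j → (C.st i < 2 ↔ C.g j = 0)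
  e_settled : ∀ i, 2 ≤ C.st i → C.e i = 0
  o_settled : ∀ j, C.g j ≠ 0 → C.o j = 0
  sum_settled : ∀ j, C.g j ≠ 0 → ∑ i, C.x i j = 1
  x_mem : ∀ i j, C.x i j ∈ I.lattice n.factorial

/-- A preflow with valid labels: the residual arcs, from agents to the goods on sale that they like
and from goods to the agents that hold some of them, go down by at most one level, and the goods
that are not sold out have label zero. -/
structure Preflow (I : Market n) (C : Config n) : Prop extends Partial I C where
  t_mem : C.t ∈ I.lattice n.factorial
  t_pos : 0 < C.t
  t_le : ∀ i, C.st i = 0 → I.c i + C.t ≤ 1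
  e_nonneg : ∀ i, 0 ≤ C.e i
  e_eq : ∀ i, C.st i < 2 → C.e i + ∑ j, C.x i j = demand I C C.t i
  o_eq : ∀ j, C.o j + 1 = ∑ i, C.x i j
  o_nonneg : ∀ j, 0 < C.b j → 0 ≤ C.o j
  a_settled : ∀ i, 0 < C.a i → C.st i < 2
  b_settled : ∀ j, 0 < C.b j → C.g j = 0
  a_le : ∀ i, C.a i ≤ 2 * n + 1
  b_le : ∀ j, C.b j ≤ 2 * n + 1
  agent_arc : ∀ i j, C.st i < 2 → I.u i j = 1 → C.g j = 0 → C.a i ≤ C.b j + 1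
  good_arc : ∀ i j, 0 < C.x i j → C.b j ≤ C.a i + 1
  e_mem : ∀ i, C.e i ∈ I.lattice n.factorial

variable {I : Market n} {C : Config n}

theorem Partial.x_eq_zero (h : Partial I C) {i j : Fin n} (hij : ¬ 0 < C.x i j) : C.x i j = 0 :=
  le_antisymm (not_lt.1 hij) (h.x_nonneg i j)

namespace Preflow

theorem demand_le_one (h : Preflow I C) (i : Fin n) : demand I C C.t i ≤ 1 := by
  unfold demand
  split_ifs with h0
  · exact h.t_le i h0
  · exact le_rfl

theorem e_le (h : Preflow I C) (i : Fin n) : C.e i ≤ 1 := by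
  by_cases hi : C.st i < 2
  · have := h.e_eq i hi
    have := h.demand_le_one i
    have := Finset.sum_nonneg fun j (_ : j ∈ Finset.univ) => h.x_nonneg i j
    linarith
  · rw [h.e_settled i (not_lt.1 hi)]
    exact zero_le_one

theorem x_le (h : Preflow I C) (i j : Fin n) : C.x i j ≤ 1 := by
  by_cases hg : C.g j = 0
  · by_cases hx : 0 < C.x i j
    · have hi := (h.settled_iff i j hx).2 hg
      have := h.e_eq i hi
      have := h.e_nonneg i
      have := h.demand_le_one i
      have := Finset.single_le_sum (fun j _ => h.x_nonneg i j) (Finset.mem_univ j)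
      linarith
    · rw [h.x_eq_zero hx]
      exact zero_le_one
  · rw [← h.sum_settled j hg]
    exact Finset.single_le_sum (fun i _ => h.x_nonneg i j) (Finset.mem_univ i)

theorem o_mem (h : Preflow I C) (j : Fin n) : C.o j ∈ I.lattice n.factorial := by
  rw [eq_sub_of_add_eq (h.o_eq j)]
  exact sub_mem (sum_mem fun i _ => h.x_mem i j) (I.one_mem_lattice _)

theorem regular_e (h : Preflow I C) (i : Fin n) : I.Regular (C.e i) :=
  ⟨h.e_mem i, by rw [abs_of_nonneg (h.e_nonneg i)]; linarith [h.e_le i, Nat.cast_nonneg (α := ℝ) n]⟩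

theorem regular_x (h : Preflow I C) (i j : Fin n) : I.Regular (C.x i j) :=
  ⟨h.x_mem i j, by
    rw [abs_of_nonneg (h.x_nonneg i j)]; linarith [h.x_le i j, Nat.cast_nonneg (α := ℝ) n]⟩

theorem regular_o (h : Preflow I C) (j : Fin n) : I.Regular (C.o j) := by
  refine ⟨h.o_mem j, abs_le.2 ⟨?_, ?_⟩⟩
  · have := Finset.sum_nonneg fun i (_ : i ∈ Finset.univ) => h.x_nonneg i j
    linarith [h.o_eq j, Nat.cast_nonneg (α := ℝ) n]
  · have := Finset.sum_le_sum fun i (_ : i ∈ Finset.univ) => h.x_le i j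
    simp at this
    linarith [h.o_eq j]

end Preflow

/-- Agent `i` gets `δ` more units of good `j`: a push from the agent to the good, or back if `δ` is
negative. -/
noncomputable def Config.shift (C : Config n) (i j : Fin n) (δ : ℝ) : Config n :=
  { C with
    x := fun i' j' => if i' = i ∧ j' = j then C.x i j + δ else C.x i' j'
    e := fun i' => if i' = i then C.e i - δ else C.e i'
    o := fun j' => if j' = j then C.o j + δ else C.o j' }

/-- Agent `i` moves up one level. -/
def Config.liftAgent (C : Config n) (i : Fin n) : Config n :=
  { C with a := fun i' => if i' = i then C.a i + 1 else C.a i' }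

/-- Good `j` moves up one level. -/
def Config.liftGood (C : Config n) (j : Fin n) : Config n :=
  { C with b := fun j' => if j' = j then C.b j + 1 else C.b j' }

theorem Config.sum_shift_row (C : Config n) (i j i' : Fin n) (δ : ℝ) :
    ∑ j', (C.shift i j δ).x i' j' = ∑ j', C.x i' j' + if i' = i then δ else 0 := by
  have : ∀ j', (C.shift i j δ).x i' j' =
      C.x i' j' + if j' = j then (if i' = i then δ else 0) else 0 := by
    intro j'
    simp only [shift]
    by_cases h1 : i' = i <;> by_cases h2 : j' = j <;> simp [h1, h2]
  simp only [this, Finset.sum_add_distrib, Finset.sum_ite_eq', Finset.mem_univ, if_true]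

theorem Config.sum_shift_column (C : Config n) (i j j' : Fin n) (δ : ℝ) :
    ∑ i', (C.shift i j δ).x i' j' = ∑ i', C.x i' j' + if j' = j then δ else 0 := by
  have : ∀ i', (C.shift i j δ).x i' j' =
      C.x i' j' + if i' = i then (if j' = j then δ else 0) else 0 := by
    intro i'
    simp only [shift]
    by_cases h1 : i' = i <;> by_cases h2 : j' = j <;> simp [h1, h2]
  simp only [this, Finset.sum_add_distrib, Finset.sum_ite_eq', Finset.mem_univ, if_true]

/-- A push along an arc between an unsettled agent and a good on sale preserves the invariant, if it
does not create a residual arc that goes down by more than one level and if a good with a positive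
label remains sold out. -/
theorem Preflow.shift (h : Preflow I C) {i j : Fin n} {δ : ℝ} (hi : C.st i < 2) (hj : C.g j = 0)
    (hl : I.u i j = 1) (hx : 0 ≤ C.x i j + δ) (he : δ ≤ C.e i) (hm : δ ∈ I.lattice n.factorial)
    (hxb : 0 < C.x i j + δ → C.b j ≤ C.a i + 1) (hb : 0 < C.b j → 0 ≤ C.o j + δ) :
    Preflow I (C.shift i j δ) where
  x_nonneg i' j' := by
    simp only [Config.shift]
    split_ifs
    · exact hx
    · exact h.x_nonneg i' j'
  likes i' j' h' := by
    simp only [Config.shift] at h'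
    split_ifs at h' with h0
    · rw [h0.1, h0.2, hl]
    · exact h.likes i' j' h'
  settled_iff i' j' h' := by
    simp only [Config.shift] at h' ⊢
    split_ifs at h' with h0
    · rw [h0.1, h0.2]
      exact iff_of_true hi hj
    · exact h.settled_iff i' j' h'
  e_settled i' h' := by
    simp only [Config.shift] at h' ⊢
    split_ifs with h0
    · rw [h0] at h'
      omega
    · exact h.e_settled i' h'
  o_settled j' h' := by
    simp only [Config.shift] at h' ⊢
    split_ifs with h0
    · rw [h0] at h'
      exact absurd hj h'
    · exact h.o_settled j' h'
  sum_settled j' h' := by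
    rw [Config.sum_shift_column, if_neg, add_zero]
    · exact h.sum_settled j' h'
    · rintro rfl
      exact h' hj
  x_mem i' j' := by
    simp only [Config.shift]
    split_ifs
    · exact add_mem (h.x_mem _ _) hm
    · exact h.x_mem i' j'
  t_mem := h.t_mem
  t_pos := h.t_pos
  t_le := h.t_le
  e_nonneg i' := by
    simp only [Config.shift]
    split_ifs
    · linarith
    · exact h.e_nonneg i'
  e_eq i' h' := by
    rw [Config.sum_shift_row]
    refine Eq.trans ?_ (h.e_eq i' h')
    simp only [Config.shift]
    split_ifs with h0
    · rw [h0]; ring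
    · ring
  o_eq j' := by
    rw [Config.sum_shift_column, ← h.o_eq]
    simp only [Config.shift]
    split_ifs with h0
    · rw [h0]; ring
    · ring
  o_nonneg j' h' := by
    simp only [Config.shift] at h' ⊢
    split_ifs with h0
    · rw [h0] at h'
      exact hb h'
    · exact h.o_nonneg j' h'
  a_settled := h.a_settled
  b_settled := h.b_settled
  a_le := h.a_le
  b_le := h.b_le
  agent_arc := h.agent_arc
  good_arc i' j' h' := by
    simp only [Config.shift] at h' ⊢
    split_ifs at h' with h0
    · rw [h0.1, h0.2]
      exact hxb h'
    · exact h.good_arc i' j' h'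
  e_mem i' := by
    simp only [Config.shift]
    split_ifs
    · exact sub_mem (h.e_mem _) hm
    · exact h.e_mem i'

/-- An agent with unsatisfied demand may be lifted if no residual arc leaves her for the level
below. -/
theorem Preflow.liftAgent (h : Preflow I C) {i : Fin n} (he : 0 < C.e i)
    (ha : C.a i + 1 ≤ 2 * n + 1) (hadm : ∀ j, I.u i j = 1 → C.g j = 0 → C.a i ≠ C.b j + 1) :
    Preflow I (C.liftAgent i) :=
  { h with
    a_settled := fun i' h' => by
      simp only [Config.liftAgent] at h' ⊢
      split_ifs at h' with h0
      · by_contra hc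
        rw [h0] at hc
        exact he.ne' (h.e_settled i (not_lt.1 hc))
      · exact h.a_settled i' h'
    a_le := fun i' => by
      simp only [Config.liftAgent]
      split_ifs
      · exact ha
      · exact h.a_le i'
    agent_arc := fun i' j h1 h2 h3 => by
      simp only [Config.liftAgent] at h1 h3 ⊢
      have := h.agent_arc i' j h1 h2 h3
      split_ifs with h0
      · subst h0
        have := hadm j h2 h3
        omega
      · exact this
    good_arc := fun i' j h' => by
      have := h.good_arc i' j h'
      simp only [Config.liftAgent]
      split_ifs with h0
      · subst h0
        omega
      · exact this }

/-- An oversold good may be lifted if no residual arc leaves it for the level below. -/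
theorem Preflow.liftGood (h : Preflow I C) {j : Fin n} (ho : 0 < C.o j) (hb : C.b j + 1 ≤ 2 * n + 1)
    (hadm : ∀ i, 0 < C.x i j → C.b j ≠ C.a i + 1) : Preflow I (C.liftGood j) :=
  { h with
    o_nonneg := fun j' h' => by
      simp only [Config.liftGood] at h' ⊢
      split_ifs at h' with h0
      · rw [h0]
        exact ho.le
      · exact h.o_nonneg j' h'
    b_settled := fun j' h' => by
      simp only [Config.liftGood] at h' ⊢
      split_ifs at h' with h0
      · by_contra hc
        rw [h0] at hc
        exact ho.ne' (h.o_settled j hc)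
      · exact h.b_settled j' h'
    b_le := fun j' => by
      simp only [Config.liftGood]
      split_ifs
      · exact hb
      · exact h.b_le j'
    agent_arc := fun i j' h1 h2 h3 => by
      simp only [Config.liftGood] at h1 h3 ⊢
      have := h.agent_arc i j' h1 h2 h3
      split_ifs with h0
      · subst h0
        omega
      · exact this
    good_arc := fun i j' h' => by
      have := h.good_arc i j' h'
      simp only [Config.liftGood]
      split_ifs with h0
      · subst h0
        have := hadm i h'
        omega
      · exact this }

/-! ### The number of pushes and lifts -/

namespace Config

/-- The sum of all labels. -/
def labelSum (C : Config n) : ℕ := ∑ i, (C.a i + C.b i)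

/-- The number of residual arcs from goods to agents that go down one level. -/
noncomputable def arcs (C : Config n) : ℕ :=
  (Finset.univ.filter fun k : Fin n × Fin n => 0 < C.x k.1 k.2 ∧ C.b k.2 = C.a k.1 + 1).card

/-- The sum of the labels of the agents and goods with an excess. -/
noncomputable def activeSum (C : Config n) : ℕ :=
  ∑ i, ((if 0 < C.e i then C.a i else 0) + if 0 < C.o i then C.b i else 0)

/-- A bound for the sum of the labels. -/
def labelBound (n : ℕ) : ℕ := n * (2 * (2 * n + 1))

/-- A bound for the potential of a preflow. -/
def potentialBound (n : ℕ) : ℕ :=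
  (labelBound n * (n * n + 1) + n * n) * (labelBound n + 1) + labelBound n

/-- The potential of a preflow encodes, in lexicographic order, that lifts increase the sum of the
labels, that a push which empties an arc from a good to an agent decreases the number of arcs that
go down one level, and that any other push moves an excess one level down. -/
noncomputable def potential (C : Config n) : ℕ :=
  ((labelBound n - C.labelSum) * (n * n + 1) + C.arcs) * (labelBound n + 1) + C.activeSum

theorem arcs_le (C : Config n) : C.arcs ≤ n * n :=
  (Finset.card_le_univ _).trans (by simp)

theorem activeSum_le (C : Config n) : C.activeSum ≤ C.labelSum :=
  Finset.sum_le_sum fun i _ => by split_ifs <;> omega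

theorem potential_lt {C C' : Config n} (hC : C.labelSum ≤ labelBound n)
    (hC' : C'.labelSum ≤ labelBound n)
    (h : C.labelSum < C'.labelSum ∨ C'.labelSum = C.labelSum ∧
      (C'.arcs < C.arcs ∨ C'.arcs ≤ C.arcs ∧ C'.activeSum < C.activeSum)) :
    C'.potential < C.potential := by
  have h1 := C.activeSum_le
  have h2 := C'.activeSum_le
  have h3 := C'.arcs_le
  have lex : ∀ {A A' B B' Z : ℕ}, B' ≤ Z → A' < A → A' * (Z + 1) + B' < A * (Z + 1) + B := by
    intro A A' B B' Z hB hA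
    nlinarith [Nat.mul_le_mul_right (Z + 1) hA]
  unfold potential
  rcases h with h | ⟨h, h' | ⟨h', h''⟩⟩
  · exact lex (h2.trans hC') (lex h3 (by omega))
  · exact lex (h2.trans hC') (by rw [h]; omega)
  · rw [h]
    have := Nat.mul_le_mul_right (labelBound n + 1) (Nat.add_le_add_left h'
      ((labelBound n - C.labelSum) * (n * n + 1)))
    omega

theorem potential_le (C : Config n) (hC : C.labelSum ≤ labelBound n) :
    C.potential ≤ potentialBound n := by
  unfold potential potentialBound
  gcongr
  · exact Nat.sub_le _ _
  · exact C.arcs_le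
  · exact C.activeSum_le.trans hC

end Config

theorem Preflow.labelSum_le (h : Preflow I C) : C.labelSum ≤ Config.labelBound n := by
  refine (Finset.sum_le_sum fun i _ => (Nat.add_le_add (h.a_le i) (h.b_le i))).trans ?_
  simp [Config.labelBound]
  ring_nf
  omega

theorem Preflow.potential_liftAgent (h : Preflow I C) {i : Fin n} (ha : C.a i + 1 ≤ 2 * n + 1)
    (h' : Preflow I (C.liftAgent i)) :
    (C.liftAgent i).potential < C.potential := by
  refine Config.potential_lt h.labelSum_le h'.labelSum_le (Or.inl ?_)
  refine Finset.sum_lt_sum (fun k _ => ?_) ⟨i, Finset.mem_univ i, ?_⟩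
  · simp only [Config.liftAgent]
    split_ifs with h0
    · subst h0; omega
    · exact le_rfl
  · simp [Config.liftAgent]

theorem Preflow.potential_liftGood (h : Preflow I C) {j : Fin n}
    (h' : Preflow I (C.liftGood j)) :
    (C.liftGood j).potential < C.potential := by
  refine Config.potential_lt h.labelSum_le h'.labelSum_le (Or.inl ?_)
  refine Finset.sum_lt_sum (fun k _ => ?_) ⟨j, Finset.mem_univ j, ?_⟩
  · simp only [Config.liftGood]
    split_ifs with h0
    · subst h0; omega
    · exact le_rfl
  · simp [Config.liftGood]

/-- Moving all of an excess to a lower level decreases the sum of the labels of what is active. -/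
theorem Config.activeSum_shift_lt {i j : Fin n} {δ : ℝ}
    (h : (0 < C.e i ∧ C.e i - δ ≤ 0 ∧ C.b j < C.a i) ∨
      (0 < C.o j ∧ C.o j + δ ≤ 0 ∧ C.a i < C.b j)) :
    (C.shift i j δ).activeSum < C.activeSum := by
  have key : ∀ (C : Config n), C.activeSum = (∑ k, if 0 < C.e k then C.a k else 0) +
      ∑ k, if 0 < C.o k then C.b k else 0 := fun C => Finset.sum_add_distrib
  have split : ∀ (k : Fin n) (f : Fin n → ℕ), ∑ l, f l = f k + ∑ l ∈ Finset.univ.erase k, f l :=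
    fun k f => (Finset.add_sum_erase _ f (Finset.mem_univ k)).symm
  rw [key, key, split i, split j, split i (fun k => if 0 < C.e k then C.a k else 0),
    split j (fun k => if 0 < C.o k then C.b k else 0)]
  have h1 : ∀ k ∈ Finset.univ.erase i, (if 0 < (C.shift i j δ).e k then (C.shift i j δ).a k else 0)
      = if 0 < C.e k then C.a k else 0 := by
    intro k hk
    simp [Config.shift, Finset.ne_of_mem_erase hk]
  have h2 : ∀ k ∈ Finset.univ.erase j, (if 0 < (C.shift i j δ).o k then (C.shift i j δ).b k else 0)
      = if 0 < C.o k then C.b k else 0 := by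
    intro k hk
    simp [Config.shift, Finset.ne_of_mem_erase hk]
  rw [Finset.sum_congr rfl h1, Finset.sum_congr rfl h2]
  simp only [Config.shift, if_true]
  rcases h with ⟨h3, h4, h5⟩ | ⟨h3, h4, h5⟩ <;> split_ifs <;> first | omega | (exfalso; linarith)

/-- Every push of the algorithm decreases the potential: it moves either all of an excess, or all
that the agent holds of an oversold good, and then a residual arc that goes down disappears. -/
theorem Preflow.potential_shift_lt (h : Preflow I C) {i j : Fin n} {δ : ℝ}
    (h' : Preflow I (C.shift i j δ))
    (hlt : (0 < C.e i ∧ δ = C.e i ∧ C.a i = C.b j + 1) ∨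
      (0 < C.o j ∧ 0 < C.x i j ∧ (δ = - C.o j ∨ δ = - C.x i j) ∧ C.b j = C.a i + 1)) :
    (C.shift i j δ).potential < C.potential := by
  refine Config.potential_lt h.labelSum_le h'.labelSum_le (Or.inr ⟨rfl, ?_⟩)
  have hsub : ∀ k : Fin n × Fin n, (0 < (C.shift i j δ).x k.1 k.2 ∧
      (C.shift i j δ).b k.2 = (C.shift i j δ).a k.1 + 1) →
      0 < C.x k.1 k.2 ∧ C.b k.2 = C.a k.1 + 1 := by
    rintro k ⟨h1, h2⟩
    simp only [Config.shift] at h1 h2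
    refine ⟨?_, h2⟩
    split_ifs at h1 with h0
    · rw [h0.1, h0.2] at h2 ⊢
      rcases hlt with h3 | h3
      · omega
      · exact h3.2.1
    · exact h1
  have hle : (C.shift i j δ).arcs ≤ C.arcs :=
    Finset.card_le_card fun k hk => by
      simp only [Finset.mem_filter, Finset.mem_univ, true_and] at hk ⊢
      exact hsub k hk
  rcases hlt with ⟨h1, rfl, h3⟩ | ⟨h1, h2, rfl | rfl, h4⟩
  · exact Or.inr ⟨hle, Config.activeSum_shift_lt (Or.inl ⟨h1, by simp, by omega⟩)⟩
  · exact Or.inr ⟨hle, Config.activeSum_shift_lt (Or.inr ⟨h1, by simp, by omega⟩)⟩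
  · refine Or.inl (Finset.card_lt_card ⟨fun k hk => ?_, fun hs => ?_⟩)
    · simp only [Finset.mem_filter, Finset.mem_univ, true_and] at hk ⊢
      exact hsub k hk
    · have := @hs (i, j) (by simp [h2, h4])
      simp [Config.shift] at this

/-! ### Bottlenecks -/

/-- `S` is a set of unsettled agents, and `G` a set of goods on sale that contains all goods on sale
that are liked by agents in `S`. -/
structure Closed (I : Market n) (C : Config n) (S G : Finset (Fin n)) : Prop where
  agents : ∀ i ∈ S, C.st i < 2
  goods : ∀ j ∈ G, C.g j = 0
  neighbors : ∀ i ∈ S, ∀ j, I.u i j = 1 → C.g j = 0 → j ∈ G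

/-- The uncapped agents in `S`. -/
def Config.uncapped (C : Config n) (S : Finset (Fin n)) : Finset (Fin n) :=
  S.filter fun i => C.st i = 0

/-- The demand of a set of unsettled agents is affine in the level; the slope is the number of
uncapped agents. -/
theorem sum_demand (S : Finset (Fin n)) (t t' : ℝ) :
    ∑ i ∈ S, demand I C t' i = ∑ i ∈ S, demand I C t i + (C.uncapped S).card * (t' - t) := by
  have : ∀ i, demand I C t' i = demand I C t i + if C.st i = 0 then t' - t else 0 := by
    intro i
    unfold demand
    split_ifs <;> ring
  simp only [this, Finset.sum_add_distrib, ← Finset.sum_filter, Finset.sum_const, nsmul_eq_mul,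
    Config.uncapped]

/-- The total excess of agents and goods: the unsatisfied demand and what is oversold. -/
noncomputable def Config.excess (C : Config n) : ℝ := ∑ i, C.e i + ∑ j, max (C.o j) 0

/-- The demand of a closed set of agents is in part unsatisfied and is otherwise met from its
goods. -/
theorem Preflow.sum_row (h : Preflow I C) {S G : Finset (Fin n)} (hS : Closed I C S G) :
    ∑ i ∈ S, demand I C C.t i = ∑ i ∈ S, C.e i + ∑ j ∈ G, ∑ i ∈ S, C.x i j := by
  rw [Finset.sum_comm (s := G), ← Finset.sum_add_distrib]
  refine Finset.sum_congr rfl fun i hi => ?_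
  rw [← h.e_eq i (hS.agents i hi)]
  congr 1
  refine (Finset.sum_subset (Finset.subset_univ G) fun j _ hj => ?_).symm
  by_contra hne
  have hpos := lt_of_le_of_ne (h.x_nonneg i j) (Ne.symm hne)
  exact hj (hS.neighbors i hi j (h.likes i j hpos)
    ((h.settled_iff i j hpos).1 (hS.agents i hi)))

/-- The deficiency of a closed pair, which is the demand of its agents minus the number of its
goods, is at most the total excess of a preflow. -/
theorem Preflow.sum_demand_le (h : Preflow I C) {S G : Finset (Fin n)} (hS : Closed I C S G) :
    ∑ i ∈ S, demand I C C.t i ≤ G.card + C.excess := by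
  rw [h.sum_row hS, Config.excess]
  have h1 : ∑ i ∈ S, C.e i ≤ ∑ i, C.e i :=
    Finset.sum_le_sum_of_subset_of_nonneg (Finset.subset_univ S) fun i _ _ => h.e_nonneg i
  have h2 : ∑ j ∈ G, ∑ i ∈ S, C.x i j ≤ ∑ j ∈ G, (1 + max (C.o j) 0) := by
    refine Finset.sum_le_sum fun j _ => ?_
    have h3 : ∑ i ∈ S, C.x i j ≤ ∑ i, C.x i j :=
      Finset.sum_le_sum_of_subset_of_nonneg (Finset.subset_univ S) fun i _ _ => h.x_nonneg i j
    linarith [h.o_eq j, le_max_left (C.o j) 0]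
  have h4 : ∑ j ∈ G, max (C.o j) 0 ≤ ∑ j, max (C.o j) 0 :=
    Finset.sum_le_sum_of_subset_of_nonneg (Finset.subset_univ G) fun i _ _ => le_max_right _ _
  rw [Finset.sum_add_distrib, Finset.sum_const, nsmul_eq_mul, mul_one] at h2
  linarith

/-- If no label equals `l`, then what is above level `l` is closed, as no residual arc goes down by
more than one level. -/
theorem Preflow.closed_above (h : Preflow I C) {l : ℕ} (hl : ∀ k, C.a k ≠ l ∧ C.b k ≠ l) :
    Closed I C (Finset.univ.filter fun i => l < C.a i) (Finset.univ.filter fun j => l < C.b j) where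
  agents i hi := h.a_settled i (by simp at hi; omega)
  goods j hj := h.b_settled j (by simp at hj; omega)
  neighbors i hi j h1 h2 := by
    simp only [Finset.mem_filter, Finset.mem_univ, true_and] at hi ⊢
    have := h.agent_arc i j (h.a_settled i (by omega)) h1 h2
    have := (hl j).2
    omega

/-- If no label equals `l`, and all excess is above level `l`, then the deficiency of what is above
level `l` is the total excess. By `Preflow.sum_demand_le` this is the maximum. -/
theorem Preflow.sum_demand_above (h : Preflow I C) {l : ℕ}
    (hl : ∀ k, C.a k ≠ l ∧ C.b k ≠ l) (he : ∀ i, 0 < C.e i → l < C.a i)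
    (ho : ∀ j, 0 < C.o j → l < C.b j) :
    ∑ i ∈ Finset.univ.filter (fun i => l < C.a i), demand I C C.t i =
      (Finset.univ.filter fun j => l < C.b j).card + C.excess := by
  rw [h.sum_row (h.closed_above hl), Config.excess]
  have h1 : ∑ i ∈ Finset.univ.filter (fun i => l < C.a i), C.e i = ∑ i, C.e i := by
    refine Finset.sum_subset (Finset.subset_univ _) fun i _ hi => ?_
    by_contra hne
    exact hi (by simpa using he i (lt_of_le_of_ne (h.e_nonneg i) (Ne.symm hne)))
  have h2 : ∑ j ∈ Finset.univ.filter (fun j => l < C.b j), max (C.o j) 0 = ∑ j, max (C.o j) 0 := by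
    refine Finset.sum_subset (Finset.subset_univ _) fun j _ hj => max_eq_right ?_
    by_contra hne
    exact hj (by simpa using ho j (not_le.1 hne))
  have h3 : ∀ j ∈ Finset.univ.filter (fun j => l < C.b j),
      ∑ i ∈ Finset.univ.filter (fun i => l < C.a i), C.x i j = 1 + max (C.o j) 0 := by
    intro j hj
    simp only [Finset.mem_filter, Finset.mem_univ, true_and] at hj
    rw [max_eq_left (h.o_nonneg j (by omega)), add_comm, h.o_eq j]
    refine Finset.sum_subset (Finset.subset_univ _) fun i _ hi => h.x_eq_zero fun hpos => hi ?_
    have := h.good_arc i j hpos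
    have := (hl i).1
    simp only [Finset.mem_filter, Finset.mem_univ, true_and]
    omega
  rw [Finset.sum_congr rfl h3, Finset.sum_add_distrib, h2, h1, Finset.sum_const, nsmul_eq_mul,
    mul_one]
  ring

/-- The `2 * n` labels of agents and goods do not cover `2 * n + 1` levels. -/
theorem Config.exists_gap (C : Config n) : ∃ l < 2 * n + 1, ∀ k, C.a k ≠ l ∧ C.b k ≠ l := by
  by_contra! hc
  have hsub : Finset.range (2 * n + 1) ⊆ Finset.univ.image C.a ∪ Finset.univ.image C.b := by
    intro l hl
    obtain ⟨k, hk⟩ := hc l (Finset.mem_range.1 hl)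
    by_cases h : C.a k = l
    · exact Finset.mem_union_left _ (Finset.mem_image.2 ⟨k, Finset.mem_univ k, h⟩)
    · exact Finset.mem_union_right _ (Finset.mem_image.2 ⟨k, Finset.mem_univ k, hk h⟩)
  have h1 := (Finset.card_le_card hsub).trans (Finset.card_union_le _ _)
  have h2 := Finset.card_image_le (s := (Finset.univ : Finset (Fin n))) (f := C.a)
  have h3 := Finset.card_image_le (s := (Finset.univ : Finset (Fin n))) (f := C.b)
  simp at h1 h2 h3
  omega

theorem Preflow.excess_pos (h : Preflow I C) (hne : (∃ i, 0 < C.e i) ∨ ∃ j, 0 < C.o j) :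
    0 < C.excess := by
  have h1 : 0 ≤ ∑ i, C.e i := Finset.sum_nonneg fun i _ => h.e_nonneg i
  have h2 : 0 ≤ ∑ j, max (C.o j) 0 := Finset.sum_nonneg fun j _ => le_max_right _ _
  unfold Config.excess
  rcases hne with ⟨i, hi⟩ | ⟨j, hj⟩
  · have := Finset.single_le_sum (fun i _ => h.e_nonneg i) (Finset.mem_univ i)
    linarith
  · have := Finset.single_le_sum (fun j _ => le_max_right (C.o j) 0) (Finset.mem_univ j)
    rw [max_eq_left hj.le] at this
    linarith

end Market

/-! ### Settling agents and goods -/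

namespace Market

variable {n : ℕ} {I : Market n} {C C' : Config n} {τ : ℝ}

/-- The part of the invariant that concerns the settled agents and goods and the prices. The level
`τ` is at least the levels at which agents and goods have been settled so far, and the demands of
the unsettled agents at level `τ` can be met by the goods on sale. -/
structure Settled (I : Market n) (C : Config n) (τ : ℝ) : Prop where
  pos : 0 < τ
  low : ∀ i, C.st i = 0 → I.c i + τ ≤ 1
  price_free : ∀ j, C.g j = 0 → C.p j = 0
  price : ∀ j, C.g j ≠ 0 → 1 / τ ≤ C.p j
  offset_uncapped : ∀ i, C.st i = 0 → C.q i = 0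
  offset_capped : ∀ i, C.st i = 1 → C.q i = 1 / (1 - I.c i)
  capped : ∀ i, C.st i = 1 → 1 - I.c i ≤ τ
  optimal : ∀ i, 2 ≤ C.st i → I.Optimal C.x C.p C.q i
  neighbors : ∀ i j, 2 ≤ C.st i → I.u i j = 1 → C.g j ≠ 0
  feasible : ∃ y : Fin n → Fin n → ℝ, (∀ i j, 0 ≤ y i j) ∧
    (∀ i j, C.st i < 2 → 0 < y i j → I.u i j = 1 ∧ C.g j = 0) ∧
    (∀ i, C.st i < 2 → ∑ j, y i j = demand I C τ i) ∧ ∀ j, ∑ i, y i j ≤ 1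

/-- All demands at the current level are met by the current allocation, and no good is oversold. -/
structure Complete (I : Market n) (C : Config n) : Prop extends Partial I C where
  t_pos : 0 < C.t
  t_le : ∀ i, C.st i = 0 → I.c i + C.t ≤ 1
  row : ∀ i, C.st i < 2 → ∑ j, C.x i j = demand I C C.t i
  o_eq : ∀ j, C.o j + 1 = ∑ i, C.x i j
  o_le : ∀ j, C.o j ≤ 0

/-- The agents of the last bottleneck. -/
def Config.agents (C : Config n) : Finset (Fin n) := Finset.univ.filter fun i => C.S i ≠ 0

/-- The goods of the last bottleneck. -/
def Config.goods (C : Config n) : Finset (Fin n) := Finset.univ.filter fun j => C.G j ≠ 0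

/-- The current level is the one at which the recorded bottleneck is tight, and at some higher level
`T` this bottleneck had maximum deficiency. The deficiencies at level `T` are written in terms of
the demands at the current level, by `sum_demand`. -/
structure Bottleneck (I : Market n) (C : Config n) : Prop where
  closed : Closed I C C.agents C.goods
  tight : ∑ i ∈ C.agents, demand I C C.t i = C.goods.card
  pos : 0 < (C.uncapped C.agents).card
  deficiency : ∃ T, C.t < T ∧ ∀ S G, Closed I C S G →
    ∑ i ∈ S, demand I C C.t i + (C.uncapped S).card * (T - C.t) ≤
      G.card + (C.uncapped C.agents).card * (T - C.t)

/-- No closed pair is deficient at a feasible level. -/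
theorem Settled.sum_demand_le (h : Settled I C τ) {S G : Finset (Fin n)} (hS : Closed I C S G) :
    ∑ i ∈ S, demand I C τ i ≤ G.card := by
  obtain ⟨y, h1, h2, h3, h4⟩ := h.feasible
  calc ∑ i ∈ S, demand I C τ i = ∑ i ∈ S, ∑ j ∈ G, y i j := by
        refine Finset.sum_congr rfl fun i hi => ?_
        rw [← h3 i (hS.agents i hi)]
        refine (Finset.sum_subset (Finset.subset_univ G) fun j _ hj => ?_).symm
        by_contra hne
        obtain ⟨h5, h6⟩ := h2 i j (hS.agents i hi) (lt_of_le_of_ne (h1 i j) (Ne.symm hne))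
        exact hj (hS.neighbors i hi j h5 h6)
    _ = ∑ j ∈ G, ∑ i ∈ S, y i j := Finset.sum_comm
    _ ≤ ∑ j ∈ G, 1 := Finset.sum_le_sum fun j _ =>
        (Finset.sum_le_sum_of_subset_of_nonneg (Finset.subset_univ S) fun i _ _ => h1 i j).trans
          (h4 j)
    _ = G.card := by simp

theorem Closed.congr (hst : C'.st = C.st) (hg : C'.g = C.g) {S G : Finset (Fin n)} :
    Closed I C' S G ↔ Closed I C S G :=
  ⟨fun h => ⟨by simpa [hst] using h.agents, by simpa [hg] using h.goods,
      by simpa [hg] using h.neighbors⟩,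
    fun h => ⟨by simpa [hst] using h.agents, by simpa [hg] using h.goods,
      by simpa [hg] using h.neighbors⟩⟩

theorem demand_congr (hst : C'.st = C.st) : demand I C' = demand I C := by
  funext t i
  simp [demand, hst]

/-- A step of Newton's method: a bottleneck of maximum deficiency is violated, and the level is
lowered to where it is tight. The previous bottleneck `S` is tight at the current level `t`, and had
maximum deficiency at a level `T > t`; as it does not have maximum deficiency at level `t`, the new
one has fewer uncapped agents. -/
theorem Preflow.newton (h : Preflow I C) (hs : Settled I C τ) {l : ℕ}
    (hl : ∀ k, C.a k ≠ l ∧ C.b k ≠ l) (he : ∀ i, 0 < C.e i → l < C.a i)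
    (ho : ∀ j, 0 < C.o j → l < C.b j) (hpos : 0 < C.excess)
    (hst : C'.st = C.st) (hg : C'.g = C.g) (hS : ∀ i, C'.S i ≠ 0 ↔ l < C.a i)
    (hG : ∀ j, C'.G j ≠ 0 ↔ l < C.b j)
    (ht : C'.t = (C'.goods.card - ∑ i ∈ C'.agents, demand I C 0 i) /
      (C.uncapped C'.agents).card) :
    τ ≤ C'.t ∧ C'.t ≤ C.t ∧ Bottleneck I C' ∧ (Bottleneck I C →
      (C.uncapped C'.agents).card < (C.uncapped C.agents).card) := by
  have hS' : C'.agents = Finset.univ.filter fun i => l < C.a i := by simp [Config.agents, hS]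
  have hG' : C'.goods = Finset.univ.filter fun j => l < C.b j := by simp [Config.goods, hG]
  have hcl : Closed I C C'.agents C'.goods := by
    rw [hS', hG']
    exact h.closed_above hl
  have h1 : ∑ i ∈ C'.agents, demand I C C.t i = C'.goods.card + C.excess := by
    rw [hS', hG']
    exact h.sum_demand_above hl he ho
  have h2 := hs.sum_demand_le hcl
  rw [sum_demand _ 0 τ] at h2
  set m := (C.uncapped C'.agents).card with hm
  have h3 := h1
  rw [sum_demand _ 0 C.t, ← hm] at h3
  set d := ∑ i ∈ C'.agents, demand I C 0 i with hd
  -- the demand of the bottleneck depends on the level, as it exceeds the supply at level `C.t` but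
  -- not at level `τ`
  have hm0 : (0 : ℝ) < m := by
    by_contra hc
    have : (m : ℝ) = 0 := le_antisymm (not_lt.1 hc) (Nat.cast_nonneg m)
    rw [this] at h2 h3
    linarith
  have ht' : m * C'.t = C'.goods.card - d := by
    rw [ht]
    field_simp
  have hlt : C'.t < C.t := by
    refine lt_of_mul_lt_mul_left (a := (m : ℝ)) ?_ hm0.le
    linarith
  have hex : m * (C.t - C'.t) = C.excess := by linarith
  have hunc : ∀ S, C'.uncapped S = C.uncapped S := fun S => by simp [Config.uncapped, hst]
  refine ⟨?_, hlt.le, ⟨(Closed.congr hst hg).2 hcl, ?_, ?_, C.t, hlt, fun S G hSG => ?_⟩,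
    fun hB => ?_⟩
  · refine le_of_mul_le_mul_left (a := (m : ℝ)) ?_ hm0
    linarith
  · rw [demand_congr hst, sum_demand _ 0 C'.t]
    linarith
  · rw [hunc]
    exact_mod_cast hm0
  · have h4 := h.sum_demand_le ((Closed.congr hst hg).1 hSG)
    rw [demand_congr hst, hunc, hunc, ← hm, hex, ← sum_demand]
    exact h4
  · obtain ⟨T, hT, hd'⟩ := hB.deficiency
    have h5 := hd' _ _ hcl
    rw [h1] at h5
    have h6 : (m : ℝ) < (C.uncapped C.agents).card := by
      refine lt_of_mul_lt_mul_right (a := T - C.t) ?_ (by linarith)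
      linarith
    exact_mod_cast h6

theorem Preflow.complete (h : Preflow I C) (he : ∀ i, C.e i ≤ 0) (ho : ∀ j, C.o j ≤ 0) :
    Complete I C :=
  { h with
    row := fun i hi => by
      have := h.e_eq i hi
      rwa [le_antisymm (he i) (h.e_nonneg i), zero_add] at this
    o_le := ho }

/-- If the agents of a closed pair demand all of its goods, and all demands are met, then they get
all of these goods. -/
theorem Complete.eq_of_tight (h : Complete I C) {S G : Finset (Fin n)} (hS : Closed I C S G)
    (ht : ∑ i ∈ S, demand I C C.t i = G.card) :
    (∀ j ∈ G, C.o j = 0) ∧ ∀ j ∈ G, ∀ i, 0 < C.x i j → i ∈ S := by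
  have h1 : ∑ i ∈ S, demand I C C.t i = ∑ j ∈ G, ∑ i ∈ S, C.x i j := by
    rw [Finset.sum_comm (s := G)]
    refine Finset.sum_congr rfl fun i hi => ?_
    rw [← h.row i (hS.agents i hi)]
    refine (Finset.sum_subset (Finset.subset_univ G) fun j _ hj => ?_).symm
    by_contra hne
    have hpos := lt_of_le_of_ne (h.x_nonneg i j) (Ne.symm hne)
    exact hj (hS.neighbors i hi j (h.likes i j hpos)
      ((h.settled_iff i j hpos).1 (hS.agents i hi)))
  have h2 : ∀ j ∈ G, ∑ i ∈ S, C.x i j ≤ 1 := fun j _ => by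
    have : ∑ i ∈ S, C.x i j ≤ ∑ i, C.x i j :=
      Finset.sum_le_sum_of_subset_of_nonneg (Finset.subset_univ S) fun i _ _ => h.x_nonneg i j
    linarith [h.o_eq j, h.o_le j]
  have h3 : ∀ j ∈ G, ∑ i ∈ S, C.x i j = 1 :=
    (Finset.sum_eq_sum_iff_of_le h2).1 (by rw [← h1, ht]; simp)
  have h4 : ∀ j ∈ G, ∑ i ∈ S, C.x i j + ∑ i ∈ Sᶜ, C.x i j = C.o j + 1 := fun j _ => by
    rw [Finset.sum_add_sum_compl, h.o_eq]
  have h5 : ∀ j, 0 ≤ ∑ i ∈ Sᶜ, C.x i j := fun j => Finset.sum_nonneg fun i _ => h.x_nonneg i j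
  have h6 : ∀ j ∈ G, C.o j = 0 := fun j hj => by
    linarith [h3 j hj, h4 j hj, h5 j, h.o_le j]
  refine ⟨h6, fun j hj i hij => ?_⟩
  by_contra hi
  have h7 : ∑ i ∈ Sᶜ, C.x i j = 0 := by linarith [h3 j hj, h4 j hj, h6 j hj]
  have := (Finset.sum_eq_zero_iff_of_nonneg fun i _ => h.x_nonneg i j).1 h7 i
    (Finset.mem_compl.2 hi)
  exact hij.ne' this

theorem Complete.feasible (h : Complete I C) : ∃ y : Fin n → Fin n → ℝ, (∀ i j, 0 ≤ y i j) ∧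
    (∀ i j, C.st i < 2 → 0 < y i j → I.u i j = 1 ∧ C.g j = 0) ∧
    (∀ i, C.st i < 2 → ∑ j, y i j = demand I C C.t i) ∧ ∀ j, ∑ i, y i j ≤ 1 :=
  ⟨C.x, h.x_nonneg, fun i j hi hij => ⟨h.likes i j hij, (h.settled_iff i j hij).1 hi⟩, h.row,
    fun j => by linarith [h.o_eq j, h.o_le j]⟩

/-- The agents and goods of the bottleneck are settled: the goods get the price `1 / t`, which is
subtracted from the offsets of the capped agents. -/
noncomputable def Config.settle (C : Config n) : Config n :=
  { C with
    st := fun i => if C.S i ≠ 0 then 2 else C.st i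
    g := fun j => if C.G j ≠ 0 then 1 else C.g j
    p := fun j => if C.G j ≠ 0 then 1 / C.t else C.p j
    q := fun i => if C.S i ≠ 0 ∧ C.st i = 1 then C.q i - 1 / C.t else C.q i }

/-- Settling a tight bottleneck separates it from the rest: its agents get all of its goods, and
nothing else. -/
theorem Complete.settle (h : Complete I C) (hB : Bottleneck I C)
    (he : ∀ i, C.e i = 0) : Complete I C.settle := by
  obtain ⟨h1, h2⟩ := h.eq_of_tight hB.closed hB.tight
  have hst : ∀ i, (C.settle).st i < 2 → C.S i = 0 ∧ C.st i < 2 := by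
    intro i hi
    simp only [Config.settle] at hi
    split_ifs at hi with h0
    · omega
    · exact ⟨not_not.1 h0, hi⟩
  have hg : ∀ j, (C.settle).g j ≠ 0 → j ∈ C.goods ∨ C.g j ≠ 0 := by
    intro j hj
    simp only [Config.settle] at hj
    split_ifs at hj with h0
    · exact Or.inl (by simp [Config.goods, h0])
    · exact Or.inr hj
  have ho : ∀ j, (C.settle).g j ≠ 0 → C.o j = 0 := fun j hj =>
    (hg j hj).elim (h1 j) (h.o_settled j)
  have hS : ∀ i, C.S i ≠ 0 → C.st i < 2 := fun i hi =>
    hB.closed.agents i (by simp [Config.agents, hi])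
  exact
    { x_nonneg := h.x_nonneg
      likes := h.likes
      settled_iff := fun i j hij => by
        have h3 := h.settled_iff i j hij
        by_cases hi : C.S i = 0
        · have hj : C.G j = 0 := by
            by_contra hj
            have := h2 j (by simp [Config.goods, hj]) i hij
            simp [Config.agents, hi] at this
          simp only [Config.settle, hi, hj]
          simpa using h3
        · have hj : C.G j ≠ 0 := by
            have := hB.closed.neighbors i (by simp [Config.agents, hi]) j (h.likes i j hij)
              (h3.1 (hS i hi))
            simpa [Config.goods] using this
          simp only [Config.settle, ne_eq, hi, hj, not_false_eq_true, if_true]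
          omega
      e_settled := fun i _ => he i
      o_settled := ho
      sum_settled := fun j hj => by
        have := ho j hj
        have h3 := h.o_eq j
        rw [this, zero_add] at h3
        exact h3.symm
      x_mem := h.x_mem
      t_pos := h.t_pos
      t_le := fun i hi => h.t_le i (by
        have := hst i (by omega)
        simpa [Config.settle, this.1] using hi)
      row := fun i hi => by
        have h3 := hst i hi
        have h4 := h.row i h3.2
        simp only [demand, Config.settle, h3.1, ne_eq, not_true_eq_false, if_false] at h4 ⊢
        exact h4
      o_eq := h.o_eq
      o_le := h.o_le }

/-- The agents of a tight bottleneck are optimally served when it is settled at level `t`: an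
uncapped agent has surplus `t` and pays `1 / t`, a capped agent has surplus `1 - c i ≤ t` and pays
`1 / (1 - c i)` including the offset. Goods settled before have a price of at least `1 / t`. -/
theorem Settled.settle (hs : Settled I C τ) (h : Complete I C) (hc : ∀ i, I.c i < 1)
    (hB : Bottleneck I C) (he : ∀ i, C.e i = 0) (hτ : τ ≤ C.t) : Settled I C.settle C.t := by
  obtain ⟨h1, h2⟩ := h.eq_of_tight hB.closed hB.tight
  have hS : ∀ i, C.S i ≠ 0 → C.st i < 2 := fun i hi =>
    hB.closed.agents i (by simp [Config.agents, hi])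
  have hG : ∀ j, C.G j ≠ 0 → C.g j = 0 := fun j hj =>
    hB.closed.goods j (by simp [Config.goods, hj])
  have hN : ∀ i j, C.S i ≠ 0 → I.u i j = 1 → C.g j = 0 → C.G j ≠ 0 := fun i j hi hij hj => by
    have := hB.closed.neighbors i (by simp [Config.agents, hi]) j hij hj
    simpa [Config.goods] using this
  have hst : ∀ i, (C.settle).st i < 2 → C.S i = 0 ∧ (C.settle).st i = C.st i := by
    intro i hi
    simp only [Config.settle] at hi ⊢
    split_ifs at hi ⊢ with h0
    · omega
    · exact ⟨not_not.1 h0, rfl⟩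
  have hq : ∀ i, C.S i = 0 ∨ C.st i ≠ 1 → (C.settle).q i = C.q i := by
    intro i hi
    simp only [Config.settle]
    rw [if_neg (by tauto)]
  have hp : ∀ j, C.G j = 0 → (C.settle).p j = C.p j := fun j hj => by simp [Config.settle, hj]
  have hp' : ∀ j, C.G j ≠ 0 → (C.settle).p j = 1 / C.t := fun j hj => by simp [Config.settle, hj]
  have hinv : 1 / C.t ≤ 1 / τ := one_div_le_one_div_of_le hs.pos hτ
  have hprice : ∀ j, (C.settle).g j ≠ 0 → 1 / C.t ≤ (C.settle).p j := by
    intro j hj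
    by_cases h0 : C.G j = 0
    · rw [hp j h0]
      exact hinv.trans (hs.price j (by simpa [Config.settle, h0] using hj))
    · rw [hp' j h0]
  have hg : ∀ j, C.G j ≠ 0 ∨ C.g j ≠ 0 → (C.settle).g j ≠ 0 := by
    intro j hj
    simp only [Config.settle]
    split_ifs with h0
    · omega
    · tauto
  refine ⟨h.t_pos, ?_, ?_, hprice, ?_, ?_, ?_, ?_, ?_, (h.settle hB he).feasible⟩
  · intro i hi
    exact h.t_le i ((hst i (by omega)).2 ▸ hi)
  · intro j hj
    by_cases h0 : C.G j = 0
    · rw [hp j h0]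
      exact hs.price_free j (by simpa [Config.settle, h0] using hj)
    · exact absurd hj (hg j (Or.inl h0))
  · intro i hi
    obtain ⟨h3, h4⟩ := hst i (by omega)
    rw [hq i (Or.inl h3)]
    exact hs.offset_uncapped i (h4 ▸ hi)
  · intro i hi
    obtain ⟨h3, h4⟩ := hst i (by omega)
    rw [hq i (Or.inl h3)]
    exact hs.offset_capped i (h4 ▸ hi)
  · intro i hi
    exact (hs.capped i ((hst i (by omega)).2 ▸ hi)).trans hτ
  · intro i hi
    by_cases h0 : C.S i = 0
    · have hi' : 2 ≤ C.st i := by simpa [Config.settle, h0] using hi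
      have ho := hs.optimal i hi'
      have hpj : ∀ j, I.u i j = 1 → (C.settle).p j = C.p j := fun j hj => hp j (by
        by_contra h3
        exact hs.neighbors i j hi' hj (hG j h3))
      have hqi := hq i (Or.inl h0)
      refine ⟨ho.lt, ho.le_one, ?_, ?_, fun j hj => ?_, fun j hj => ?_⟩
      · rw [hqi]; exact ho.offset_nonneg
      · rw [hqi]; exact ho.offset_eq
      · rw [hqi, hpj j hj]; exact ho.le j hj
      · rw [hqi, hpj j (h.likes i j hj)]; exact ho.eq j hj
    · have hlt := hS i h0
      have hrow := h.row i hlt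
      have hgood : ∀ j, 0 < C.x i j → (C.settle).p j = 1 / C.t := fun j hj =>
        hp' j (hN i j h0 (h.likes i j hj) ((h.settled_iff i j hj).1 hlt))
      have hlike : ∀ j, I.u i j = 1 → 1 / C.t ≤ (C.settle).p j := fun j hj => hprice j (hg j (by
        by_cases h3 : C.g j = 0
        · exact Or.inl (hN i j h0 hj h3)
        · exact Or.inr h3))
      change I.Optimal C.x C.settle.p C.settle.q i
      by_cases h3 : C.st i = 0
      · have hqi : (C.settle).q i = 0 := by
          rw [hq i (Or.inr (by omega))]
          exact hs.offset_uncapped i h3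
        simp only [demand, h3, if_true] at hrow
        have := h.t_pos
        refine ⟨?_, ?_, ?_, ?_, fun j hj => ?_, fun j hj => ?_⟩
        · rw [hrow]; linarith
        · rw [hrow]; exact h.t_le i h3
        · rw [hqi]
        · intro _; exact hqi
        · rw [hqi, hrow, add_sub_cancel_left, add_zero]; exact hlike j hj
        · rw [hqi, hrow, add_sub_cancel_left, add_zero]; exact (hgood j hj).symm
      · have h4 : C.st i = 1 := by omega
        have hqi : (C.settle).q i = 1 / (1 - I.c i) - 1 / C.t := by
          simp only [Config.settle]
          rw [if_pos ⟨h0, h4⟩, hs.offset_capped i h4]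
        simp only [demand, h3, if_false] at hrow
        have h5 := one_div_le_one_div_of_le (sub_pos.2 (hc i)) ((hs.capped i h4).trans hτ)
        refine ⟨?_, ?_, ?_, ?_, fun j hj => ?_, fun j hj => ?_⟩
        · rw [hrow]; exact hc i
        · rw [hrow]
        · rw [hqi]; linarith
        · intro h6; rw [hrow] at h6; exact absurd h6 (lt_irrefl _)
        · rw [hqi, hrow]; linarith [hlike j hj]
        · rw [hqi, hrow, hgood j hj]; ring
  · intro i j hi hij
    by_cases h0 : C.S i = 0
    · exact hg j (Or.inr (hs.neighbors i j (by simpa [Config.settle, h0] using hi) hij))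
    · by_cases h3 : C.g j = 0
      · exact hg j (Or.inl (hN i j h0 hij h3))
      · exact hg j (Or.inr h3)

/-- The uncapped agents who demand one unit are capped. -/
noncomputable def Config.cap (I : Market n) (C : Config n) : Config n :=
  { C with
    st := fun i => if C.st i = 0 ∧ 1 - I.c i ≤ C.t then 1 else C.st i
    q := fun i => if C.st i = 0 ∧ 1 - I.c i ≤ C.t then 1 / (1 - I.c i) else C.q i }

theorem Config.cap_st_lt {i : Fin n} : (C.cap I).st i < 2 ↔ C.st i < 2 := by
  simp only [cap]
  split_ifs <;> omega

/-- At level `1 - c i` it makes no difference for the demand of agent `i` whether she is capped. -/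
theorem Complete.cap (h : Complete I C) : Complete I (C.cap I) :=
  { h with
    settled_iff := fun i j hij => by rw [Config.cap_st_lt]; exact h.settled_iff i j hij
    e_settled := fun i hi => h.e_settled i (by
      rw [← not_lt] at hi ⊢
      rwa [← Config.cap_st_lt (I := I)])
    t_le := fun i hi => h.t_le i (by
      simp only [Config.cap] at hi
      split_ifs at hi
      exact hi)
    row := fun i hi => by
      have hrow := h.row i (Config.cap_st_lt.1 hi)
      refine hrow.trans ?_
      simp only [demand, Config.cap]
      by_cases h0 : C.st i = 0
      · by_cases h1 : 1 - I.c i ≤ C.t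
        · have := h.t_le i h0
          simp only [h0, h1, and_self, if_true, one_ne_zero, if_false]
          linarith
        · simp [h0, h1]
      · simp [h0] }

/-- An agent that is capped at level `t` has `1 - c i ≤ t`, and this remains true when the level is
raised. -/
theorem Settled.cap (hs : Settled I C τ) (h : Complete I C) (hτ : τ ≤ C.t) :
    Settled I (C.cap I) C.t := by
  have h0 : ∀ i, (C.cap I).st i = 0 → C.st i = 0 ∧ ¬ 1 - I.c i ≤ C.t := by
    intro i hi
    simp only [Config.cap] at hi
    split_ifs at hi with h0
    exact ⟨hi, fun h1 => h0 ⟨hi, h1⟩⟩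
  have h1 : ∀ i, (C.cap I).st i = 1 → C.st i = 0 ∧ 1 - I.c i ≤ C.t ∨ C.st i = 1 := by
    intro i hi
    simp only [Config.cap] at hi
    split_ifs at hi with h0
    · exact Or.inl h0
    · exact Or.inr hi
  have hinv : 1 / C.t ≤ 1 / τ := one_div_le_one_div_of_le hs.pos hτ
  have h2 : ∀ i, 2 ≤ (C.cap I).st i → 2 ≤ C.st i := fun i hi => by
    rw [← not_lt, Config.cap_st_lt] at hi
    omega
  have hq : ∀ i, 1 ≤ C.st i → (C.cap I).q i = C.q i := fun i hi => by
    simp only [Config.cap]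
    rw [if_neg (by omega)]
  refine ⟨h.t_pos, fun i hi => h.t_le i (h0 i hi).1, hs.price_free,
    fun j hj => hinv.trans (hs.price j hj), fun i hi => ?_, fun i hi => ?_, fun i hi => ?_,
    fun i hi => ?_, fun i j hi => hs.neighbors i j (h2 i hi), h.cap.feasible⟩
  · have := h0 i hi
    simp only [Config.cap]
    rw [if_neg (by tauto)]
    exact hs.offset_uncapped i this.1
  · rcases h1 i hi with h3 | h3
    · simp only [Config.cap]
      rw [if_pos h3]
    · rw [hq i h3.ge]
      exact hs.offset_capped i h3
  · rcases h1 i hi with h3 | h3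
    · exact h3.2
    · exact (hs.capped i h3).trans hτ
  · have ho := hs.optimal i (h2 i hi)
    have hqi := hq i (by have := h2 i hi; omega)
    refine ⟨ho.lt, ho.le_one, ?_, ?_, fun j hj => ?_, fun j hj => ?_⟩
    · rw [hqi]; exact ho.offset_nonneg
    · rw [hqi]; exact ho.offset_eq
    · rw [hqi]; exact ho.le j hj
    · rw [hqi]; exact ho.eq j hj

/-- When all agents are capped or settled, the current allocation is optimal. -/
theorem Settled.optimal_of_complete (hs : Settled I C τ) (h : Complete I C) (hc : ∀ i, I.c i < 1)
    (hU : ∀ i, C.st i ≠ 0) (i : Fin n) : I.Optimal C.x C.p C.q i := by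
  rcases lt_or_ge (C.st i) 2 with hi | hi
  · have h1 : C.st i = 1 := by have := hU i; omega
    have hrow := h.row i hi
    simp only [demand, hU i, if_false] at hrow
    have h2 := one_div_pos.2 (sub_pos.2 (hc i))
    have h3 := hs.offset_capped i h1
    refine ⟨?_, ?_, ?_, ?_, fun j hj => ?_, fun j hj => ?_⟩
    · rw [hrow]; exact hc i
    · rw [hrow]
    · rw [h3]; exact h2.le
    · intro h4; rw [hrow] at h4; exact absurd h4 (lt_irrefl _)
    · rw [hrow, h3]
      have : 0 ≤ C.p j := by
        by_cases h5 : C.g j = 0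
        · rw [hs.price_free j h5]
        · exact (one_div_nonneg.2 hs.pos.le).trans (hs.price j h5)
      linarith
    · rw [hrow, h3, hs.price_free j ((h.settled_iff i j hj).1 hi), zero_add]
  · exact hs.optimal i hi

/-- At the start nothing is settled, and a sufficiently low level is feasible. -/
theorem Feasible.settled (hu : I.Dichotomous) (hc : ∀ i, 0 ≤ I.c i) (hI : I.Feasible) (hn : 0 < n)
    (hst : ∀ i, C.st i = 0) (hg : ∀ j, C.g j = 0) (hp : ∀ j, C.p j = 0) (hq : ∀ i, C.q i = 0) :
    ∃ τ, Settled I C τ := by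
  obtain ⟨x, ⟨hx, hrow, hcol⟩, hlt⟩ := hI
  have : Nonempty (Fin n) := ⟨⟨0, hn⟩⟩
  obtain ⟨k, -, hk⟩ := Finset.exists_min_image Finset.univ (fun i => I.utility x i - I.c i)
    Finset.univ_nonempty
  -- the least surplus of an agent in a feasible allocation is a feasible level
  set τ := I.utility x k - I.c k with hτ
  have hτ0 : 0 < τ := sub_pos.2 (hlt k)
  have hle : ∀ i, I.c i + τ ≤ I.utility x i := fun i => by linarith [hk i (Finset.mem_univ i)]
  have hux : ∀ i j, 0 ≤ I.u i j * x i j ∧ I.u i j * x i j ≤ x i j := fun i j => by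
    rcases hu i j with h | h <;> simp [h, hx i j]
  have hle1 : ∀ i, I.utility x i ≤ 1 := fun i => by
    rw [← hrow i]
    exact Finset.sum_le_sum fun j _ => (hux i j).2
  have hd : ∀ i, 0 < I.c i + τ := fun i => by linarith [hc i]
  have hv : ∀ i, 0 < I.utility x i := fun i => (hd i).trans_le (hle i)
  refine ⟨τ, hτ0, fun i _ => (hle i).trans (hle1 i), fun j _ => hp j,
    fun j hj => absurd (hg j) hj, fun i _ => hq i, fun i hi => ?_, fun i hi => ?_, fun i hi => ?_,
    fun i j hi => ?_, ?_⟩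
  any_goals (rw [hst i] at hi; omega)
  -- the given allocation is scaled down, so that each agent gets exactly her demand
  refine ⟨fun i j => (I.c i + τ) / I.utility x i * (I.u i j * x i j), fun i j => ?_,
    fun i j _ hij => ⟨?_, hg j⟩, fun i _ => ?_, fun j => ?_⟩
  · exact mul_nonneg (div_pos (hd i) (hv i)).le (hux i j).1
  · rcases hu i j with h | h
    · simp [h] at hij
    · exact h
  · rw [← Finset.mul_sum, demand, if_pos (hst i)]
    exact div_mul_cancel₀ _ (hv i).ne'
  · rw [← hcol j]
    refine Finset.sum_le_sum fun i _ => ?_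
    have := mul_le_mul_of_nonneg_right ((div_le_one (hv i)).2 (hle i)) (hux i j).1
    rw [one_mul] at this
    exact this.trans (hux i j).2

end Market

/-! ### The program: pushes and lifts -/

namespace Market

open RealRAM Prog

variable {n : ℕ} {I : Market n} {C C' : Config n} {τ : ℝ} {N : ℕ}

/-- The configuration in the memory. The array `0` of natural numbers holds `n`, and the arrays `0`
and `1` of real numbers hold the utilities and the disagreement utilities. The remaining arrays are
auxiliary. Natural numbers: `8` is a flag for activity, `9` tells whether the current level comes
from a bottleneck, `10` is the number of uncapped agents, `11` a level without agents and goods,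
`12` the number of uncapped agents in a bottleneck, `13` is a flag, and `20` and `21` are the loop
variables. Real numbers: `8` is an accumulator, `9` is what the agents lack of one unit, and `10` is
the amount of a push. -/
def Config.ofState (n : ℕ) (s : State) : Config n where
  st i := s.nat 1 i 0
  g j := s.nat 2 j 0
  a i := s.nat 3 i 0
  b j := s.nat 4 j 0
  S i := s.nat 5 i 0
  G j := s.nat 6 j 0
  x i j := s.num 2 i j
  p j := s.num 3 j 0
  q i := s.num 4 i 0
  e i := s.num 5 i 0
  o j := s.num 6 j 0
  t := s.num 7 0 0

@[simp] theorem Config.ofState_setNat {s : State} {a i j v : ℕ} (h : 6 < a) :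
    Config.ofState n (s.setNat a i j v) = Config.ofState n s := by
  ext <;> simp (disch := omega) [Config.ofState]

@[simp] theorem Config.ofState_setNum {s : State} {a i j : ℕ} {v : ℝ} (h : 7 < a) :
    Config.ofState n (s.setNum a i j v) = Config.ofState n s := by
  ext <;> simp (disch := omega) [Config.ofState]

/-- The instance is in the memory. -/
structure Reads (I : Market n) (s : State) : Prop where
  n_eq : s.nat 0 0 0 = n
  u_eq : ∀ i j : Fin n, s.num 0 i j = I.u i j
  c_eq : ∀ i : Fin n, s.num 1 i 0 = I.c i

theorem Reads.agree {c : Prog} {s t : State} (h : Reads I s) (hA : c.Agree s t)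
    (h1 : 0 ∉ c.natArrays) (h2 : 0 ∉ c.numArrays) (h3 : 1 ∉ c.numArrays) : Reads I t :=
  ⟨by rw [hA.nat 0 h1, h.n_eq], by rw [hA.num 0 h2]; exact h.u_eq, by
    rw [hA.num 1 h3]; exact h.c_eq⟩

/-- What pushes and lifts do not change. -/
structure Keep (C C' : Config n) : Prop where
  st : C'.st = C.st
  g : C'.g = C.g
  S : C'.S = C.S
  G : C'.G = C.G
  p : C'.p = C.p
  q : C'.q = C.q
  t : C'.t = C.t
  row : ∀ i, 2 ≤ C.st i → C'.x i = C.x i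

theorem Keep.refl (C : Config n) : Keep C C := ⟨rfl, rfl, rfl, rfl, rfl, rfl, rfl, fun _ _ => rfl⟩

theorem Keep.shift (h : Keep C C') {i j : Fin n} {δ : ℝ} (hi : C'.st i < 2) :
    Keep C (C'.shift i j δ) :=
  { h with
    row := fun k hk => by
      rw [← h.row k hk]
      funext l
      simp only [Config.shift]
      rw [if_neg]
      rintro ⟨rfl, -⟩
      rw [h.st] at hi
      omega }

theorem Keep.liftAgent (h : Keep C C') (i : Fin n) : Keep C (C'.liftAgent i) := { h with }

theorem Keep.liftGood (h : Keep C C') (j : Fin n) : Keep C (C'.liftGood j) := { h with }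

theorem Settled.keep (hs : Settled I C τ) (h : Keep C C') : Settled I C' τ := by
  obtain ⟨h1, h2, h3, h4, h5, h6, h7, h8, h9, h10⟩ := hs
  refine ⟨h1, ?_, ?_, ?_, ?_, ?_, ?_, fun i hi => ?_, ?_, ?_⟩
  any_goals simpa only [h.st, h.g, h.p, h.q, demand_congr h.st]
  rw [h.st] at hi
  obtain ⟨g1, g2, g3, g4, g5, g6⟩ := h8 i hi
  refine ⟨?_, ?_, ?_, ?_, ?_, ?_⟩ <;> simpa only [h.row i hi, h.p, h.q]

theorem Bottleneck.keep (hB : Bottleneck I C) (h : Keep C C') : Bottleneck I C' := by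
  have h1 : C'.agents = C.agents := by simp [Config.agents, h.S]
  have h2 : C'.goods = C.goods := by simp [Config.goods, h.G]
  have h3 : ∀ S, C'.uncapped S = C.uncapped S := fun S => by simp [Config.uncapped, h.st]
  obtain ⟨h4, h5, h6, h7⟩ := hB
  refine ⟨?_, ?_, ?_, ?_⟩ <;>
    simpa only [h1, h2, h3, Closed.congr h.st h.g, demand_congr h.st, h.t]

/-- The first loop variable, which usually stands for an agent. -/
abbrev varI : NatExp := .cell 20
/-- The second loop variable, which usually stands for a good. -/
abbrev varJ : NatExp := .cell 21
/-- The number of agents. -/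
abbrev size : NatExp := .cell 0
/-- The highest label. -/
abbrev top : NatExp := .add (.mul (.const 2) size) (.const 1)
/-- Entry `i` of the vector in column `0` of the array `a` of natural numbers. -/
abbrev natAt (a : ℕ) (i : NatExp) : NatExp := .load a i (.const 0)
/-- Entry `i` of the vector in column `0` of the array `a` of real numbers. -/
abbrev numAt (a : ℕ) (i : NatExp) : NumExp := .load a i (.const 0)
/-- The real number in cell `(0, 0)` of array `a`. -/
abbrev numCell (a : ℕ) : NumExp := .load a (.const 0) (.const 0)
/-- A natural number as a real number. -/
abbrev lit (k : ℕ) : NumExp := .ofNat (.const k)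
/-- Assignment to entry `i` of the vector in column `0` of the array `a` of natural numbers. -/
abbrev setNatAt (a : ℕ) (i e : NatExp) : Prog := .setNat a i (.const 0) e
/-- Assignment to entry `i` of the vector in column `0` of the array `a` of real numbers. -/
abbrev setNumAt (a : ℕ) (i : NatExp) (e : NumExp) : Prog := .setNum a i (.const 0) e
/-- Assignment to cell `(0, 0)` of the array `a` of natural numbers. -/
abbrev setNatCell (a : ℕ) (e : NatExp) : Prog := .setNat a (.const 0) (.const 0) e
/-- Assignment to cell `(0, 0)` of the array `a` of real numbers. -/
abbrev setNumCell (a : ℕ) (e : NumExp) : Prog := .setNum a (.const 0) (.const 0) e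
/-- The test `0 < e`. -/
abbrev isPos (e : NumExp) : Test := .not (.numLe e (lit 0))
/-- The test `e = f`. -/
abbrev isEq (e f : NatExp) : Test := .and (.natLe e f) (.natLe f e)

/-- Agent `i` gets `δ` more units of good `j`, where `δ` is in array `10`, and the flag is set. -/
def shiftProg : Prog :=
  .seq (.setNum 2 varI varJ (.add (.load 2 varI varJ) (numCell 10)))
    (.seq (setNumAt 6 varJ (.add (numAt 6 varJ) (numCell 10)))
      (.seq (setNumAt 5 varI (.sub (numAt 5 varI) (numCell 10)))
        (setNatCell 8 (.const 1))))

theorem wp_shiftProg (hN : 1 ≤ N) {s : State} {i j : Fin n} {δ : ℝ} (hi : s.nat 20 0 0 = i)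
    (hj : s.nat 21 0 0 = j) (hδ : s.num 10 0 0 = δ)
    (hP : Preflow I ((Config.ofState n s).shift i j δ)) {Q : State → Prop}
    (hQ : ∀ t, Config.ofState n t = (Config.ofState n s).shift i j δ → t.nat 8 0 0 = 1 → Q t) :
    shiftProg.wp N I.Short Q s := by
  have h1 := (hP.regular_x i j).short
  have h2 := (hP.regular_o j).short
  have h3 := (hP.regular_e i).short
  simp only [Config.shift, Config.ofState, and_self, if_true] at h1 h2 h3
  simp only [shiftProg, wp, NatExp.eval, NumExp.eval, hi, hj, hδ]
  refine ⟨h1, ?_, ?_, hN, ?_⟩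
  · simpa [hδ, hj] using h2
  · simpa [hδ, hi] using h3
  · refine hQ _ ?_ (by simp)
    simp [Config.ofState, Config.shift, Fin.val_inj, hδ, hi, hj]

/-- What is preserved by a sequence of pushes and lifts that starts from `C₀`; the flag `f = 1`
records that there was at least one. -/
structure Sweep (I : Market n) (C₀ : Config n) (f : ℕ) (C : Config n) : Prop where
  preflow : Preflow I C
  keep : Keep C₀ C
  potential : C.potential + f ≤ C₀.potential

/-- All agents with an unsatisfied demand push it to goods that are one level lower, and are lifted
if something is left. -/
def agentSweep : Prog :=
  forLoop 20 size (.seq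
    (forLoop 21 size
      (.branch (.and (isPos (numAt 5 varI)) (.and (.numLe (lit 1) (.load 0 varI varJ))
          (.and (.natLe (natAt 2 varJ) (.const 0))
            (isEq (natAt 3 varI) (.add (natAt 4 varJ) (.const 1))))))
        (.seq (setNumCell 10 (numAt 5 varI)) shiftProg) .skip))
    (.branch (.and (isPos (numAt 5 varI)) (.natLe (.add (natAt 3 varI) (.const 1)) top))
      (.seq (setNatAt 3 varI (.add (natAt 3 varI) (.const 1))) (setNatCell 8 (.const 1))) .skip))

/-- If the flag is still `0` after the sweep, no agent with unsatisfied demand could be lifted, so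
that all of them have the highest label. The inner loop ensures that a lifted agent has no residual
arc to the level below. -/
theorem wp_agentSweep (hu : I.Dichotomous) (hN : 2 * n + 2 ≤ N) {s : State} (hI : Reads I s)
    {C₀ : Config n} (hs : Sweep I C₀ (s.nat 8 0 0) (Config.ofState n s)) :
    agentSweep.wp N I.Short (fun t => Sweep I C₀ (t.nat 8 0 0) (Config.ofState n t) ∧
      (t.nat 8 0 0 = 0 → ∀ i, 0 < (Config.ofState n t).e i →
        (Config.ofState n t).a i = 2 * n + 1)) s := by
  refine wp_forLoop (M := n) (fun i t => Sweep I C₀ (t.nat 8 0 0) (Config.ofState n t) ∧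
      (t.nat 8 0 0 = 0 → ∀ k : Fin n, k < i → 0 < (Config.ofState n t).e k →
        (Config.ofState n t).a k = 2 * n + 1)) (by decide) (by omega)
    (fun t hA => (hI.agree hA (by decide) (by decide) (by decide)).n_eq) ?_ ?_ ?_
  · simpa [Config.ofState] using hs
  · intro i hi t hA hti hinv
    have hI' := hI.agree hA (by decide) (by decide) (by decide)
    lift i to Fin n using hi
    refine wp_forLoop (M := n) (fun j r => Sweep I C₀ (r.nat 8 0 0) (Config.ofState n r) ∧
      (r.nat 8 0 0 = 0 → ∀ k : Fin n, k < i → 0 < (Config.ofState n r).e k →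
        (Config.ofState n r).a k = 2 * n + 1) ∧ (0 < (Config.ofState n r).e i → ∀ k : Fin n, k < j →
        I.u i k = 1 → (Config.ofState n r).g k = 0 →
          (Config.ofState n r).a i ≠ (Config.ofState n r).b k + 1))
        (by decide) (by omega)
      (fun r hA => (hI'.agree hA (by decide) (by decide) (by decide)).n_eq) ?_ ?_ ?_
    · simpa [Config.ofState] using hinv
    · intro j hj r hA' hrj ⟨h1, h2, h3⟩
      have hI'' := hI'.agree hA' (by decide) (by decide) (by decide)
      have hri : r.nat 20 0 0 = i := by rw [hA'.nat 20 (by decide), hti]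
      lift j to Fin n using hj
      refine ⟨fun hb => ?_, fun hb => ?_⟩
      · simp only [Test.Holds, NatExp.eval, NumExp.eval, hri, hrj, hI''.u_eq, Nat.cast_zero,
          Nat.cast_one, not_le, Nat.le_zero] at hb
        obtain ⟨he, hl, hg, hab⟩ := hb
        have hl : I.u i j = 1 := by
          rcases hu i j with h | h
          · rw [h] at hl; norm_num at hl
          · exact h
        refine ⟨?_, ?_⟩
        · simp only [NumExp.eval, NatExp.eval, hri]
          exact (h1.preflow.regular_e i).short
        have hst : (Config.ofState n r).st i < 2 := by
          by_contra hc
          exact he.ne' (h1.preflow.e_settled i (not_lt.1 hc))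
        have hab' : (Config.ofState n r).a i = (Config.ofState n r).b j + 1 := by
          simp only [Config.ofState]; omega
        have hP : Preflow I ((Config.ofState n r).shift i j ((Config.ofState n r).e i)) := by
          refine h1.preflow.shift hst hg hl (add_nonneg (h1.preflow.x_nonneg i j)
            (h1.preflow.e_nonneg i)) le_rfl (h1.preflow.e_mem i) (fun _ => ?_) (fun h => ?_)
          · omega
          · exact add_nonneg (h1.preflow.o_nonneg j h) (h1.preflow.e_nonneg i)
        have hlt := h1.preflow.potential_shift_lt hP (Or.inl ⟨he, rfl, hab'⟩)
        refine wp_shiftProg (I := I) (by omega) (i := i) (j := j)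
          (δ := (Config.ofState n r).e i) (by simpa using hri) (by simpa using hrj) ?_ ?_ ?_
        · simp [Config.ofState, NumExp.eval, NatExp.eval, hri]
        · simpa using hP
        · intro w hw hw8
          simp at hw
          simp [hw8, hw]
          refine ⟨⟨hP, h1.keep.shift hst, ?_⟩, fun h => ?_⟩
          · have := h1.potential
            omega
          · simp [Config.shift] at h
      · simp only [wp]
        simp
        refine ⟨h1, h2, fun he k hk => ?_⟩
        rcases hk.lt_or_eq with hk | rfl
        · exact h3 he k hk
        · intro hl hg hab
          refine hb ?_
          simp only [Config.ofState] at he hg hab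
          simp only [Test.Holds, NatExp.eval, NumExp.eval, hri, hrj, hI''.u_eq, Nat.cast_zero,
            Nat.cast_one, not_le, Nat.le_zero]
          exact ⟨he, hl.ge, hg, hab.le, hab.ge⟩
    · intro r hA' ⟨h1, h2, h3⟩
      have hI'' := hI'.agree hA' (by decide) (by decide) (by decide)
      have hri : r.nat 20 0 0 = i := by rw [hA'.nat 20 (by decide), hti]
      refine ⟨fun hb => ?_, fun hb => ?_⟩
      · simp only [Test.Holds, NatExp.eval, NumExp.eval, hri, hI''.n_eq, Nat.cast_zero,
          not_le] at hb
        obtain ⟨he, ha⟩ := hb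
        have hP := h1.preflow.liftAgent he ha (fun k => h3 he k k.2)
        have hlt := h1.preflow.potential_liftAgent ha hP
        have hw : Config.ofState n ((r.setNat 3 i 0 (r.nat 3 i 0 + 1)).setNat 8 0 0 1) =
            (Config.ofState n r).liftAgent i := by
          ext <;> simp [Config.ofState, Config.liftAgent, Fin.val_inj]
        simp only [wp, NatExp.eval, hri]
        refine ⟨by omega, by omega, ?_⟩
        simp only [ne_eq, Nat.reduceEqDiff, not_false_eq_true, State.nat_setNat_of_ne,
          State.nat_setNat_self, and_self, if_true, one_ne_zero, false_imp_iff, and_true]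
        rw [Config.ofState_setNat (by norm_num), hw]
        have := h1.potential
        exact ⟨hP, h1.keep.liftAgent i, by omega⟩
      · simp only [wp]
        simp
        refine ⟨h1, fun hf k hk he => ?_⟩
        rcases hk.lt_or_eq with hk | rfl
        · exact h2 hf k hk he
        · have := h1.preflow.a_le k
          by_contra hc
          refine hb ?_
          simp only [Config.ofState] at he this hc
          simp only [Test.Holds, NatExp.eval, NumExp.eval, hri, hI''.n_eq, Nat.cast_zero,
            not_le]
          exact ⟨he, by omega⟩
  · exact fun t _ ht => ⟨ht.1, fun hf i => ht.2 hf i i.2⟩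

/-- All oversold goods are pushed back to agents that are one level lower, and are lifted if they
remain oversold. -/
def goodSweep : Prog :=
  forLoop 21 size (.seq
    (forLoop 20 size
      (.branch (.and (isPos (numAt 6 varJ)) (.and (isPos (.load 2 varI varJ))
            (isEq (natAt 4 varJ) (.add (natAt 3 varI) (.const 1)))))
        (.seq (.branch (.numLe (.load 2 varI varJ) (numAt 6 varJ))
          (setNumCell 10 (.sub (lit 0) (.load 2 varI varJ)))
          (setNumCell 10 (.sub (lit 0) (numAt 6 varJ)))) shiftProg) .skip))
    (.branch (.and (isPos (numAt 6 varJ)) (.natLe (.add (natAt 4 varJ) (.const 1)) top))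
      (.seq (setNatAt 4 varJ (.add (natAt 4 varJ) (.const 1))) (setNatCell 8 (.const 1))) .skip))

/-- If the flag is still `0` after the sweep, no oversold good could be lifted, so that all of them
have the highest label. As the flag is `0`, nothing has changed for the agents either. -/
theorem wp_goodSweep (hN : 2 * n + 2 ≤ N) {s : State} (hI : Reads I s)
    {C₀ : Config n} (hs : Sweep I C₀ (s.nat 8 0 0) (Config.ofState n s))
    (ha : s.nat 8 0 0 = 0 → ∀ i, 0 < (Config.ofState n s).e i →
        (Config.ofState n s).a i = 2 * n + 1) :
    goodSweep.wp N I.Short (fun t => Sweep I C₀ (t.nat 8 0 0) (Config.ofState n t) ∧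
      (t.nat 8 0 0 = 0 → (∀ i, 0 < (Config.ofState n t).e i →
        (Config.ofState n t).a i = 2 * n + 1) ∧ ∀ j, 0 < (Config.ofState n t).o j →
        (Config.ofState n t).b j = 2 * n + 1)) s := by
  refine wp_forLoop (M := n) (fun j t => Sweep I C₀ (t.nat 8 0 0) (Config.ofState n t) ∧
      (t.nat 8 0 0 = 0 → ∀ i, 0 < (Config.ofState n t).e i →
        (Config.ofState n t).a i = 2 * n + 1) ∧
      (t.nat 8 0 0 = 0 → ∀ k : Fin n, k < j → 0 < (Config.ofState n t).o k →
        (Config.ofState n t).b k = 2 * n + 1)) (by decide) (by omega)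
    (fun t hA => (hI.agree hA (by decide) (by decide) (by decide)).n_eq) ?_ ?_ ?_
  · simpa using ⟨hs, ha⟩
  · intro j hj t hA htj hinv
    have hI' := hI.agree hA (by decide) (by decide) (by decide)
    lift j to Fin n using hj
    refine wp_forLoop (M := n) (fun i r => Sweep I C₀ (r.nat 8 0 0) (Config.ofState n r) ∧
      (r.nat 8 0 0 = 0 → ∀ i, 0 < (Config.ofState n r).e i →
        (Config.ofState n r).a i = 2 * n + 1) ∧
      (r.nat 8 0 0 = 0 → ∀ k : Fin n, k < j → 0 < (Config.ofState n r).o k →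
        (Config.ofState n r).b k = 2 * n + 1) ∧ (0 < (Config.ofState n r).o j →
        ∀ k : Fin n, k < i → 0 < (Config.ofState n r).x k j →
          (Config.ofState n r).b j ≠ (Config.ofState n r).a k + 1))
        (by decide) (by omega)
      (fun r hA => (hI'.agree hA (by decide) (by decide) (by decide)).n_eq) ?_ ?_ ?_
    · simpa using hinv
    · intro i hi r hA' hri ⟨h1, h2, h3, h4⟩
      have hI'' := hI'.agree hA' (by decide) (by decide) (by decide)
      have hrj : r.nat 21 0 0 = j := by rw [hA'.nat 21 (by decide), htj]
      lift i to Fin n using hi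
      refine ⟨fun hb => ?_, fun hb => ?_⟩
      · simp only [Test.Holds, NatExp.eval, NumExp.eval, hri, hrj, Nat.cast_zero,
          not_le] at hb
        obtain ⟨ho, hx, hba⟩ := hb
        set C := Config.ofState n r with hC
        have ho' : 0 < C.o j := ho
        have hx' : 0 < C.x i j := hx
        have hg : C.g j = 0 := by
          by_contra hc
          exact ho'.ne' (h1.preflow.o_settled j hc)
        have hst : C.st i < 2 := (h1.preflow.settled_iff i j hx').2 hg
        have hba' : C.b j = C.a i + 1 := by
          simp only [hC, Config.ofState]; omega
        -- a push, for both values of the amount that is moved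
        have key : ∀ δ : ℝ, (C.x i j ≤ C.o j ∧ δ = - C.x i j ∨ C.o j ≤ C.x i j ∧ δ = - C.o j) →
            ∀ r' : State, r'.nat 20 0 0 = i → r'.nat 21 0 0 = j → r'.num 10 0 0 = δ →
              Config.ofState n r' = C → shiftProg.wp N I.Short (fun t =>
                Sweep I C₀ (t.nat 8 0 0) (Config.ofState n t) ∧
                (t.nat 8 0 0 = 0 → ∀ i, 0 < (Config.ofState n t).e i →
                  (Config.ofState n t).a i = 2 * n + 1) ∧
                (t.nat 8 0 0 = 0 → ∀ k : Fin n, k < j → 0 < (Config.ofState n t).o k →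
                  (Config.ofState n t).b k = 2 * n + 1) ∧ (0 < (Config.ofState n t).o j →
                  ∀ k : Fin n, (k : ℕ) < i + 1 → 0 < (Config.ofState n t).x k j →
                    (Config.ofState n t).b j ≠ (Config.ofState n t).a k + 1)) r' := by
          intro δ hδ r' hr'i hr'j hr'δ hr'
          have hδ' : (δ = - C.o j ∨ δ = - C.x i j) ∧ 0 ≤ C.x i j + δ ∧ 0 ≤ C.o j + δ ∧ δ ≤ 0 ∧
              δ ∈ I.lattice n.factorial := by
            rcases hδ with ⟨h5, rfl⟩ | ⟨h5, rfl⟩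
            · exact ⟨Or.inr rfl, by linarith, by linarith, by linarith,
                neg_mem (h1.preflow.x_mem i j)⟩
            · exact ⟨Or.inl rfl, by linarith, by linarith, by linarith,
                neg_mem (h1.preflow.o_mem j)⟩
          obtain ⟨hd1, hd2, hd3, hd4, hd5⟩ := hδ'
          have hP : Preflow I (C.shift i j δ) :=
            h1.preflow.shift hst hg (h1.preflow.likes i j hx') hd2
              (hd4.trans (h1.preflow.e_nonneg i)) hd5 (fun _ => hba'.le) (fun _ => hd3)
          have hlt := h1.preflow.potential_shift_lt hP (Or.inr ⟨ho', hx', hd1, hba'⟩)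
          refine wp_shiftProg (I := I) (by omega) hr'i hr'j hr'δ (by rwa [hr']) ?_
          intro w hw hw8
          rw [hr'] at hw
          simp only [hw8, hw, one_ne_zero, false_imp_iff, true_and]
          refine ⟨⟨hP, h1.keep.shift hst, ?_⟩, fun h k hk hxk => ?_⟩
          · have := h1.potential
            omega
          · simp only [Config.shift, if_true] at h
            simp only [Config.shift, and_true] at hxk ⊢
            have h5 : 0 < C.x k j := by
              split_ifs at hxk with h0
              · rw [h0]; exact hx'
              · exact hxk
            rcases (Nat.lt_succ_iff.1 hk).lt_or_eq with hk | hk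
            · exact h4 ho' k hk h5
            · obtain rfl := Fin.val_injective hk
              rw [if_pos rfl] at hxk
              rcases hd1 with rfl | rfl <;> linarith
        have hreg : I.Short (0 - r.num 2 i j) ∧ I.Short (0 - r.num 6 j 0) := by
          rw [zero_sub, zero_sub]
          exact ⟨(h1.preflow.regular_x i j).neg.short, (h1.preflow.regular_o j).neg.short⟩
        refine ⟨fun hb => ⟨?_, ?_⟩, fun hb => ⟨?_, ?_⟩⟩
        · simpa only [NumExp.eval, NatExp.eval, hri, hrj, Nat.cast_zero] using hreg.1
        · simp only [Test.Holds, NumExp.eval, NatExp.eval, hri, hrj] at hb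
          refine (key _ (Or.inl ⟨hb, rfl⟩) _ (by simpa using hri) (by simpa using hrj) ?_
            (by simp [hC])).mono ?_
          · simp [NumExp.eval, NatExp.eval, hri, hrj, hC, Config.ofState]
          · intro t ht
            simpa using ht
        · simpa only [NumExp.eval, NatExp.eval, hri, hrj, Nat.cast_zero] using hreg.2
        · simp only [Test.Holds, NumExp.eval, NatExp.eval, hri, hrj, not_le] at hb
          refine (key _ (Or.inr ⟨hb.le, rfl⟩) _ (by simpa using hri) (by simpa using hrj) ?_
            (by simp [hC])).mono ?_
          · simp [NumExp.eval, NatExp.eval, hrj, hC, Config.ofState]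
          · intro t ht
            simpa using ht
      · simp only [wp]
        simp
        refine ⟨h1, h2, h3, fun ho k hk => ?_⟩
        rcases hk.lt_or_eq with hk | rfl
        · exact h4 ho k hk
        · intro hx hba
          refine hb ?_
          simp only [Config.ofState] at ho hx hba
          simp only [Test.Holds, NatExp.eval, NumExp.eval, hri, hrj, Nat.cast_zero, not_le]
          exact ⟨ho, hx, hba.le, hba.ge⟩
    · intro r hA' ⟨h1, h2, h3, h4⟩
      have hI'' := hI'.agree hA' (by decide) (by decide) (by decide)
      have hrj : r.nat 21 0 0 = j := by rw [hA'.nat 21 (by decide), htj]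
      refine ⟨fun hb => ?_, fun hb => ?_⟩
      · simp only [Test.Holds, NatExp.eval, NumExp.eval, hrj, hI''.n_eq, Nat.cast_zero,
          not_le] at hb
        obtain ⟨ho, hb⟩ := hb
        have hP := h1.preflow.liftGood ho hb (fun k => h4 ho k k.2)
        have hlt := h1.preflow.potential_liftGood hP
        have hw : Config.ofState n ((r.setNat 4 j 0 (r.nat 4 j 0 + 1)).setNat 8 0 0 1) =
            (Config.ofState n r).liftGood j := by
          ext <;> simp [Config.ofState, Config.liftGood, Fin.val_inj]
        simp only [wp, NatExp.eval, hrj]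
        refine ⟨by omega, by omega, ?_⟩
        simp only [ne_eq, Nat.reduceEqDiff, not_false_eq_true, State.nat_setNat_of_ne,
          State.nat_setNat_self, and_self, if_true, one_ne_zero, false_imp_iff, and_true]
        rw [Config.ofState_setNat (by norm_num), hw]
        have := h1.potential
        exact ⟨hP, h1.keep.liftGood j, by omega⟩
      · simp only [wp]
        simp
        refine ⟨h1, h2, fun hf k hk ho => ?_⟩
        rcases hk.lt_or_eq with hk | rfl
        · exact h3 hf k hk ho
        · have := h1.preflow.b_le k
          by_contra hc
          refine hb ?_
          simp only [Config.ofState] at ho this hc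
          simp only [Test.Holds, NatExp.eval, NumExp.eval, hrj, hI''.n_eq, Nat.cast_zero,
            not_le]
          exact ⟨ho, by omega⟩
  · exact fun t _ ht => ⟨ht.1, fun hf => ⟨ht.2.1 hf, fun j => ht.2.2 hf j j.2⟩⟩

/-! ### The program: bottlenecks -/

theorem Config.ofState_agree {c : Prog} {s t : State} (h : c.Agree s t)
    (h1 : ∀ a ≤ 6, a ∉ c.natArrays) (h2 : ∀ a ≤ 7, a ∉ c.numArrays) :
    Config.ofState n t = Config.ofState n s := by
  ext <;> simp [Config.ofState, h.nat 1 (h1 1 (by norm_num)), h.nat 2 (h1 2 (by norm_num)),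
    h.nat 3 (h1 3 (by norm_num)), h.nat 4 (h1 4 (by norm_num)), h.nat 5 (h1 5 (by norm_num)),
    h.nat 6 (h1 6 (by norm_num)), h.num 2 (h2 2 (by norm_num)), h.num 3 (h2 3 (by norm_num)),
    h.num 4 (h2 4 (by norm_num)), h.num 5 (h2 5 (by norm_num)), h.num 6 (h2 6 (by norm_num)),
    h.num 7 (h2 7 (by norm_num))]

/-- The test whether there is an unsatisfied demand or an oversold good; if so, the flag is set. -/
def activeProg : Prog :=
  forLoop 20 size (.branch (.and (.numLe (numAt 5 varI) (lit 0)) (.numLe (numAt 6 varI) (lit 0)))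
    .skip (setNatCell 8 (.const 1)))

theorem wp_activeProg (hN : 2 * n + 2 ≤ N) {s : State} (hI : Reads I s) (h8 : s.nat 8 0 0 = 0) :
    activeProg.wp N I.Short (fun t =>
      (t.nat 8 0 0 = 0 → ∀ k, (Config.ofState n t).e k ≤ 0 ∧ (Config.ofState n t).o k ≤ 0) ∧
      (t.nat 8 0 0 ≠ 0 → ∃ k, 0 < (Config.ofState n t).e k ∨ 0 < (Config.ofState n t).o k)) s := by
  refine wp_forLoop (M := n) (fun i t =>
      (t.nat 8 0 0 = 0 → ∀ k : Fin n, k < i →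
        (Config.ofState n t).e k ≤ 0 ∧ (Config.ofState n t).o k ≤ 0) ∧
      (t.nat 8 0 0 ≠ 0 → ∃ k, 0 < (Config.ofState n t).e k ∨ 0 < (Config.ofState n t).o k))
    (by decide) (by omega) (fun t hA => (hI.agree hA (by decide) (by decide) (by decide)).n_eq)
    ?_ ?_ ?_
  · simp [h8]
  · intro i hi t hA hti ⟨h1, h2⟩
    lift i to Fin n using hi
    refine ⟨fun hb => ?_, fun hb => ?_⟩
    · simp only [Test.Holds, NatExp.eval, NumExp.eval, hti, Nat.cast_zero] at hb
      simp only [wp]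
      simp
      refine ⟨fun hf k hk => ?_, h2⟩
      rcases hk.lt_or_eq with hk | rfl
      · exact h1 hf k hk
      · exact hb
    · simp only [Test.Holds, NatExp.eval, NumExp.eval, hti, Nat.cast_zero, not_and_or,
        not_le] at hb
      refine ⟨by simp [NatExp.eval]; omega, ?_⟩
      simp [NatExp.eval]
      exact ⟨i, hb⟩
  · exact fun t _ ht => ⟨fun hf k => ht.1 hf k k.2, ht.2⟩

theorem forall_lt_succ {P : Fin n → Prop} {i : Fin n} :
    (∀ k : Fin n, (k : ℕ) < i + 1 → P k) ↔ (∀ k : Fin n, (k : ℕ) < i → P k) ∧ P i := by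
  refine ⟨fun h => ⟨fun k hk => h k (by omega), h i (by omega)⟩, fun h k hk => ?_⟩
  rcases (Nat.lt_succ_iff.1 hk).lt_or_eq with hk | hk
  · exact h.1 k hk
  · rw [Fin.val_injective hk]
    exact h.2

/-- The search for a level without agents and goods; the last such level is stored in array `11`. -/
def gapProg : Prog :=
  forLoop 20 top (.seq (setNatCell 13 (.const 0)) (.seq
    (forLoop 21 size (.branch
      (.and (.not (isEq (natAt 3 varJ) varI)) (.not (isEq (natAt 4 varJ) varI)))
      .skip (setNatCell 13 (.const 1))))
    (.branch (.natLe (.cell 13) (.const 0)) (setNatCell 11 varI) .skip)))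

theorem wp_gapProg (hN : 2 * n + 2 ≤ N) {s : State} (hI : Reads I s) :
    gapProg.wp N I.Short (fun t => t.nat 11 0 0 < 2 * n + 1 ∧ ∀ k,
      (Config.ofState n t).a k ≠ t.nat 11 0 0 ∧ (Config.ofState n t).b k ≠ t.nat 11 0 0) s := by
  set C := Config.ofState n s with hC
  have hreads : ∀ {t}, gapProg.Agree s t → Reads I t := fun hA =>
    hI.agree hA (by decide) (by decide) (by decide)
  have hconf : ∀ {t}, gapProg.Agree s t → Config.ofState n t = C := fun hA =>
    Config.ofState_agree hA (by decide) (by decide)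
  refine wp_forLoop (M := 2 * n + 1) (fun i t => (∃ l < i, ∀ k, C.a k ≠ l ∧ C.b k ≠ l) →
      t.nat 11 0 0 < 2 * n + 1 ∧ ∀ k, C.a k ≠ t.nat 11 0 0 ∧ C.b k ≠ t.nat 11 0 0)
    (by decide) (by omega) (fun t hA => by simp [NatExp.eval, (hreads hA).n_eq]) ?_ ?_ ?_
  · simp
  · intro i hi t hA hti hinv
    refine ⟨by simp [NatExp.eval], ?_⟩
    have hA1 : gapProg.Agree s (t.setNat 13 0 0 0) := by
      refine ⟨fun a ha => ?_, hA.num⟩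
      rw [State.nat_setNat_of_ne (by rintro rfl; exact absurd ha (by decide))]
      exact hA.nat a ha
    refine wp_forLoop (M := n) (fun j r => ((∃ l < i, ∀ k, C.a k ≠ l ∧ C.b k ≠ l) →
        r.nat 11 0 0 < 2 * n + 1 ∧ ∀ k, C.a k ≠ r.nat 11 0 0 ∧ C.b k ≠ r.nat 11 0 0) ∧
        (r.nat 13 0 0 = 0 ↔ ∀ k : Fin n, k < j → C.a k ≠ i ∧ C.b k ≠ i))
      (by decide) (by omega) (fun r hA' => ?_) ?_ ?_ ?_
    · have := hA'.nat 0 (by decide)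
      simp only [NatExp.eval, this]
      exact (hreads hA1).n_eq
    · simpa [NatExp.eval] using hinv
    · intro j hj r hA' hrj ⟨h1, h2⟩
      lift j to Fin n using hj
      have hA2 : gapProg.Agree s r := hA1.trans (hA'.weaken (by decide) (by decide))
      have hri : r.nat 20 0 0 = i := by
        rw [hA'.nat 20 (by decide)]
        simpa [NatExp.eval] using hti
      have ha : ∀ k : Fin n, r.nat 3 k 0 = C.a k := fun k => by rw [← hconf hA2]; rfl
      have hb : ∀ k : Fin n, r.nat 4 k 0 = C.b k := fun k => by rw [← hconf hA2]; rfl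
      refine ⟨fun hb' => ?_, fun hb' => ?_⟩
      · simp only [Test.Holds, NatExp.eval, hri, hrj, ha, hb, ← le_antisymm_iff] at hb'
        simp only [wp]
        simp [-Order.lt_add_one_iff, -Order.add_one_le_iff]
        refine ⟨by simpa using h1, ?_⟩
        rw [forall_lt_succ, h2]
        exact ⟨fun h => ⟨h, hb'⟩, fun h => h.1⟩
      · simp only [Test.Holds, NatExp.eval, hri, hrj, ha, hb, ← le_antisymm_iff] at hb'
        refine ⟨by simp [NatExp.eval]; omega, ?_⟩
        simp [NatExp.eval, -Order.lt_add_one_iff, -Order.add_one_le_iff]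
        exact ⟨by simpa using h1, j, by omega, by tauto⟩
    · intro r hA' ⟨h1, h2⟩
      have hri : r.nat 20 0 0 = i := by
        rw [hA'.nat 20 (by decide)]
        simpa [NatExp.eval] using hti
      have h2' : r.nat 13 0 0 = 0 ↔ ∀ k : Fin n, C.a k ≠ i ∧ C.b k ≠ i :=
        h2.trans ⟨fun h k => h k k.2, fun h k _ => h k⟩
      refine ⟨fun hb => ?_, fun hb => ?_⟩
      · simp only [Test.Holds, NatExp.eval, Nat.le_zero] at hb
        refine ⟨by simp only [NatExp.eval, hri]; omega, fun _ => ?_⟩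
        simp only [NatExp.eval, hri]
        simpa using ⟨by omega, h2'.1 hb⟩
      · simp only [Test.Holds, NatExp.eval, Nat.le_zero] at hb
        rintro ⟨l, hl, hf⟩
        rcases (Nat.lt_succ_iff.1 hl).lt_or_eq with hl | rfl
        · simpa using h1 ⟨l, hl, hf⟩
        · exact absurd (h2'.2 hf) hb
  · intro t hA ht
    rw [hconf hA]
    exact ht C.exists_gap

/-- What is above level `l` is recorded as a bottleneck, and the level `t` is changed to where it is
tight: the root of `|G| - ∑ i ∈ S, demand i t`, which is affine in `t`. -/
noncomputable def Config.cut (I : Market n) (C : Config n) (l : ℕ) : Config n :=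
  { C with
    S := fun i => if l < C.a i then 1 else 0
    G := fun j => if l < C.b j then 1 else 0
    t := ((Finset.univ.filter fun j => l < C.b j).card -
      ∑ i ∈ Finset.univ.filter (fun i => l < C.a i), demand I C 0 i) /
        (C.uncapped (Finset.univ.filter fun i => l < C.a i)).card }

/-- What is above the level in array `11` is recorded as a bottleneck, and the level `t` is changed
to where it is tight. The numerator is accumulated in array `8`, the denominator in array `12`. -/
def cutProg : Prog :=
  .seq (setNumCell 8 (lit 0)) (.seq (setNatCell 12 (.const 0)) (.seq
    (forLoop 20 size (.seq
      (.branch (.natLe (.add (.cell 11) (.const 1)) (natAt 3 varI))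
        (.seq (setNatAt 5 varI (.const 1))
          (.branch (.natLe (natAt 1 varI) (.const 0))
            (.seq (setNumCell 8 (.sub (numCell 8) (numAt 1 varI)))
              (setNatCell 12 (.add (.cell 12) (.const 1))))
            (setNumCell 8 (.sub (numCell 8) (lit 1)))))
        (setNatAt 5 varI (.const 0)))
      (.branch (.natLe (.add (.cell 11) (.const 1)) (natAt 4 varI))
        (.seq (setNatAt 6 varI (.const 1)) (setNumCell 8 (.add (numCell 8) (lit 1))))
        (setNatAt 6 varI (.const 0)))))
    (.seq (setNumCell 7 (.div (numCell 8) (.ofNat (.cell 12)))) (setNatCell 9 (.const 1)))))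

theorem sum_ite_lt_succ {M : Type*} [AddCommMonoid M] (f : Fin n → M) (i : Fin n) :
    ∑ k : Fin n, (if (k : ℕ) < i + 1 then f k else 0) =
      ∑ k : Fin n, (if (k : ℕ) < i then f k else 0) + f i := by
  have : ∀ k : Fin n, (if (k : ℕ) < i + 1 then f k else 0) =
      (if (k : ℕ) < i then f k else 0) + if k = i then f k else 0 := by
    intro k
    rcases lt_trichotomy k i with h | h | h
    · have h' : (k : ℕ) < i := h
      simp [h', h.ne, h'.trans (Nat.lt_succ_self _)]
    · simp [h]
    · have h' : (i : ℕ) < k := h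
      rw [if_neg (by omega), if_neg (by omega), if_neg h.ne', add_zero]
  simp only [this, Finset.sum_add_distrib, Finset.sum_ite_eq', Finset.mem_univ, if_true]

theorem sum_ite_lt_mem {m : ℕ} {f : Fin n → ℝ} (h : ∀ k, f k ∈ I.lattice m) (i : ℕ) :
    ∑ k : Fin n, (if (k : ℕ) < i then f k else 0) ∈ I.lattice m :=
  sum_mem fun k _ => by
    split_ifs
    · exact h k
    · exact zero_mem _

theorem abs_sum_ite_lt_le {f : Fin n → ℝ} (h : ∀ k, |f k| ≤ 1) (i : Fin n) :
    |∑ k : Fin n, (if (k : ℕ) < i then f k else 0)| ≤ i := by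
  refine (Finset.abs_sum_le_sum_abs _ _).trans ?_
  have h1 : ∀ k : Fin n, |if (k : ℕ) < i then f k else 0| ≤ if k < i then 1 else 0 := by
    intro k
    by_cases hk : k < i
    · have hk' : (k : ℕ) < i := hk
      simpa [hk', hk] using h k
    · have hk' : ¬ (k : ℕ) < i := hk
      simp [hk', hk]
  refine (Finset.sum_le_sum fun k _ => h1 k).trans ?_
  have h2 : Finset.univ.filter (fun k => k < i) = Finset.Iio i := by ext; simp
  rw [← Finset.sum_filter, h2]
  simp

theorem wp_cutProg (hN : 2 * n + 2 ≤ N) (hc : ∀ i, 0 ≤ I.c i ∧ I.c i ≤ 1) {s : State}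
    (hI : Reads I s) {l : ℕ} (hl : s.nat 11 0 0 = l)
    (ht : I.Short ((Config.ofState n s).cut I l).t) {Q : State → Prop}
    (hQ : ∀ t, cutProg.Agree s t → Config.ofState n t = (Config.ofState n s).cut I l →
      t.nat 9 0 0 = 1 → Q t) :
    cutProg.wp N I.Short Q s := by
  refine (?_ : cutProg.wp N I.Short (fun t => Config.ofState n t = (Config.ofState n s).cut I l ∧
      t.nat 9 0 0 = 1) s).agree.mono fun t h => hQ t h.1 h.2.1 h.2.2
  set C := Config.ofState n s with hC
  -- the contributions of agent and good `k` to the numerator and to the denominator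
  set f : Fin n → ℝ := fun k => (if l < C.b k then 1 else 0) -
    if l < C.a k then demand I C 0 k else 0 with hf
  set g : Fin n → ℕ := fun k => if l < C.a k ∧ C.st k = 0 then 1 else 0 with hg
  have hdem : ∀ k, demand I C 0 k ∈ I.lattice 1 ∧ 0 ≤ demand I C 0 k ∧ demand I C 0 k ≤ 1 := by
    intro k
    unfold demand
    split_ifs
    · rw [add_zero]
      exact ⟨I.c_mem_lattice _ _, hc k⟩
    · exact ⟨I.one_mem_lattice _, zero_le_one, le_rfl⟩
  have hf1 : ∀ k, f k ∈ I.lattice 1 := by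
    intro k
    refine sub_mem ?_ ?_ <;> split_ifs
    exacts [I.one_mem_lattice _, zero_mem _, (hdem k).1, zero_mem _]
  have hf2 : ∀ k, |f k| ≤ 1 := by
    intro k
    obtain ⟨-, h1, h2⟩ := hdem k
    rw [abs_le]
    simp only [hf]
    split_ifs <;> constructor <;> linarith
  have hreg : ∀ (i : Fin n) (y : ℝ), y ∈ I.lattice 1 → |y| ≤ 1 →
      I.Short (∑ k : Fin n, (if (k : ℕ) < i then f k else 0) + y) := by
    intro i y hy1 hy2
    refine Regular.short ⟨I.lattice_mono (one_dvd _) (add_mem (sum_ite_lt_mem hf1 i) hy1), ?_⟩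
    refine (abs_add_le _ _).trans ?_
    have h1 := abs_sum_ite_lt_le hf2 i
    have h2 : ((i : ℕ) : ℝ) ≤ n := by exact_mod_cast i.2.le
    linarith
  refine ⟨by simpa [NumExp.eval, NatExp.eval] using I.regular_zero.short, by simp [NatExp.eval], ?_⟩
  refine wp_forLoop (M := n) (fun i t => (∀ k : Fin n, (k : ℕ) < i →
      t.nat 5 k 0 = (if l < C.a k then 1 else 0) ∧ t.nat 6 k 0 = if l < C.b k then 1 else 0) ∧
      t.num 8 0 0 = ∑ k : Fin n, (if (k : ℕ) < i then f k else 0) ∧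
      t.nat 12 0 0 = ∑ k : Fin n, if (k : ℕ) < i then g k else 0) (by decide) (by omega)
    (fun t hA => ?_) ?_ ?_ ?_
  · have := hA.nat 0 (by decide)
    simp only [NatExp.eval, this]
    exact hI.n_eq
  · simp [NatExp.eval, NumExp.eval]
  · intro i hi t hA hti ⟨h1, h2, h3⟩
    lift i to Fin n using hi
    have hA3 : ∀ k : Fin n, t.nat 3 k 0 = C.a k := fun k => by rw [hA.nat 3 (by decide)]; rfl
    have hA4 : ∀ k : Fin n, t.nat 4 k 0 = C.b k := fun k => by rw [hA.nat 4 (by decide)]; rfl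
    have hA1 : ∀ k : Fin n, t.nat 1 k 0 = C.st k := fun k => by rw [hA.nat 1 (by decide)]; rfl
    have hAc : ∀ k : Fin n, t.num 1 k 0 = I.c k := fun k => by
      rw [hA.num 1 (by decide)]; exact hI.c_eq k
    have hAl : t.nat 11 0 0 = l := by rw [hA.nat 11 (by decide)]; exact hl
    have hm : t.nat 12 0 0 + 1 ≤ N := by
      have : t.nat 12 0 0 ≤ ∑ k : Fin n, 1 := by
        rw [h3]
        refine Finset.sum_le_sum fun k _ => ?_
        simp only [hg]
        split_ifs <;> omega
      simp at this
      omega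
    -- the invariant after any of the branches
    have fin : ∀ r : State, (∀ k : Fin n, k ≠ i → r.nat 5 k 0 = t.nat 5 k 0 ∧
        r.nat 6 k 0 = t.nat 6 k 0) → r.nat 5 i 0 = (if l < C.a i then 1 else 0) →
        r.nat 6 i 0 = (if l < C.b i then 1 else 0) → r.num 8 0 0 = t.num 8 0 0 + f i →
        r.nat 12 0 0 = t.nat 12 0 0 + g i →
        (∀ k : Fin n, (k : ℕ) < i + 1 → (r.setNat 20 0 0 (i + 1)).nat 5 k 0 =
          (if l < C.a k then 1 else 0) ∧
          (r.setNat 20 0 0 (i + 1)).nat 6 k 0 = if l < C.b k then 1 else 0) ∧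
        (r.setNat 20 0 0 (i + 1)).num 8 0 0 = ∑ k : Fin n, (if (k : ℕ) < i + 1 then f k else 0) ∧
        (r.setNat 20 0 0 (i + 1)).nat 12 0 0 = ∑ k : Fin n, if (k : ℕ) < i + 1 then g k else 0 := by
      intro r g1 g2 g3 g4 g5
      simp only [ne_eq, Nat.reduceEqDiff, not_false_eq_true, State.nat_setNat_of_ne,
        State.num_setNat]
      refine ⟨fun k hk => ?_, ?_, ?_⟩
      · by_cases hki : k = i
        · rw [hki]
          exact ⟨g2, g3⟩
        · have hk' : (k : ℕ) < i := lt_of_le_of_ne (Nat.lt_succ_iff.1 hk)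
            fun h => hki (Fin.val_injective h)
          rw [(g1 k hki).1, (g1 k hki).2]
          exact h1 k hk'
      · rw [g4, h2, sum_ite_lt_succ]
      · rw [g5, h3, sum_ite_lt_succ]
    have hne : ∀ {k : Fin n}, k ≠ i → (k : ℕ) ≠ i := fun h h' => h (Fin.val_injective h')
    refine ⟨fun ha => ?_, fun ha => ?_⟩
    · simp only [Test.Holds, NatExp.eval, hti, hA3, hAl, Nat.add_one_le_iff] at ha
      refine ⟨by simp [NatExp.eval]; omega, ?_⟩
      refine ⟨fun h0 => ?_, fun h0 => ?_⟩
      · simp [Test.Holds, NatExp.eval, hti, hA1] at h0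
        have hd : demand I C 0 i = I.c i := by simp [demand, h0]
        refine ⟨?_, by simpa [NatExp.eval] using hm, ?_⟩
        · simpa [NumExp.eval, NatExp.eval, hti, hAc, h2, sub_eq_add_neg] using
            hreg i (-I.c i) (neg_mem (I.c_mem_lattice _ _))
              (by rw [abs_neg, abs_le]; constructor <;> linarith [hc i])
        refine ⟨fun hb => ?_, fun hb => ?_⟩
        · simp only [Test.Holds, NatExp.eval, Nat.add_one_le_iff] at hb
          simp [hti, hA4, hAl] at hb
          refine ⟨by simp [NatExp.eval]; omega, ?_, ?_⟩
          · have := hreg i (-I.c i + 1) (add_mem (neg_mem (I.c_mem_lattice _ _))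
              (I.one_mem_lattice _)) (by rw [abs_le]; constructor <;> linarith [hc i])
            rw [← add_assoc] at this
            simpa [NumExp.eval, NatExp.eval, hti, hAc, h2, sub_eq_add_neg] using this
          · refine fin _ (fun k hk => ?_) ?_ ?_ ?_ ?_
            · simp [NatExp.eval, hti, hne hk]
            · simp [NatExp.eval, hti, ha]
            · simp [NatExp.eval, hti, hb]
            · simp [NatExp.eval, NumExp.eval, hti, hAc, hf, ha, hb, hd]
              ring
            · simp [NatExp.eval, hg, ha, h0]
        · simp only [Test.Holds, NatExp.eval, Nat.add_one_le_iff] at hb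
          simp [hti, hA4, hAl] at hb
          rw [← not_lt] at hb
          refine ⟨by simp [NatExp.eval], fin _ (fun k hk => ?_) ?_ ?_ ?_ ?_⟩
          · simp [NatExp.eval, hti, hne hk]
          · simp [NatExp.eval, hti, ha]
          · simp [NatExp.eval, hti, hb]
          · simp [NatExp.eval, NumExp.eval, hti, hAc, hf, ha, hb, hd]
            ring
          · simp [NatExp.eval, hg, ha, h0]
      · simp [Test.Holds, NatExp.eval, hti, hA1] at h0
        have hd : demand I C 0 i = 1 := by simp [demand, h0]
        refine ⟨?_, ?_⟩
        · simpa [NumExp.eval, NatExp.eval, hti, hAc, h2, sub_eq_add_neg] using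
            hreg i (-1) (neg_mem (I.one_mem_lattice _)) (by simp)
        refine ⟨fun hb => ?_, fun hb => ?_⟩
        · simp only [Test.Holds, NatExp.eval, Nat.add_one_le_iff] at hb
          simp [hti, hA4, hAl] at hb
          refine ⟨by simp [NatExp.eval]; omega, ?_, ?_⟩
          · have := hreg i 0 (zero_mem _) (by simp)
            simpa [NumExp.eval, NatExp.eval, hti, hAc, h2, sub_eq_add_neg] using this
          · refine fin _ (fun k hk => ?_) ?_ ?_ ?_ ?_
            · simp [NatExp.eval, hti, hne hk]
            · simp [NatExp.eval, hti, ha]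
            · simp [NatExp.eval, hti, hb]
            · simp [NatExp.eval, NumExp.eval, hti, hf, ha, hb, hd]
            · simp [NatExp.eval, hg, ha, h0]
        · simp only [Test.Holds, NatExp.eval, Nat.add_one_le_iff] at hb
          simp [hti, hA4, hAl] at hb
          rw [← not_lt] at hb
          refine ⟨by simp [NatExp.eval], fin _ (fun k hk => ?_) ?_ ?_ ?_ ?_⟩
          · simp [NatExp.eval, hti, hne hk]
          · simp [NatExp.eval, hti, ha]
          · simp [NatExp.eval, hti, hb]
          · simp [NatExp.eval, NumExp.eval, hti, hf, ha, hb, hd]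
            ring
          · simp [NatExp.eval, hg, ha, h0]
    · simp only [Test.Holds, NatExp.eval, hti, hA3, hAl, Nat.add_one_le_iff] at ha
      refine ⟨by simp [NatExp.eval], ?_⟩
      refine ⟨fun hb => ?_, fun hb => ?_⟩
      · simp only [Test.Holds, NatExp.eval, Nat.add_one_le_iff] at hb
        simp [hti, hA4, hAl] at hb
        refine ⟨by simp [NatExp.eval]; omega, ?_, ?_⟩
        · have := hreg i 1 (I.one_mem_lattice _) (by simp)
          simpa [NumExp.eval, NatExp.eval, hti, hAc, h2, sub_eq_add_neg] using this
        · refine fin _ (fun k hk => ?_) ?_ ?_ ?_ ?_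
          · simp [NatExp.eval, hti, hne hk]
          · simp [NatExp.eval, hti, ha]
          · simp [NatExp.eval, hti, hb]
          · simp [NatExp.eval, NumExp.eval, hf, ha, hb]
          · simp [NatExp.eval, hg, ha]
      · simp only [Test.Holds, NatExp.eval, Nat.add_one_le_iff] at hb
        simp [hti, hA4, hAl] at hb
        rw [← not_lt] at hb
        refine ⟨by simp [NatExp.eval], fin _ (fun k hk => ?_) ?_ ?_ ?_ ?_⟩
        · simp [NatExp.eval, hti, hne hk]
        · simp [NatExp.eval, hti, ha]
        · simp [NatExp.eval, hti, hb]
        · simp [NatExp.eval, hf, ha, hb]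
        · simp [NatExp.eval, hg, ha]
  · rintro t hA ⟨h1, h2, h3⟩
    have hsum : ∑ k : Fin n, f k = (Finset.univ.filter fun j => l < C.b j).card -
        ∑ i ∈ Finset.univ.filter (fun i => l < C.a i), demand I C 0 i := by
      simp only [hf, Finset.sum_sub_distrib, Finset.sum_boole, Finset.sum_filter]
    have hcard : ∑ k : Fin n, g k = (C.uncapped (Finset.univ.filter fun i => l < C.a i)).card := by
      simp only [hg, Finset.sum_boole, Config.uncapped, Finset.filter_filter, Nat.cast_id]
    simp only [Fin.is_lt, if_true, hsum] at h2
    simp only [Fin.is_lt, if_true, hcard] at h3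
    have hval : t.num 8 0 0 / (t.nat 12 0 0 : ℝ) = (C.cut I l).t := by rw [h2, h3]; rfl
    refine ⟨?_, by simp [NatExp.eval]; omega, ?_, by simp [NatExp.eval]⟩
    · simpa only [NumExp.eval, NatExp.eval, hval] using ht
    · have e1 : ∀ a, a ∉ [20, 5, 12, 5, 6, 20] → ∀ i j, t.nat a i j = s.nat a i j := by
        intro a ha i j
        have ha' : a ≠ 12 := by rintro rfl; simp at ha
        rw [hA.nat a (by simpa [natArrays, forLoop] using ha)]
        simp [ha']
      have e2 : ∀ a ≠ 8, ∀ i j, t.num a i j = s.num a i j := fun a ha i j => by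
        rw [hA.num a (by simpa [numArrays, forLoop] using ha)]
        simp [ha]
      ext k
      · simpa [C, Config.ofState, Config.cut] using e1 1 (by decide) k 0
      · simpa [C, Config.ofState, Config.cut] using e1 2 (by decide) k 0
      · simpa [C, Config.ofState, Config.cut] using e1 3 (by decide) k 0
      · simpa [C, Config.ofState, Config.cut] using e1 4 (by decide) k 0
      · simpa [C, Config.ofState, Config.cut] using (h1 k k.2).1
      · simpa [C, Config.ofState, Config.cut] using (h1 k k.2).2
      · simpa [C, Config.ofState, Config.cut] using e2 2 (by decide) k _
      · simpa [C, Config.ofState, Config.cut] using e2 5 (by decide) k 0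
      · simpa [C, Config.ofState, Config.cut] using e2 6 (by decide) k 0
      · simpa [C, Config.ofState, Config.cut] using e2 3 (by decide) k 0
      · simpa [C, Config.ofState, Config.cut] using e2 4 (by decide) k 0
      · simpa [Config.ofState, NumExp.eval, NatExp.eval] using hval

/-! ### The program: settling, capping, and new levels -/

/-- The zero flow with labels zero is a preflow for the unsettled agents and goods. -/
theorem Partial.preflow_of_reset (h : Partial I C) (hc : ∀ i, 0 ≤ I.c i) (hk : Keep C C')
    (hm : C.t ∈ I.lattice n.factorial) (hpos : 0 < C.t) (hle : ∀ i, C.st i = 0 → I.c i + C.t ≤ 1)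
    (ha : ∀ i, C'.a i = 0) (hb : ∀ j, C'.b j = 0) (hx : ∀ i, C.st i < 2 → ∀ j, C'.x i j = 0)
    (he : ∀ i, C.st i < 2 → C'.e i = demand I C C.t i) (he' : ∀ i, 2 ≤ C.st i → C'.e i = C.e i)
    (ho : ∀ j, C.g j = 0 → C'.o j = -1) (ho' : ∀ j, C.g j ≠ 0 → C'.o j = C.o j) :
    Preflow I C' := by
  have hxx : ∀ i j, C'.x i j = C.x i j ∨ C'.x i j = 0 := fun i j => by
    rcases lt_or_ge (C.st i) 2 with hi | hi
    · exact Or.inr (hx i hi j)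
    · rw [hk.row i hi]; exact Or.inl rfl
  have hx0 : ∀ i j, C.g j = 0 → C'.x i j = 0 := fun i j hj => by
    rcases lt_or_ge (C.st i) 2 with hi | hi
    · exact hx i hi j
    · rw [hk.row i hi]
      exact h.x_eq_zero fun hp => absurd ((h.settled_iff i j hp).2 hj) (not_lt.2 hi)
  have hx1 : ∀ i j, C.g j ≠ 0 → C'.x i j = C.x i j := fun i j hj => by
    rcases lt_or_ge (C.st i) 2 with hi | hi
    · rw [hx i hi j, h.x_eq_zero fun hp => hj ((h.settled_iff i j hp).1 hi)]
    · rw [hk.row i hi]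
  have hlt : ∀ i j, 0 < C'.x i j → 0 < C.x i j ∧ 2 ≤ C.st i := fun i j hp => by
    rcases lt_or_ge (C.st i) 2 with hi | hi
    · rw [hx i hi j] at hp
      exact absurd hp (lt_irrefl _)
    · rw [hk.row i hi] at hp
      exact ⟨hp, hi⟩
  have hdem : ∀ i, 0 ≤ demand I C C.t i ∧ demand I C C.t i ∈ I.lattice n.factorial := fun i => by
    unfold demand
    split_ifs
    · exact ⟨by linarith [hc i], add_mem (I.c_mem_lattice _ _) hm⟩
    · exact ⟨zero_le_one, I.one_mem_lattice _⟩
  refine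
    { x_nonneg := fun i j => ?_
      likes := fun i j hp => h.likes i j (hlt i j hp).1
      settled_iff := fun i j hp => by rw [hk.st, hk.g]; exact h.settled_iff i j (hlt i j hp).1
      e_settled := fun i hi => ?_
      o_settled := fun j hj => ?_
      sum_settled := fun j hj => ?_
      x_mem := fun i j => ?_
      t_mem := by rwa [hk.t]
      t_pos := by rwa [hk.t]
      t_le := by rwa [hk.t, hk.st]
      e_nonneg := fun i => ?_
      e_eq := fun i hi => ?_
      o_eq := fun j => ?_
      o_nonneg := fun j hj => by rw [hb j] at hj; omega
      a_settled := fun i hi => by rw [ha i] at hi; omega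
      b_settled := fun j hj => by rw [hb j] at hj; omega
      a_le := fun i => by rw [ha i]; omega
      b_le := fun j => by rw [hb j]; omega
      agent_arc := fun i j _ _ _ => by rw [ha i]; omega
      good_arc := fun i j _ => by rw [hb j]; omega
      e_mem := fun i => ?_ }
  · rcases hxx i j with h1 | h1 <;> rw [h1]
    exact h.x_nonneg i j
  · rw [hk.st] at hi
    rw [he' i hi, h.e_settled i hi]
  · rw [hk.g] at hj
    rw [ho' j hj, h.o_settled j hj]
  · rw [hk.g] at hj
    simp only [hx1 _ j hj]
    exact h.sum_settled j hj
  · rcases hxx i j with h1 | h1 <;> rw [h1]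
    · exact h.x_mem i j
    · exact zero_mem _
  · rcases lt_or_ge (C.st i) 2 with hi | hi
    · rw [he i hi]; exact (hdem i).1
    · rw [he' i hi, h.e_settled i hi]
  · rw [hk.st] at hi
    rw [he i hi, demand_congr hk.st, hk.t]
    simp [hx i hi]
  · by_cases hj : C.g j = 0
    · rw [ho j hj]
      simp [hx0 _ j hj]
    · rw [ho' j hj, h.o_settled j hj, zero_add]
      simp only [hx1 _ j hj]
      exact (h.sum_settled j hj).symm
  · rcases lt_or_ge (C.st i) 2 with hi | hi
    · rw [he i hi]; exact (hdem i).2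
    · rw [he' i hi, h.e_settled i hi]; exact zero_mem _

/-- The current allocation of the unsettled agents and the labels are discarded. -/
def resetProg : Prog :=
  forLoop 20 size (.seq (setNatAt 3 varI (.const 0)) (.seq (setNatAt 4 varI (.const 0)) (.seq
    (.branch (.natLe (natAt 2 varI) (.const 0)) (setNumAt 6 varI (.sub (lit 0) (lit 1))) .skip)
    (.branch (.natLe (natAt 1 varI) (.const 1))
      (.seq (.branch (.natLe (natAt 1 varI) (.const 0))
          (setNumAt 5 varI (.add (numAt 1 varI) (numCell 7))) (setNumAt 5 varI (lit 1)))
        (forLoop 21 size (.setNum 2 varI varJ (lit 0))))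
      .skip))))

/-- The state of the memory after the first `i` rounds of the reset. -/
structure Resetting (I : Market n) (C : Config n) (i : ℕ) (C' : Config n) : Prop where
  keep : Keep C C'
  a : ∀ k : Fin n, k < i → C'.a k = 0
  b : ∀ k : Fin n, k < i → C'.b k = 0
  x : ∀ k : Fin n, k < i → C.st k < 2 → ∀ j, C'.x k j = 0
  e : ∀ k : Fin n, k < i → C.st k < 2 → C'.e k = demand I C C.t k
  e' : ∀ k, 2 ≤ C.st k → C'.e k = C.e k
  o : ∀ k : Fin n, k < i → C.g k = 0 → C'.o k = -1
  o' : ∀ k, C.g k ≠ 0 → C'.o k = C.o k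

theorem wp_resetProg (hN : 2 * n + 2 ≤ N) (hc : ∀ i, 0 ≤ I.c i) {s : State} (hI : Reads I s)
    (h : Partial I (Config.ofState n s)) (hm : (Config.ofState n s).t ∈ I.lattice n.factorial)
    (hpos : 0 < (Config.ofState n s).t)
    (hle : ∀ i, (Config.ofState n s).st i = 0 → I.c i + (Config.ofState n s).t ≤ 1) :
    resetProg.wp N I.Short (fun t => Preflow I (Config.ofState n t) ∧
      Keep (Config.ofState n s) (Config.ofState n t)) s := by
  set C := Config.ofState n s with hC
  refine wp_forLoop (M := n) (fun i t => Resetting I C i (Config.ofState n t))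
    (by decide) (by omega)
    (fun t hA => (hI.agree hA (by decide) (by decide) (by decide)).n_eq) ?_ ?_ ?_
  · rw [Config.ofState_setNat (by norm_num), ← hC]
    exact ⟨Keep.refl C, by simp, by simp, by simp, by simp, by simp, by simp, by simp⟩
  · intro i hi t hA hti hinv
    have hI' := hI.agree hA (by decide) (by decide) (by decide)
    lift i to Fin n using hi
    have hst : ∀ k : Fin n, t.nat 1 k 0 = C.st k := fun k => congrFun hinv.keep.st k
    have hg : ∀ k : Fin n, t.nat 2 k 0 = C.g k := fun k => congrFun hinv.keep.g k
    have htt : t.num 7 0 0 = C.t := hinv.keep.t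
    -- the three cases of the last branch, for any state reached before it
    have key : ∀ r : State, r.nat 0 = t.nat 0 → r.nat 1 = t.nat 1 → r.nat 20 = t.nat 20 →
        r.num 1 = t.num 1 →
        r.num 7 = t.num 7 → Resetting I C i (Config.ofState n r) → (Config.ofState n r).a i = 0 →
        (Config.ofState n r).b i = 0 → (C.g i = 0 → (Config.ofState n r).o i = -1) →
        (branch (.natLe (natAt 1 varI) (.const 1))
          (.seq (.branch (.natLe (natAt 1 varI) (.const 0))
            (setNumAt 5 varI (.add (numAt 1 varI) (numCell 7))) (setNumAt 5 varI (lit 1)))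
            (forLoop 21 size (.setNum 2 varI varJ (lit 0)))) .skip).wp N I.Short
          (fun t => Resetting I C (i + 1) (Config.ofState n (t.setNat 20 0 0 (i + 1)))) r := by
      intro r hr0 hr1 hr20 hrc hr7 hinv ha hb ho
      refine ⟨fun hb' => ?_, fun hb' => ?_⟩
      · simp only [Test.Holds, NatExp.eval, hr20, hti, hr1, hst] at hb'
        -- the inner loop, for any state in which the demand of agent `i` has been stored
        have key' : ∀ w : State, w.nat 0 = t.nat 0 → w.nat 20 = t.nat 20 →
            Resetting I C i (Config.ofState n w) → (Config.ofState n w).a i = 0 →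
            (Config.ofState n w).b i = 0 → (C.g i = 0 → (Config.ofState n w).o i = -1) →
            (Config.ofState n w).e i = demand I C C.t i →
            (forLoop 21 size (.setNum 2 varI varJ (lit 0))).wp N I.Short
              (fun t => Resetting I C (i + 1) (Config.ofState n (t.setNat 20 0 0 (i + 1)))) w := by
          intro w hw0 hw20 hinv ha hb ho he
          refine wp_forLoop (M := n) (fun j z => Resetting I C i (Config.ofState n z) ∧
            (Config.ofState n z).a i = 0 ∧
            (Config.ofState n z).b i = 0 ∧ (C.g i = 0 → (Config.ofState n z).o i = -1) ∧
            (Config.ofState n z).e i = demand I C C.t i ∧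
            ∀ k : Fin n, k < j → (Config.ofState n z).x i k = 0) (by decide) (by omega)
            (fun z hA => ?_) ?_ ?_ ?_
          · have := hA.nat 0 (by decide)
            simp only [NatExp.eval, this, hw0]
            exact hI'.n_eq
          · rw [Config.ofState_setNat (by norm_num)]
            exact ⟨hinv, ha, hb, ho, he, by simp⟩
          · intro j hj z hA hzj ⟨h1, h2, h3, h4, h5, h6⟩
            lift j to Fin n using hj
            have hzi : z.nat 20 0 0 = i := by rw [hA.nat 20 (by decide), hw20, hti]
            refine ⟨by simpa [NumExp.eval, NatExp.eval] using I.regular_zero.short, ?_⟩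
            beta_reduce
            rw [Config.ofState_setNat (by norm_num)]
            simp only [NatExp.eval, NumExp.eval, hzi, hzj, Nat.cast_zero]
            have hx : ∀ k l : Fin n, (Config.ofState n (z.setNum 2 i j 0)).x k l =
                if k = i ∧ l = j then 0 else (Config.ofState n z).x k l := fun k l => by
              simp [Config.ofState, Fin.val_inj]
            refine ⟨⟨{ h1.keep with row := fun k hk => ?_ }, h1.a, h1.b, fun k hk hk' l => ?_, h1.e,
              h1.e', h1.o, h1.o'⟩, h2, h3, h4, h5, ?_⟩
            · rw [← h1.keep.row k hk]
              funext l
              rw [hx, if_neg]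
              rintro ⟨rfl, -⟩
              omega
            · rw [hx]
              split_ifs
              · rfl
              · exact h1.x k hk hk' l
            · rw [forall_lt_succ]
              refine ⟨fun k hk => ?_, ?_⟩
              · rw [hx]
                split_ifs
                · rfl
                · exact h6 k hk
              · rw [hx, if_pos ⟨rfl, rfl⟩]
          · intro z hA ⟨h1, h2, h3, h4, h5, h6⟩
            rw [Config.ofState_setNat (by norm_num)]
            exact ⟨h1.keep, forall_lt_succ.2 ⟨h1.a, h2⟩, forall_lt_succ.2 ⟨h1.b, h3⟩,
              forall_lt_succ.2 ⟨h1.x, fun _ k => h6 k k.2⟩,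
              forall_lt_succ.2 ⟨h1.e, fun _ => h5⟩, h1.e',
              forall_lt_succ.2 ⟨h1.o, h4⟩, h1.o'⟩
        have hset : ∀ v, v = demand I C C.t i → (forLoop 21 size (.setNum 2 varI varJ (lit 0))).wp N
            I.Short (fun t => Resetting I C (i + 1) (Config.ofState n (t.setNat 20 0 0 (i + 1))))
            (r.setNum 5 i 0 v) := by
          rintro v rfl
          have hx : ∀ k : Fin n, (Config.ofState n (r.setNum 5 i 0 (demand I C C.t i))).e k =
              if k = i then demand I C C.t i else (Config.ofState n r).e k := fun k => by
            simp [Config.ofState, Fin.val_inj]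
          have hxx : (Config.ofState n (r.setNum 5 i 0 (demand I C C.t i))).x =
              (Config.ofState n r).x := by
            simp [Config.ofState]
          have hoo : (Config.ofState n (r.setNum 5 i 0 (demand I C C.t i))).o =
              (Config.ofState n r).o := by
            simp [Config.ofState]
          have hk : Keep C (Config.ofState n (r.setNum 5 i 0 (demand I C C.t i))) := by
            obtain ⟨k1, k2, k3, k4, k5, k6, k7, k8⟩ := hinv.keep
            refine ⟨k1, k2, k3, k4, ?_, ?_, ?_, ?_⟩
            · rw [← k5]; simp [Config.ofState]
            · rw [← k6]; simp [Config.ofState]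
            · rw [← k7]; simp [Config.ofState]
            · rw [hxx]; exact k8
          refine key' _ hr0 hr20 ⟨hk, hinv.a, hinv.b, ?_, fun k hk hk' => ?_, fun k hk' => ?_,
            ?_, ?_⟩ ha hb ?_ ?_
          · rw [hxx]; exact hinv.x
          · rw [hx]
            split_ifs with h0
            · rw [h0]
            · exact hinv.e k hk hk'
          · rw [hx, if_neg]
            · exact hinv.e' k hk'
            · rintro rfl; omega
          · rw [hoo]; exact hinv.o
          · rw [hoo]; exact hinv.o'
          · rw [hoo]; exact ho
          · rw [hx, if_pos rfl]
        refine ⟨fun h0 => ?_, fun h0 => ?_⟩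
        · simp only [Test.Holds, NatExp.eval, hr20, hti, hr1, hst, Nat.le_zero] at h0
          have hd : I.c i + C.t = demand I C C.t i := by rw [demand, if_pos h0]
          refine ⟨?_, ?_⟩
          · simp only [NumExp.eval, NatExp.eval, hr20, hti, hrc, hI'.c_eq, hr7, htt]
            refine Regular.short ⟨add_mem (I.c_mem_lattice _ _) hm, ?_⟩
            rw [abs_of_nonneg (add_nonneg (hc i) hpos.le)]
            linarith [hle i h0, Nat.cast_nonneg (α := ℝ) n]
          · simp only [NumExp.eval, NatExp.eval, hr20, hti, hrc, hI'.c_eq, hr7, htt]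
            exact hset _ hd
        · simp only [Test.Holds, NatExp.eval, hr20, hti, hr1, hst, Nat.le_zero] at h0
          have hd : 1 = demand I C C.t i := by rw [demand, if_neg h0]
          refine ⟨?_, ?_⟩
          · simpa only [NumExp.eval, NatExp.eval, Nat.cast_one] using I.regular_one.short
          · simp only [NumExp.eval, NatExp.eval, hr20, hti, Nat.cast_one]
            exact hset _ hd
      · simp only [Test.Holds, NatExp.eval, hr20, hti, hr1, hst] at hb'
        simp only [wp]
        rw [Config.ofState_setNat (by norm_num)]
        exact ⟨hinv.keep, forall_lt_succ.2 ⟨hinv.a, ha⟩, forall_lt_succ.2 ⟨hinv.b, hb⟩,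
          forall_lt_succ.2 ⟨hinv.x, fun h => absurd h (by omega)⟩,
          forall_lt_succ.2 ⟨hinv.e, fun h => absurd h (by omega)⟩, hinv.e',
          forall_lt_succ.2 ⟨hinv.o, ho⟩, hinv.o'⟩
    refine ⟨by simp [NatExp.eval], by simp [NatExp.eval], ?_⟩
    simp only [NatExp.eval, hti, State.nat_setNat_of_ne, ne_eq, Nat.reduceEqDiff, not_false_eq_true]
    set r := (t.setNat 3 i 0 0).setNat 4 i 0 0 with hr
    have hra : ∀ k : Fin n, (Config.ofState n r).a k =
        if k = i then 0 else (Config.ofState n t).a k := fun k => by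
      simp [hr, Config.ofState, Fin.val_inj]
    have hrb : ∀ k : Fin n, (Config.ofState n r).b k =
        if k = i then 0 else (Config.ofState n t).b k := fun k => by
      simp [hr, Config.ofState, Fin.val_inj]
    have hr1 : Resetting I C i (Config.ofState n r) := by
      obtain ⟨k1, k2, k3, k4, k5, k6, k7, k8⟩ := hinv.keep
      refine ⟨⟨?_, ?_, ?_, ?_, k5, k6, k7, k8⟩, fun k hk => ?_, fun k hk => ?_, hinv.x, hinv.e,
        hinv.e', hinv.o, hinv.o'⟩
      · rw [← k1]; simp [hr, Config.ofState]
      · rw [← k2]; simp [hr, Config.ofState]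
      · rw [← k3]; simp [hr, Config.ofState]
      · rw [← k4]; simp [hr, Config.ofState]
      · rw [hra]; split_ifs
        · rfl
        · exact hinv.a k hk
      · rw [hrb]; split_ifs
        · rfl
        · exact hinv.b k hk
    have hri : r.nat 20 0 0 = i := by rw [hr]; simpa using hti
    refine ⟨fun h0 => ?_, fun h0 => ?_⟩
    · simp only [Test.Holds, NatExp.eval, hri] at h0
      have h0 : C.g i = 0 := by
        rw [← hg i]
        simpa [hr] using h0
      refine ⟨?_, ?_⟩
      · simpa [NumExp.eval, NatExp.eval] using I.regular_one.neg.short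
      · simp only [NatExp.eval, NumExp.eval, hri, Nat.cast_zero, Nat.cast_one, zero_sub]
        have hx : ∀ k : Fin n, (Config.ofState n (r.setNum 6 i 0 (-1))).o k =
            if k = i then -1 else (Config.ofState n r).o k := fun k => by
          simp [Config.ofState, Fin.val_inj]
        refine key _ (by simp [hr]) (by simp [hr]) (by simp [hr]) (by simp [hr]) (by simp [hr])
          ⟨?_, hr1.a, hr1.b, ?_, ?_, ?_, fun k hk hk' => ?_, fun k hk' => ?_⟩ ?_ ?_ (fun _ => ?_)
        · obtain ⟨k1, k2, k3, k4, k5, k6, k7, k8⟩ := hr1.keep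
          refine ⟨k1, k2, k3, k4, ?_, ?_, ?_, ?_⟩
          · rw [← k5]; simp [Config.ofState]
          · rw [← k6]; simp [Config.ofState]
          · rw [← k7]; simp [Config.ofState]
          · simpa [Config.ofState] using k8
        · simpa [Config.ofState] using hr1.x
        · simpa [Config.ofState] using hr1.e
        · simpa [Config.ofState] using hr1.e'
        · rw [hx]; split_ifs
          · rfl
          · exact hr1.o k hk hk'
        · rw [hx, if_neg]
          · exact hr1.o' k hk'
          · rintro rfl; exact hk' h0
        · exact (hra i).trans (if_pos rfl)
        · exact (hrb i).trans (if_pos rfl)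
        · rw [hx, if_pos rfl]
    · simp only [Test.Holds, NatExp.eval, hri] at h0
      have h0 : C.g i ≠ 0 := by
        rw [← hg i]
        simpa [hr] using h0
      refine key _ (by simp [hr]) (by simp [hr]) (by simp [hr]) (by simp [hr]) (by simp [hr])
        hr1 ((hra i).trans (if_pos rfl)) ((hrb i).trans (if_pos rfl)) (fun h => absurd h h0)
  · intro t hA ht
    refine ⟨h.preflow_of_reset hc ht.keep hm hpos hle (fun i => ht.a i i.2) (fun i => ht.b i i.2)
      (fun i => ht.x i i.2) (fun i => ht.e i i.2) ht.e' (fun j => ht.o j j.2) ht.o', ht.keep⟩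

/-- The memory `s` holds the status, the price and the offset of agent and good `k` in the
configuration `C`. -/
structure HoldsAt (s : State) (C : Config n) (k : Fin n) : Prop where
  st : s.nat 1 k 0 = C.st k
  g : s.nat 2 k 0 = C.g k
  p : s.num 3 k 0 = C.p k
  q : s.num 4 k 0 = C.q k

theorem HoldsAt.of_eq {s t : State} {k : Fin n} (h : HoldsAt s C k) (h1 : t.nat 1 k 0 = s.nat 1 k 0)
    (h2 : t.nat 2 k 0 = s.nat 2 k 0) (h3 : t.num 3 k 0 = s.num 3 k 0)
    (h4 : t.num 4 k 0 = s.num 4 k 0) : HoldsAt t C k :=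
  ⟨h1.trans h.st, h2.trans h.g, h3.trans h.p, h4.trans h.q⟩

/-- A loop that changes the statuses, prices and offsets of each agent and good separately. -/
theorem wp_forLoop_of_holdsAt (hN : 2 * n + 2 ≤ N) {c : Prog} {s : State} (hI : Reads I s)
    {D : Config n} (hD : D = { Config.ofState n s with st := D.st, g := D.g, p := D.p, q := D.q })
    (hn : ∀ a ≤ 20, a ≠ 1 → a ≠ 2 → a ∉ c.natArrays)
    (hr : ∀ a ≤ 10, a ≠ 3 → a ≠ 4 → a ∉ c.numArrays)
    (step : ∀ (i : Fin n) (t : State), (forLoop 20 size c).Agree s t → t.nat 20 0 0 = i →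
      HoldsAt t (Config.ofState n s) i → c.wp N I.Short (fun r => HoldsAt r D i ∧
        ∀ k : Fin n, k ≠ i → ∀ E : Config n, HoldsAt t E k → HoldsAt r E k) t) :
    (forLoop 20 size c).wp N I.Short (fun t => Config.ofState n t = D) s := by
  have hn' : ∀ a < 20, a ≠ 1 → a ≠ 2 → a ∉ (forLoop 20 size c).natArrays := by
    intro a ha h1 h2
    simp only [forLoop, natArrays, List.mem_append, List.mem_singleton, not_or]
    exact ⟨by omega, hn a ha.le h1 h2, by omega⟩
  have hr' : ∀ a ≤ 10, a ≠ 3 → a ≠ 4 → a ∉ (forLoop 20 size c).numArrays := by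
    intro a ha h1 h2
    simpa [forLoop, numArrays] using hr a ha h1 h2
  refine wp_forLoop (M := n) (fun i t => ∀ k : Fin n,
      ((k : ℕ) < i → HoldsAt t D k) ∧ (i ≤ (k : ℕ) → HoldsAt t (Config.ofState n s) k))
    (hn 20 le_rfl (by norm_num) (by norm_num)) (by omega) (fun t hA => ?_) ?_ ?_ ?_
  · exact (hI.agree hA (hn' 0 (by norm_num) (by norm_num) (by norm_num))
      (hr' 0 (by norm_num) (by norm_num) (by norm_num))
      (hr' 1 (by norm_num) (by norm_num) (by norm_num))).n_eq
  · exact fun k => ⟨fun h => absurd h (Nat.not_lt_zero _), fun _ => ⟨by simp [Config.ofState],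
      by simp [Config.ofState], rfl, rfl⟩⟩
  · intro i hi t hA hti hinv
    lift i to Fin n using hi
    refine (step i t hA hti ((hinv i).2 le_rfl)).mono fun r ⟨h1, h2⟩ k => ?_
    have hset : ∀ E, HoldsAt r E k → HoldsAt (r.setNat 20 0 0 (i + 1)) E k := fun E h =>
      h.of_eq (by simp) (by simp) rfl rfl
    rcases lt_trichotomy (k : ℕ) i with h | h | h
    · have hk : k ≠ i := fun h' => by rw [h'] at h; omega
      exact ⟨fun _ => hset _ (h2 k hk _ ((hinv k).1 h)), fun _ => by omega⟩
    · obtain rfl := Fin.val_injective h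
      exact ⟨fun _ => hset _ h1, fun _ => by omega⟩
    · have hk : k ≠ i := fun h' => by rw [h'] at h; omega
      exact ⟨fun _ => by omega, fun _ => hset _ (h2 k hk _ ((hinv k).2 h.le))⟩
  · intro t hA ht
    have e1 : ∀ a ≤ 6, a ≠ 1 → a ≠ 2 → t.nat a = s.nat a := fun a ha h1 h2 =>
      hA.nat a (hn' a (by omega) h1 h2)
    have e2 : ∀ a ≤ 7, a ≠ 3 → a ≠ 4 → t.num a = s.num a := fun a ha h1 h2 =>
      hA.num a (hr' a (by omega) h1 h2)
    rw [hD]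
    ext k
    · exact ((ht k).1 k.2).st
    · exact ((ht k).1 k.2).g
    all_goals simp only [Config.ofState]
    · rw [e1 3 (by norm_num) (by norm_num) (by norm_num)]
    · rw [e1 4 (by norm_num) (by norm_num) (by norm_num)]
    · rw [e1 5 (by norm_num) (by norm_num) (by norm_num)]
    · rw [e1 6 (by norm_num) (by norm_num) (by norm_num)]
    · rw [e2 2 (by norm_num) (by norm_num) (by norm_num)]
    · rw [e2 5 (by norm_num) (by norm_num) (by norm_num)]
    · rw [e2 6 (by norm_num) (by norm_num) (by norm_num)]
    · exact ((ht k).1 k.2).p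
    · exact ((ht k).1 k.2).q
    · rw [e2 7 (by norm_num) (by norm_num) (by norm_num)]

/-- The agents and goods of the bottleneck are settled, as in `Config.settle`. -/
def settleProg : Prog :=
  forLoop 20 size (.seq
    (.branch (.natLe (natAt 5 varI) (.const 0)) .skip
      (.seq (.branch (isEq (natAt 1 varI) (.const 1))
          (setNumAt 4 varI (.sub (numAt 4 varI) (.div (lit 1) (numCell 7)))) .skip)
        (setNatAt 1 varI (.const 2))))
    (.branch (.natLe (natAt 6 varI) (.const 0)) .skip
      (.seq (setNumAt 3 varI (.div (lit 1) (numCell 7))) (setNatAt 2 varI (.const 1)))))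

theorem wp_settleProg (hN : 2 * n + 2 ≤ N) {s : State} (hI : Reads I s)
    (ht : I.Short (1 / (Config.ofState n s).t))
    (hq : ∀ i, (Config.ofState n s).st i = 1 →
      I.Short ((Config.ofState n s).q i - 1 / (Config.ofState n s).t)) :
    settleProg.wp N I.Short (fun t => Config.ofState n t = (Config.ofState n s).settle) s := by
  set C := Config.ofState n s with hC
  refine wp_forLoop_of_holdsAt hN hI rfl (by decide) (by decide) fun i t hA hti hinv => ?_
  have hS : t.nat 5 i 0 = C.S i := by rw [hA.nat 5 (by decide)]; rfl
  have hG : t.nat 6 i 0 = C.G i := by rw [hA.nat 6 (by decide)]; rfl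
  have htt : t.num 7 0 0 = C.t := by rw [hA.num 7 (by decide)]; rfl
  have hn0 : n ≠ 0 := by rintro rfl; exact i.elim0
  have hne : ∀ {k : Fin n}, k ≠ i → (k : ℕ) ≠ i := fun h h' => h (Fin.val_injective h')
  obtain ⟨h1, h2, h3, h4⟩ := hinv
  rw [← hC] at h1 h2 h3 h4
  -- the branch for good `i`, for any state reached after the branch for agent `i`
  have key : ∀ r : State, r.nat 20 0 0 = i → r.nat 6 i 0 = C.G i → r.num 7 0 0 = C.t →
      r.nat 1 i 0 = C.settle.st i → r.nat 2 i 0 = C.g i → r.num 3 i 0 = C.p i →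
      r.num 4 i 0 = C.settle.q i → (∀ k : Fin n, k ≠ i → ∀ E : Config n, HoldsAt t E k →
        HoldsAt r E k) →
      (branch (.natLe (natAt 6 varI) (.const 0)) .skip
        (.seq (setNumAt 3 varI (.div (lit 1) (numCell 7))) (setNatAt 2 varI (.const 1)))).wp N
        I.Short (fun r => HoldsAt r C.settle i ∧
        ∀ k : Fin n, k ≠ i → ∀ E : Config n, HoldsAt t E k → HoldsAt r E k) r := by
    intro r g1 g2 g3 g4 g5 g6 g7 g8
    refine ⟨fun hb => ?_, fun hb => ?_⟩
    · simp only [Test.Holds, NatExp.eval, g1, g2, Nat.le_zero] at hb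
      refine ⟨⟨g4, ?_, ?_, g7⟩, g8⟩
      · simp [g5, Config.settle, hb]
      · simp [g6, Config.settle, hb]
    · simp only [Test.Holds, NatExp.eval, g1, g2, Nat.le_zero] at hb
      refine ⟨?_, by simp only [NatExp.eval]; omega, ⟨?_, ?_, ?_, ?_⟩, fun k hk E hE => ?_⟩
      · simpa [NumExp.eval, NatExp.eval, g3] using ht
      · simpa using g4
      · simp [NatExp.eval, Config.settle, hb, g1]
      · simp [NatExp.eval, NumExp.eval, Config.settle, hb, g1, g3]
      · simpa using g7
      · refine (g8 k hk E hE).of_eq (by simp) ?_ ?_ (by simp)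
        · simp [NatExp.eval, g1, hne hk]
        · simp [NatExp.eval, g1, hne hk]
  refine ⟨fun hb => ?_, fun hb => ?_⟩
  · simp only [Test.Holds, NatExp.eval, hti, hS, Nat.le_zero] at hb
    refine key t hti hG htt ?_ h2 h3 ?_ (fun k hk E hE => hE)
    · simp [Config.settle, hb, h1]
    · simp [Config.settle, hb, h4]
  · simp only [Test.Holds, NatExp.eval, hti, hS, Nat.le_zero] at hb
    refine ⟨fun h0 => ?_, fun h0 => ?_⟩
    · simp only [Test.Holds, NatExp.eval, hti, h1, ← le_antisymm_iff] at h0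
      refine ⟨?_, by simp only [NatExp.eval]; omega, ?_⟩
      · simpa [NumExp.eval, NatExp.eval, hti, h4, htt] using hq i h0
      · refine key _ (by simpa using hti) ?_ ?_ ?_ ?_ ?_ ?_ (fun k hk E hE => ?_)
        · simpa using hG
        · simpa using htt
        · simp [NatExp.eval, hti, Config.settle, hb]
        · simpa using h2
        · simpa using h3
        · simp [NatExp.eval, NumExp.eval, hti, Config.settle, hb, h0, h4, htt]
        · refine hE.of_eq ?_ (by simp) (by simp) ?_
          · simp [NatExp.eval, hti, hne hk]
          · simp [NatExp.eval, hti, hne hk]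
    · simp only [Test.Holds, NatExp.eval, hti, h1, ← le_antisymm_iff] at h0
      refine ⟨by simp only [NatExp.eval]; omega, ?_⟩
      refine key _ (by simpa using hti) ?_ ?_ ?_ ?_ ?_ ?_ (fun k hk E hE => ?_)
      · simpa using hG
      · simpa using htt
      · simp [NatExp.eval, hti, Config.settle, hb]
      · simpa using h2
      · simpa using h3
      · simp [Config.settle, h0, h4]
      · refine hE.of_eq ?_ (by simp) (by simp) (by simp)
        simp [NatExp.eval, hti, hne hk]

/-- The uncapped agents that demand one unit are capped, as in `Config.cap`. -/
def capProg : Prog :=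
  forLoop 20 size (.branch
    (.and (.natLe (natAt 1 varI) (.const 0)) (.numLe (.sub (lit 1) (numAt 1 varI)) (numCell 7)))
    (.seq (setNatAt 1 varI (.const 1))
      (setNumAt 4 varI (.div (lit 1) (.sub (lit 1) (numAt 1 varI)))))
    .skip)

theorem wp_capProg (hN : 2 * n + 2 ≤ N) {s : State} (hI : Reads I s)
    (hq : ∀ i, I.Short (1 / (1 - I.c i))) :
    capProg.wp N I.Short (fun t => Config.ofState n t = (Config.ofState n s).cap I) s := by
  set C := Config.ofState n s with hC
  refine wp_forLoop_of_holdsAt hN hI rfl (by decide) (by decide) fun i t hA hti hinv => ?_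
  have hI' := hI.agree hA (by decide) (by decide) (by decide)
  have htt : t.num 7 0 0 = C.t := by rw [hA.num 7 (by decide)]; rfl
  have hne : ∀ {k : Fin n}, k ≠ i → (k : ℕ) ≠ i := fun h h' => h (Fin.val_injective h')
  have hn0 : n ≠ 0 := by rintro rfl; exact i.elim0
  obtain ⟨h1, h2, h3, h4⟩ := hinv
  rw [← hC] at h1 h2 h3 h4
  refine ⟨fun hb => ?_, fun hb => ?_⟩
  · simp only [Test.Holds, NatExp.eval, NumExp.eval, hti, h1, hI'.c_eq, htt, Nat.le_zero,
      Nat.cast_one] at hb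
    refine ⟨by simp only [NatExp.eval]; omega, ?_, ⟨?_, ?_, ?_, ?_⟩, fun k hk E hE => ?_⟩
    · simpa [NumExp.eval, NatExp.eval, hti, hI'.c_eq] using hq i
    · have h5 : (C.cap I).st i = 1 := if_pos hb
      simpa [NatExp.eval, hti] using h5.symm
    · simpa [Config.cap] using h2
    · simpa [Config.cap] using h3
    · have h5 : (C.cap I).q i = 1 / (1 - I.c i) := if_pos hb
      simpa [NatExp.eval, NumExp.eval, hti, hI'.c_eq] using h5.symm
    · refine hE.of_eq ?_ (by simp) (by simp) ?_
      · simp [NatExp.eval, hti, hne hk]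
      · simp [NatExp.eval, hti, hne hk]
  · simp only [Test.Holds, NatExp.eval, NumExp.eval, hti, h1, hI'.c_eq, htt, Nat.le_zero,
      Nat.cast_one] at hb
    refine ⟨⟨?_, h2, h3, ?_⟩, fun k hk E hE => hE⟩
    · exact h1.trans (if_neg hb).symm
    · exact h4.trans (if_neg hb).symm

/-- The next level is the lowest level at which some uncapped agent demands one unit, and the
current allocation is discarded; the number of uncapped agents is stored in array `10`. If there are
none, the allocation is final and is kept. -/
def levelProg : Prog :=
  .seq (setNatCell 10 (.const 0)) (.seq
    (forLoop 20 size (.branch (.natLe (natAt 1 varI) (.const 0))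
      (.seq (.branch (.and (.not (.natLe (.cell 10) (.const 0)))
          (.numLe (numCell 7) (.sub (lit 1) (numAt 1 varI)))) .skip
          (setNumCell 7 (.sub (lit 1) (numAt 1 varI))))
        (setNatCell 10 (.add (.cell 10) (.const 1)))) .skip))
    (.seq (setNatCell 9 (.const 0))
      (.branch (.natLe (.cell 10) (.const 0)) .skip resetProg)))

/-- The number of uncapped agents. -/
def Config.count (C : Config n) : ℕ := (Finset.univ.filter fun i => C.st i = 0).card

/-- The new level is at least every feasible level `τ`, since no demand exceeds one unit at a
feasible level. -/
theorem wp_levelProg (hN : 2 * n + 2 ≤ N) (hc : ∀ i, 0 ≤ I.c i ∧ I.c i < 1) {s : State}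
    (hI : Reads I s) (h : Partial I (Config.ofState n s))
    (hs : (Config.ofState n s).count ≠ 0 → Settled I (Config.ofState n s) τ) :
    levelProg.wp N I.Short (fun t => t.nat 10 0 0 = (Config.ofState n s).count ∧
      t.nat 9 0 0 = 0 ∧ (Config.ofState n t).count = (Config.ofState n s).count ∧
      (t.nat 10 0 0 = 0 → Config.ofState n t = Config.ofState n s) ∧
      (t.nat 10 0 0 ≠ 0 → Preflow I (Config.ofState n t) ∧ Settled I (Config.ofState n t) τ ∧
        τ ≤ (Config.ofState n t).t ∧
        ∃ i, (Config.ofState n t).st i = 0 ∧ 1 - I.c i ≤ (Config.ofState n t).t)) s := by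
  set C := Config.ofState n s with hC
  set g : Fin n → ℕ := fun k => if C.st k = 0 then 1 else 0 with hg
  have hcount : ∑ k, g k = C.count := by
    simp only [hg, Finset.sum_boole, Config.count, Nat.cast_id]
  refine ⟨by simp [NatExp.eval], ?_⟩
  refine wp_forLoop (M := n) (fun i t => Config.ofState n t = { C with t := t.num 7 0 0 } ∧
      t.nat 10 0 0 = ∑ k : Fin n, (if (k : ℕ) < i then g k else 0) ∧
      (t.nat 10 0 0 = 0 → t.num 7 0 0 = C.t) ∧
      (t.nat 10 0 0 ≠ 0 → (∃ k, C.st k = 0 ∧ t.num 7 0 0 = 1 - I.c k) ∧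
        ∀ k : Fin n, (k : ℕ) < i → C.st k = 0 → t.num 7 0 0 ≤ 1 - I.c k)) (by decide) (by omega)
    (fun t hA => ?_) ?_ ?_ ?_
  · have := hA.nat 0 (by decide)
    simp only [NatExp.eval, this]
    exact hI.n_eq
  · simp [NatExp.eval, hC]
    exact ⟨rfl, rfl⟩
  · intro i hi t hA hti ⟨h1, h2, h3, h4⟩
    lift i to Fin n using hi
    have hAc : ∀ k : Fin n, t.num 1 k 0 = I.c k := fun k => by
      rw [hA.num 1 (by decide)]; exact hI.c_eq k
    have hst : ∀ k : Fin n, t.nat 1 k 0 = C.st k := fun k => congrFun (congrArg Config.st h1) k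
    have hm : t.nat 10 0 0 + 1 ≤ N := by
      have : t.nat 10 0 0 ≤ ∑ k : Fin n, 1 := by
        rw [h2]
        refine Finset.sum_le_sum fun k _ => ?_
        simp only [hg]
        split_ifs <;> omega
      simp at this
      omega
    have hzero : t.nat 10 0 0 = 0 → ∀ k : Fin n, (k : ℕ) < i → C.st k ≠ 0 := by
      intro h0 k hk hk0
      rw [h2, Finset.sum_eq_zero_iff] at h0
      have := h0 k (Finset.mem_univ k)
      simp [hk, hg, hk0] at this
    refine ⟨fun hb => ?_, fun hb => ?_⟩
    · simp only [Test.Holds, NatExp.eval, hti, hst, Nat.le_zero] at hb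
      refine ⟨fun h0 => ?_, fun h0 => ?_⟩
      · simp only [Test.Holds, NatExp.eval, NumExp.eval, hti, hAc, Nat.le_zero, Nat.cast_one] at h0
        refine ⟨by simpa [NatExp.eval] using hm, ?_, ?_, ?_, ?_⟩
        · simpa using h1
        · simp [NatExp.eval, -Order.lt_add_one_iff, sum_ite_lt_succ, h2, hg, hb]
        · simp [NatExp.eval]
        · intro _
          obtain ⟨g1, g2⟩ := h4 h0.1
          simp only [State.num_setNat]
          exact ⟨g1, forall_lt_succ.2 ⟨g2, fun _ => h0.2⟩⟩
      · simp only [Test.Holds, NatExp.eval, NumExp.eval, hti, hAc, Nat.le_zero, Nat.cast_one] at h0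
        refine ⟨?_, by simpa [NatExp.eval] using hm, ?_, ?_, ?_, ?_⟩
        · simp only [NumExp.eval, NatExp.eval, hti, hAc, Nat.cast_one]
          refine Regular.short ⟨sub_mem (I.one_mem_lattice _) (I.c_mem_lattice _ _), ?_⟩
          rw [abs_le]
          constructor <;> linarith [hc i, Nat.cast_nonneg (α := ℝ) n]
        · simp only [Config.ofState_setNat, Nat.reduceLT, State.num_setNat, State.num_setNum_self,
            NatExp.eval, NumExp.eval, hti, hAc, and_self, if_true]
          have := h1
          simp only [Config.ofState, Config.mk.injEq] at this ⊢
          simpa using this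
        · simp [NatExp.eval, -Order.lt_add_one_iff, sum_ite_lt_succ, h2, hg, hb]
        · simp [NatExp.eval]
        · intro _
          simp only [State.num_setNat, State.num_setNum_self, NatExp.eval, NumExp.eval, hti, hAc,
            and_self, if_true, Nat.cast_one]
          refine ⟨⟨i, hb, rfl⟩, forall_lt_succ.2 ⟨fun k hk hk0 => ?_, fun _ => le_rfl⟩⟩
          by_cases h5 : t.nat 10 0 0 = 0
          · exact absurd hk0 (hzero h5 k hk)
          · have h6 : ¬ t.num 7 0 0 ≤ 1 - I.c i := fun h7 => h0 ⟨h5, h7⟩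
            have := (h4 h5).2 k hk hk0
            linarith
    · simp only [Test.Holds, NatExp.eval, hti, hst, Nat.le_zero] at hb
      refine ⟨?_, ?_, ?_, ?_⟩
      · simpa using h1
      · simp [-Order.lt_add_one_iff, sum_ite_lt_succ, h2, hg, hb]
      · simpa using h3
      · intro h5
        obtain ⟨g1, g2⟩ := h4 (by simpa using h5)
        simp only [State.num_setNat]
        exact ⟨g1, forall_lt_succ.2 ⟨g2, fun h => absurd h hb⟩⟩
  · intro t hA ⟨h1, h2, h3, h4⟩
    simp only [Fin.is_lt, if_true, hcount, forall_const] at h2 h4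
    have hI' : Reads I t := by
      refine Reads.agree (s := s.setNat 10 0 0 0) ?_ hA (by decide) (by decide) (by decide)
      exact ⟨by simpa using hI.n_eq, hI.u_eq, hI.c_eq⟩
    refine ⟨by simp [NatExp.eval], fun hb => ?_, fun hb => ?_⟩
    · simp only [Test.Holds, NatExp.eval, Nat.le_zero] at hb
      have hb' : t.nat 10 0 0 = 0 := by simpa using hb
      have heq : Config.ofState n t = C := by rw [h1, h3 hb']
      simp only [wp, NatExp.eval]
      rw [Config.ofState_setNat (by norm_num), heq]
      refine ⟨by simpa using h2, by simp, rfl, fun _ => rfl, fun hne => absurd ?_ hne⟩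
      simpa using hb'
    · simp only [Test.Holds, NatExp.eval, Nat.le_zero] at hb
      have hb' : t.nat 10 0 0 ≠ 0 := by simpa using hb
      obtain ⟨⟨k, hk, hkt⟩, hle⟩ := h4 hb'
      have hs' := hs (by rw [← h2]; exact hb')
      have hr : Config.ofState n (t.setNat 9 0 0 0) = { C with t := t.num 7 0 0 } := by
        rw [Config.ofState_setNat (by norm_num), h1]
      have hP : Partial I (Config.ofState n (t.setNat 9 0 0 0)) := by
        rw [hr]; exact { h with }
      have hS : Settled I (Config.ofState n (t.setNat 9 0 0 0)) τ := by
        rw [hr]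
        obtain ⟨g1, g2, g3, g4, g5, g6, g7, g8, g9, g10⟩ := hs'
        exact ⟨g1, g2, g3, g4, g5, g6, g7, g8, g9, g10⟩
      have hτ : τ ≤ t.num 7 0 0 := by rw [hkt]; linarith [hs'.low k hk]
      refine (wp_resetProg (I := I) (s := t.setNat 9 0 0 0) hN (fun i => (hc i).1)
        ⟨by simpa using hI'.n_eq, hI'.u_eq, hI'.c_eq⟩ hP ?_ ?_ ?_).agree.mono
          fun w ⟨hw1, hw2, hw3⟩ => ?_
      · rw [hr]
        simp only [hkt]
        exact sub_mem (I.one_mem_lattice _) (I.c_mem_lattice _ _)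
      · rw [hr]
        exact hs'.pos.trans_le hτ
      · rw [hr]
        intro i hi
        have := hle i hi
        simp only
        linarith
      · have hw10 : w.nat 10 0 0 = t.nat 10 0 0 := by
          rw [hw1.nat 10 (by decide)]; simp
        have hst : (Config.ofState n w).st = C.st := by rw [hw3.st, hr]
        have htw : (Config.ofState n w).t = t.num 7 0 0 := by rw [hw3.t, hr]
        refine ⟨by rw [hw10, h2], ?_, by simp [Config.count, hst], fun h0 => ?_, fun _ => ?_⟩
        · rw [hw1.nat 9 (by decide)]; simp
        · rw [hw10] at h0
          exact absurd h0 hb'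
        · refine ⟨hw2, hS.keep hw3, by rw [htw]; exact hτ, k, by rw [hst]; exact hk, ?_⟩
          rw [htw, hkt]

/-! ### The program: completion to a perfect matching -/

/-- What the agents lack of one unit is computed in array `9`, and what is left of the goods in
array `8`. -/
def deficitProg : Prog :=
  .seq (setNumCell 8 (lit 0)) (forLoop 20 size (.seq (setNumAt 9 varI (lit 1)) (.seq
    (forLoop 21 size (setNumAt 9 varI (.sub (numAt 9 varI) (.load 2 varI varJ))))
    (setNumCell 8 (.sub (numCell 8) (numAt 6 varI))))))

theorem wp_deficitProg (hN : 2 * n + 2 ≤ N) {s : State} (hI : Reads I s)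
    {x : Fin n → Fin n → ℝ} {o : Fin n → ℝ} (hsx : ∀ i j : Fin n, s.num 2 i j = x i j)
    (hso : ∀ j : Fin n, s.num 6 j 0 = o j) (hx : ∀ i j, 0 ≤ x i j) (hrow : ∀ i, ∑ j, x i j ≤ 1)
    (hxm : ∀ i j, x i j ∈ I.lattice n.factorial) (hom : ∀ j, o j ∈ I.lattice n.factorial)
    (ho : ∀ j, |o j| ≤ 1) :
    deficitProg.wp N I.Short (fun t => (∀ i : Fin n, t.num 9 i 0 = 1 - ∑ j, x i j) ∧
      t.num 8 0 0 = - ∑ j, o j) s := by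
  refine ⟨by simpa [NumExp.eval, NatExp.eval] using I.regular_zero.short, ?_⟩
  simp only [NumExp.eval, NatExp.eval, Nat.cast_zero]
  refine wp_forLoop (M := n) (fun i t => (∀ k : Fin n, (k : ℕ) < i → t.num 9 k 0 = 1 - ∑ j, x k j) ∧
      t.num 8 0 0 = - ∑ k : Fin n, if (k : ℕ) < i then o k else 0) (by decide) (by omega)
    (fun t hA => by simpa [NatExp.eval, hA.nat 0 (by decide)] using hI.n_eq) (by simp) ?_ ?_
  · intro i hi t hA hti hinv
    lift i to Fin n using hi
    have hn0 : t.nat 0 0 0 = n := by simpa [hA.nat 0 (by decide)] using hI.n_eq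
    have hsx' : ∀ k l : Fin n, t.num 2 k l = x k l := fun k l => by
      rw [hA.num 2 (by decide), ← hsx]; simp
    have hso' : t.num 6 i 0 = o i := by rw [hA.num 6 (by decide), ← hso]; simp
    refine ⟨by simpa [NumExp.eval, NatExp.eval] using I.regular_one.short, ?_⟩
    refine wp_forLoop (M := n) (fun j r =>
        (∀ k : Fin n, (k : ℕ) < i → r.num 9 k 0 = 1 - ∑ j, x k j) ∧
        r.num 9 i 0 = 1 - ∑ k : Fin n, if (k : ℕ) < j then x i k else 0) (by decide) (by omega)
      (fun r hB => ?_) ?_ ?_ ?_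
    · simp [NatExp.eval, hB.nat 0 (by decide), hn0]
    · refine ⟨fun k hk => ?_, ?_⟩
      · simpa [NatExp.eval, hti, hk.ne] using hinv.1 k hk
      · simp [NatExp.eval, NumExp.eval, hti]
    · intro j hj r hB hrj ⟨h1, h2⟩
      lift j to Fin n using hj
      have hri : r.nat 20 0 0 = i := by rw [hB.nat 20 (by decide)]; simpa using hti
      have hrx : r.num 2 i j = x i j := by rw [hB.num 2 (by decide), ← hsx']; simp
      have hval : 1 - (∑ k : Fin n, if (k : ℕ) < j then x i k else 0) - x i j =
          1 - ∑ k : Fin n, if (k : ℕ) < j + 1 then x i k else 0 := by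
        rw [sum_ite_lt_succ]; ring
      refine ⟨?_, fun k hk => ?_, ?_⟩
      · simp only [NumExp.eval, NatExp.eval, hri, hrj, h2, hrx, hval]
        refine Regular.short ⟨sub_mem (I.one_mem_lattice _) (sum_ite_lt_mem (hxm i) _), ?_⟩
        have h3 : ∑ k : Fin n, (if (k : ℕ) < j + 1 then x i k else 0) ≤ ∑ k, x i k :=
          Finset.sum_le_sum fun k _ => by split_ifs; exacts [le_rfl, hx i k]
        have h4 : 0 ≤ ∑ k : Fin n, (if (k : ℕ) < j + 1 then x i k else 0) :=
          Finset.sum_nonneg fun k _ => by split_ifs; exacts [hx i k, le_rfl]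
        have h5 := hrow i
        rw [abs_le]
        constructor <;> linarith [Nat.cast_nonneg (α := ℝ) n]
      · simpa [NatExp.eval, hri, hk.ne] using h1 k hk
      · simp only [State.num_setNat, State.num_setNum_self, NumExp.eval, NatExp.eval, hri, hrj, h2,
          hrx, hval, and_self, if_true]
    · intro r hB ⟨h1, h2⟩
      simp only [Fin.is_lt, if_true] at h2
      have hri : r.nat 20 0 0 = i := by rw [hB.nat 20 (by decide)]; simpa using hti
      have hro : r.num 6 i 0 = o i := by rw [hB.num 6 (by decide), ← hso']; simp
      have hr8 : r.num 8 0 0 = t.num 8 0 0 := by rw [hB.num 8 (by decide)]; simp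
      have hval : -(∑ k : Fin n, if (k : ℕ) < i then o k else 0) - o i =
          -∑ k : Fin n, if (k : ℕ) < i + 1 then o k else 0 := by
        rw [sum_ite_lt_succ]; ring
      refine ⟨?_, ?_, ?_⟩
      · simp only [NumExp.eval, NatExp.eval, hri, hro, hr8, hinv.2, hval]
        refine Regular.short ⟨neg_mem (sum_ite_lt_mem hom _), ?_⟩
        rw [abs_neg, sum_ite_lt_succ]
        refine (abs_add_le _ _).trans ?_
        have : ((i : ℕ) + 1 : ℝ) ≤ n := by exact_mod_cast i.2
        linarith [abs_sum_ite_lt_le ho i, ho i]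
      · simp only [State.num_setNat]
        rw [State.num_setNum_of_ne (by norm_num)]
        exact forall_lt_succ.2 ⟨h1, h2⟩
      · simp only [State.num_setNat, State.num_setNum_self, NumExp.eval, NatExp.eval, hri, hro, hr8,
          hinv.2, hval, and_self, if_true]
  · intro t hA ⟨h1, h2⟩
    exact ⟨fun i => h1 i i.2, by simpa using h2⟩

/-- What is left of the goods is distributed among the agents, in proportion to what they lack. -/
def spreadProg : Prog :=
  forLoop 20 size (forLoop 21 size (.setNum 2 varI varJ (.sub (.load 2 varI varJ)
    (.div (.mul (numAt 9 varI) (numAt 6 varJ)) (numCell 8)))))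

theorem wp_spreadProg (hN : 2 * n + 2 ≤ N) {s : State} (hI : Reads I s)
    {x : Fin n → Fin n → ℝ} {r o : Fin n → ℝ} {T : ℝ} (hsx : ∀ i j : Fin n, s.num 2 i j = x i j)
    (hsr : ∀ i : Fin n, s.num 9 i 0 = r i) (hso : ∀ j : Fin n, s.num 6 j 0 = o j)
    (hsT : s.num 8 0 0 = T) (hshort : ∀ i j, I.Short (x i j - r i * o j / T)) :
    spreadProg.wp N I.Short (fun t => ∀ i j : Fin n, t.num 2 i j = x i j - r i * o j / T) s := by
  refine wp_forLoop (M := n) (fun i t => ∀ k l : Fin n, t.num 2 k l =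
      if (k : ℕ) < i then x k l - r k * o l / T else x k l) (by decide) (by omega)
    (fun t hA => (hI.agree hA (by decide) (by decide) (by decide)).n_eq) (by simpa using hsx) ?_ ?_
  · intro i hi t hA hti hinv
    lift i to Fin n using hi
    have hI' := hI.agree hA (by decide) (by decide) (by decide)
    refine wp_forLoop (M := n) (fun j t => ∀ k l : Fin n, t.num 2 k l =
        if (k : ℕ) < i ∨ k = i ∧ (l : ℕ) < j then x k l - r k * o l / T else x k l) (by decide)
      (by omega) (fun t hA => (hI'.agree hA (by decide) (by decide) (by decide)).n_eq)
      (by simpa using hinv) ?_ ?_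
    · intro j hj w hB hwj hinv'
      lift j to Fin n using hj
      have hwi : w.nat 20 0 0 = i := by rw [hB.nat 20 (by decide), hti]
      have hwx : w.num 2 i j = x i j := by rw [hinv', if_neg (by simp)]
      have hwr : w.num 9 i 0 = r i := by rw [hB.num 9 (by decide), hA.num 9 (by decide), hsr]
      have hwo : w.num 6 j 0 = o j := by rw [hB.num 6 (by decide), hA.num 6 (by decide), hso]
      have hwT : w.num 8 0 0 = T := by rw [hB.num 8 (by decide), hA.num 8 (by decide), hsT]
      refine ⟨?_, fun k l => ?_⟩
      · simpa only [NumExp.eval, NatExp.eval, hwi, hwj, hwx, hwr, hwo, hwT] using hshort i j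
      · simp only [State.num_setNat, State.num_setNum_self, NumExp.eval, NatExp.eval, hwi, hwj, hwx,
          hwr, hwo, hwT, Fin.val_inj]
        by_cases hkl : k = i ∧ l = j
        · obtain ⟨rfl, rfl⟩ := hkl
          simp
        · rw [if_neg hkl, hinv']
          refine if_congr (or_congr_right (and_congr_right fun hk => ?_)) rfl rfl
          have : (l : ℕ) ≠ j := fun h => hkl ⟨hk, Fin.val_injective h⟩
          omega
    · intro w hB hw k l
      rw [State.num_setNat, hw]
      refine if_congr ?_ rfl rfl
      rw [Fin.ext_iff]
      omega
  · intro t hA ht i j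
    rw [ht, if_pos i.2]

/-- The current allocation is completed to a perfect matching. -/
def completionProg : Prog := .seq deficitProg spreadProg

theorem wp_completionProg (hN : 2 * n + 2 ≤ N) {s : State} (hI : Reads I s)
    {x : Fin n → Fin n → ℝ} {o : Fin n → ℝ} (hsx : ∀ i j : Fin n, s.num 2 i j = x i j)
    (hso : ∀ j : Fin n, s.num 6 j 0 = o j) (hx : ∀ i j, 0 ≤ x i j) (hrow : ∀ i, ∑ j, x i j ≤ 1)
    (hxm : ∀ i j, x i j ∈ I.lattice n.factorial) (ho : ∀ j, o j + 1 = ∑ i, x i j)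
    (ho' : ∀ j, o j ≤ 0) :
    completionProg.wp N I.Short (fun t => ∀ i j : Fin n,
      t.num 2 i j = x i j - (1 - ∑ k, x i k) * o j / (- ∑ k, o k)) s := by
  have hom : ∀ j, o j ∈ I.lattice n.factorial := fun j => by
    rw [eq_sub_of_add_eq (ho j)]
    exact sub_mem (sum_mem fun i _ => hxm i j) (I.one_mem_lattice _)
  have ho1 : ∀ j, |o j| ≤ 1 := fun j => by
    have := Finset.sum_nonneg fun i (_ : i ∈ Finset.univ) => hx i j
    rw [abs_le]
    constructor <;> linarith [ho j, ho' j]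
  have hn0 : (0 : ℝ) ≤ n := Nat.cast_nonneg n
  have hx1 : ∀ i j, x i j ≤ 1 := fun i j =>
    (Finset.single_le_sum (fun j _ => hx i j) (Finset.mem_univ j)).trans (hrow i)
  change deficitProg.wp N I.Short (spreadProg.wp N I.Short _) s
  refine (wp_deficitProg hN hI hsx hso hx hrow hxm hom ho1).agree.mono fun t ⟨hA, h1, h2⟩ => ?_
  refine wp_spreadProg hN (hI.agree hA (by decide) (by decide) (by decide))
    (fun i j => by rw [hA.num 2 (by decide), hsx]) h1
    (fun j => by rw [hA.num 6 (by decide), hso]) h2 fun i j => ?_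
  have hX : I.Regular (x i j) := ⟨hxm i j, by rw [abs_of_nonneg (hx i j)]; linarith [hx1 i j]⟩
  have hR : I.Regular (1 - ∑ k, x i k) := by
    refine ⟨sub_mem (I.one_mem_lattice _) (sum_mem fun k _ => hxm i k), ?_⟩
    have := Finset.sum_nonneg fun k (_ : k ∈ Finset.univ) => hx i k
    rw [abs_le]
    constructor <;> linarith [hrow i]
  have hO : I.Regular (o j) := ⟨hom j, (ho1 j).trans (by linarith)⟩
  have hT : I.Regular (- ∑ k, o k) := by
    refine ⟨neg_mem (sum_mem fun k _ => hom k), ?_⟩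
    rw [abs_neg]
    refine (Finset.abs_sum_le_sum_abs _ _).trans ((Finset.sum_le_sum fun k _ => ho1 k).trans ?_)
    simp
  -- if nothing is left of the goods, the machine divides by zero and the allocation is unchanged
  by_cases h0 : - ∑ k, o k = 0
  · rw [h0, div_zero, sub_zero]
    exact hX.short
  · convert short_of_regular hX hT hR.neg hO hT I.regular_one using 1
    rw [mul_one, add_div, mul_div_cancel_right₀ _ h0]
    ring

/-! ### The main loop -/

/-- The invariant of the algorithm while there are uncapped agents. The current level has been
chosen either as the lowest level at which an uncapped agent demands one unit (then `h = 0`), or as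
the level at which a violated bottleneck is tight. -/
structure Running (I : Market n) (C : Config n) (h : ℕ) : Prop where
  preflow : Preflow I C
  settled : ∃ τ, Settled I C τ ∧ τ ≤ C.t
  attained : h = 0 → ∃ i, C.st i = 0 ∧ 1 - I.c i ≤ C.t
  bottleneck : h ≠ 0 → Bottleneck I C

theorem Running.keep {h : ℕ} (hR : Running I C h) (hP : Preflow I C') (hk : Keep C C') :
    Running I C' h := by
  obtain ⟨τ, h1, h2⟩ := hR.settled
  exact ⟨hP, ⟨τ, h1.keep hk, by rwa [hk.t]⟩, by rw [hk.st, hk.t]; exact hR.attained,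
    fun h0 => (hR.bottleneck h0).keep hk⟩

/-- An allocation that is optimal for all agents, up to the completion to a perfect matching. -/
structure Solved (I : Market n) (C : Config n) : Prop where
  x_nonneg : ∀ i j, 0 ≤ C.x i j
  likes : ∀ i j, 0 < C.x i j → I.u i j = 1
  x_mem : ∀ i j, C.x i j ∈ I.lattice n.factorial
  o_eq : ∀ j, C.o j + 1 = ∑ i, C.x i j
  o_le : ∀ j, C.o j ≤ 0
  p_nonneg : ∀ j, 0 ≤ C.p j
  p_free : ∀ j, C.o j < 0 → C.p j = 0
  optimal : ∀ i, I.Optimal C.x C.p C.q i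

theorem Complete.solved (h : Complete I C) (hs : Settled I C τ) (hc : ∀ i, I.c i < 1)
    (h0 : C.count = 0) : Solved I C where
  x_nonneg := h.x_nonneg
  likes := h.likes
  x_mem := h.x_mem
  o_eq := h.o_eq
  o_le := h.o_le
  p_nonneg := fun j => by
    by_cases hj : C.g j = 0
    · rw [hs.price_free j hj]
    · exact (one_div_pos.2 hs.pos).le.trans (hs.price j hj)
  p_free := fun j hj => hs.price_free j (by
    by_contra hg
    exact hj.ne (h.o_settled j hg))
  optimal := hs.optimal_of_complete h hc fun i hi => by
    simp only [Config.count, Finset.card_eq_zero, Finset.filter_eq_empty_iff] at h0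
    exact h0 (Finset.mem_univ i) hi

/-- The invariant of the main loop, in terms of the memory. -/
structure Invariant (I : Market n) (s : State) : Prop where
  reads : Reads I s
  count : s.nat 10 0 0 = (Config.ofState n s).count
  running : (Config.ofState n s).count ≠ 0 → Running I (Config.ofState n s) (s.nat 9 0 0)
  solved : (Config.ofState n s).count = 0 → Solved I (Config.ofState n s)

theorem wp_levelProg_invariant (hN : 2 * n + 2 ≤ N) (hc : ∀ i, 0 ≤ I.c i ∧ I.c i < 1) {s : State}
    (hI : Reads I s) (h : Partial I (Config.ofState n s))
    (hs : (Config.ofState n s).count ≠ 0 → Settled I (Config.ofState n s) τ)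
    (h0 : (Config.ofState n s).count = 0 → Solved I (Config.ofState n s)) :
    levelProg.wp N I.Short (fun t => Invariant I t ∧
      (Config.ofState n t).count = (Config.ofState n s).count) s := by
  refine (wp_levelProg hN hc hI h hs).agree.mono fun t ⟨hA, h1, h2, h3, h4, h5⟩ =>
    ⟨⟨hI.agree hA (by decide) (by decide) (by decide), h1.trans h3.symm, fun hne => ?_,
      fun heq => ?_⟩, h3⟩
  · obtain ⟨g1, g2, g3, g4⟩ := h5 (by rwa [h1, ← h3])
    exact ⟨g1, ⟨τ, g2, g3⟩, fun _ => g4, fun hne => absurd h2 hne⟩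
  · rw [h3] at heq
    rw [h4 (h1.trans heq)]
    exact h0 heq

theorem Config.count_lt (h : ∀ i, C'.st i = 0 → C.st i = 0) {i : Fin n} (hi : C.st i = 0)
    (hi' : C'.st i ≠ 0) : C'.count < C.count := by
  refine Finset.card_lt_card ((Finset.ssubset_iff_of_subset fun k hk => ?_).2 ⟨i, ?_, ?_⟩)
  · simpa using h k (by simpa using hk)
  · simpa using hi
  · simpa using hi'

/-- When all demands are met, the agents that demand one unit are capped, or, if the level comes
from a bottleneck, this is settled. Then the search for the next level begins. -/
def completeProg : Prog :=
  .seq (.branch (.natLe (.cell 9) (.const 0)) capProg settleProg) levelProg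

theorem wp_completeProg (hN : 2 * n + 2 ≤ N) (hc : ∀ i, 0 ≤ I.c i ∧ I.c i < 1) {s : State}
    (hI : Reads I s) (hR : Running I (Config.ofState n s) (s.nat 9 0 0))
    (h : ∀ k, (Config.ofState n s).e k ≤ 0 ∧ (Config.ofState n s).o k ≤ 0) :
    completeProg.wp N I.Short (fun t => Invariant I t ∧
      (Config.ofState n t).count < (Config.ofState n s).count) s := by
  change Prog.wp N I.Short _ (levelProg.wp N I.Short _) s
  set C := Config.ofState n s with hC
  have hcomp : Complete I C := hR.preflow.complete (fun i => (h i).1) fun j => (h j).2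
  have he : ∀ i, C.e i = 0 := fun i => le_antisymm (h i).1 (hR.preflow.e_nonneg i)
  obtain ⟨τ, hs, hτ⟩ := hR.settled
  have hc1 : ∀ i, I.c i < 1 := fun i => (hc i).2
  have hreg : ∀ i, I.Regular (1 - I.c i) := fun i =>
    ⟨sub_mem (I.one_mem_lattice _) (I.c_mem_lattice _ i), by
      have := hc i
      rw [abs_le]
      constructor <;> linarith [Nat.cast_nonneg (α := ℝ) n]⟩
  -- the search for the next level, after capping or settling has led to `D`
  have key : ∀ (D : Config n) (t : State), Reads I t → Config.ofState n t = D → Complete I D →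
      Settled I D C.t → D.count < C.count → levelProg.wp N I.Short (fun t => Invariant I t ∧
        (Config.ofState n t).count < C.count) t := by
    rintro D t hI' rfl hD hsD hlt
    exact (wp_levelProg_invariant hN hc hI' hD.toPartial (fun _ => hsD) (hD.solved hsD hc1)).mono
      fun r ⟨h1, h2⟩ => ⟨h1, by rwa [h2]⟩
  refine ⟨fun hb => ?_, fun hb => ?_⟩
  · simp only [Test.Holds, NatExp.eval, Nat.le_zero] at hb
    refine (wp_capProg hN hI fun i => (hreg i).short_one_div).agree.mono fun t ⟨hA, ht⟩ => ?_
    obtain ⟨i, hi, hi'⟩ := hR.attained hb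
    refine key _ t (hI.agree hA (by decide) (by decide) (by decide)) ht hcomp.cap
      (hs.cap hcomp hτ) (Config.count_lt (fun k hk => ?_) hi ?_)
    · simp only [Config.cap] at hk
      split_ifs at hk
      exact hk
    · simp only [Config.cap]
      rw [if_pos ⟨hi, hi'⟩]
      exact one_ne_zero
  · simp only [Test.Holds, NatExp.eval, Nat.le_zero] at hb
    have hB := hR.bottleneck hb
    obtain ⟨i, hi⟩ := Finset.card_pos.1 hB.pos
    simp only [Config.uncapped, Config.agents, Finset.mem_filter, Finset.mem_univ, true_and] at hi
    have ht : I.Regular C.t := by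
      refine ⟨hR.preflow.t_mem, ?_⟩
      rw [abs_of_pos hR.preflow.t_pos]
      linarith [hR.preflow.t_le i hi.2, hc i, Nat.cast_nonneg (α := ℝ) n]
    refine (wp_settleProg hN hI ht.short_one_div fun k hk => ?_).agree.mono fun t ⟨hA, hr⟩ => ?_
    · -- the offset is `1 / (1 - c) - 1 / t = (t - (1 - c)) / ((1 - c) * t)`
      rw [← hC, hs.offset_capped k hk]
      convert short_of_regular ht I.regular_one (hreg k).neg I.regular_one (hreg k) ht using 1
      have := sub_pos.2 (hc k).2
      have := hR.preflow.t_pos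
      field_simp
      ring
    · refine key _ t (hI.agree hA (by decide) (by decide) (by decide)) hr (hcomp.settle hB he)
        (hs.settle hcomp hc1 hB he hτ) (Config.count_lt (fun k hk => ?_) hi.2 ?_)
      · simp only [Config.settle] at hk
        split_ifs at hk
        exact hk
      · simp only [Config.settle]
        rw [if_pos hi.1]
        norm_num

/-- The number of uncapped agents in the bottleneck from which the current level comes; if it does
not come from one (`h = 0`), a larger number. -/
def Config.stage (C : Config n) (h : ℕ) : ℕ := if h = 0 then n + 1 else (C.uncapped C.agents).card

theorem Config.card_uncapped_le (C : Config n) (S : Finset (Fin n)) : (C.uncapped S).card ≤ n :=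
  (Finset.card_le_univ _).trans (by simp)

theorem Config.stage_le (C : Config n) (h : ℕ) : C.stage h ≤ n + 1 := by
  unfold stage
  split_ifs
  · exact le_rfl
  · exact (C.card_uncapped_le _).trans (Nat.le_succ n)

theorem Keep.count (hk : Keep C C') : C'.count = C.count := by simp [Config.count, hk.st]

theorem Keep.stage (hk : Keep C C') (h : ℕ) : C'.stage h = C.stage h := by
  simp [Config.stage, Config.uncapped, Config.agents, hk.st, hk.S]

/-- When some excess cannot be removed, the level is lowered to where a violated bottleneck is
tight. -/
def newtonProg : Prog := .seq gapProg (.seq cutProg resetProg)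

/-- Since all excess has the highest label `2 * n + 1`, it is above any empty level below. Hence
the new bottleneck has maximum deficiency, and by `Preflow.newton` it has fewer uncapped agents than
the previous one, if there was one. -/
theorem wp_newtonProg (hN : 2 * n + 2 ≤ N) (hc : ∀ i, 0 ≤ I.c i ∧ I.c i < 1) {s : State}
    (hI : Reads I s) (hR : Running I (Config.ofState n s) (s.nat 9 0 0))
    (he : ∀ i, 0 < (Config.ofState n s).e i → (Config.ofState n s).a i = 2 * n + 1)
    (ho : ∀ j, 0 < (Config.ofState n s).o j → (Config.ofState n s).b j = 2 * n + 1)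
    (hpos : ∃ k, 0 < (Config.ofState n s).e k ∨ 0 < (Config.ofState n s).o k)
    (hcount : (Config.ofState n s).count ≠ 0) :
    newtonProg.wp N I.Short (fun t => Running I (Config.ofState n t) (t.nat 9 0 0) ∧
      (Config.ofState n t).count = (Config.ofState n s).count ∧
      (Config.ofState n t).stage (t.nat 9 0 0) < (Config.ofState n s).stage (s.nat 9 0 0)) s := by
  set C := Config.ofState n s with hC
  have hP := hR.preflow
  change gapProg.wp N I.Short (cutProg.wp N I.Short (resetProg.wp N I.Short _)) s
  refine (wp_gapProg hN hI).agree.mono fun t ⟨hA, hl, hgap⟩ => ?_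
  have ht : Config.ofState n t = C := Config.ofState_agree hA (by decide) (by decide)
  have hIt := hI.agree hA (by decide) (by decide) (by decide)
  rw [ht] at hgap
  set l := t.nat 11 0 0 with hlt
  obtain ⟨τ, hs, hτ⟩ := hR.settled
  set D := C.cut I l with hD
  have hag : D.agents = Finset.univ.filter fun i => l < C.a i := by
    simp [Config.agents, hD, Config.cut]
  have hgo : D.goods = Finset.univ.filter fun j => l < C.b j := by
    simp [Config.goods, hD, Config.cut]
  have hDt : D.t = (D.goods.card - ∑ i ∈ D.agents, demand I C 0 i) /
      (C.uncapped D.agents).card := by rw [hag, hgo]; rfl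
  obtain ⟨h1, h2, hB, h3⟩ := hP.newton (C' := D) hs hgap (fun i hi => by rw [he i hi]; exact hl)
    (fun j hj => by rw [ho j hj]; exact hl)
    (hP.excess_pos (by
      obtain ⟨k, hk | hk⟩ := hpos
      · exact Or.inl ⟨k, hk⟩
      · exact Or.inr ⟨k, hk⟩)) rfl rfl (by simp [hD, Config.cut]) (by simp [hD, Config.cut]) hDt
  have ht1 : C.t ≤ 1 := by
    obtain ⟨i, hi⟩ := Finset.card_pos.1 (Nat.pos_of_ne_zero hcount)
    simp only [Finset.mem_filter, Finset.mem_univ, true_and] at hi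
    linarith [hP.t_le i hi, hc i]
  have hDpos : 0 < D.t := hs.pos.trans_le h1
  have hDm : D.t ∈ I.lattice n.factorial := by
    rw [hDt]
    refine I.div_mem_lattice hB.pos.ne' (Nat.dvd_factorial hB.pos (C.card_uncapped_le _)) ?_
    refine sub_mem ?_ (sum_mem fun i _ => ?_)
    · simpa using nsmul_mem (I.one_mem_lattice 1) D.goods.card
    · unfold demand
      split_ifs
      · rw [add_zero]
        exact I.c_mem_lattice 1 i
      · exact I.one_mem_lattice 1
  have hDP : Partial I D := { hP.toPartial with }
  have hle : ∀ i, D.st i = 0 → I.c i + D.t ≤ 1 := fun i hi => by linarith [hP.t_le i hi]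
  have hDs : Settled I D τ := by
    obtain ⟨g1, g2, g3, g4, g5, g6, g7, g8, g9, g10⟩ := hs
    exact ⟨g1, g2, g3, g4, g5, g6, g7, g8, g9, g10⟩
  refine wp_cutProg hN (fun i => ⟨(hc i).1, (hc i).2.le⟩) hIt rfl ?_ fun r hA' hr h9 => ?_
  · rw [ht]
    refine Regular.short ⟨hDm, ?_⟩
    rw [abs_of_pos hDpos]
    linarith [Nat.cast_nonneg (α := ℝ) n]
  · rw [ht] at hr
    have hIr := hIt.agree hA' (by decide) (by decide) (by decide)
    refine (wp_resetProg hN (fun i => (hc i).1) hIr (by rw [hr]; exact hDP) (by rw [hr]; exact hDm)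
      (by rw [hr]; exact hDpos) (by rw [hr]; exact hle)).agree.mono fun w ⟨hB', hw, hk⟩ => ?_
    rw [hr] at hk
    have hw9 : w.nat 9 0 0 = 1 := by rw [hB'.nat 9 (by decide), h9]
    rw [hw9]
    refine ⟨⟨hw, ⟨τ, hDs.keep hk, by rwa [hk.t]⟩, fun h => absurd h one_ne_zero,
      fun _ => hB.keep hk⟩, hk.count, ?_⟩
    rw [hk.stage]
    unfold Config.stage
    rw [if_neg one_ne_zero]
    split_ifs with h0
    · exact Nat.lt_succ_of_le (D.card_uncapped_le _)
    · exact h3 (hR.bottleneck h0)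

/-- The number of iterations of the main loop that are left is at most this number. It encodes, in
lexicographic order, that events decrease the number of uncapped agents, that new bottlenecks
decrease the number of uncapped agents in the bottleneck, and that pushes and lifts decrease the
potential. The potential is bounded for preflows only; the minimum makes the bound hold always. -/
noncomputable def Config.rank (C : Config n) (h : ℕ) : ℕ :=
  (C.count * (n + 2) + C.stage h) * (potentialBound n + 1) + min C.potential (potentialBound n)

theorem Config.rank_lt_of_count {h h' : ℕ} (hC : C'.count < C.count) : C'.rank h' < C.rank h := by
  have h1 := C'.stage_le h'
  have h2 : C'.count * (n + 2) + C'.stage h' + 1 ≤ C.count * (n + 2) + C.stage h := by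
    have := Nat.mul_le_mul_right (n + 2) (Nat.succ_le_of_lt hC)
    rw [Nat.succ_mul] at this
    omega
  have h3 := Nat.mul_le_mul_right (Config.potentialBound n + 1) h2
  have h4 := min_le_right C'.potential (Config.potentialBound n)
  rw [Nat.succ_mul] at h3
  unfold rank
  omega

theorem Config.rank_lt_of_stage {h h' : ℕ} (hC : C'.count = C.count)
    (hS : C'.stage h' < C.stage h) : C'.rank h' < C.rank h := by
  have h2 : C'.count * (n + 2) + C'.stage h' + 1 ≤ C.count * (n + 2) + C.stage h := by
    rw [hC]; omega
  have h3 := Nat.mul_le_mul_right (Config.potentialBound n + 1) h2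
  have h4 := min_le_right C'.potential (Config.potentialBound n)
  rw [Nat.succ_mul] at h3
  unfold rank
  omega

/-- One round of pushes and lifts; if it has no effect, the next level is determined. -/
def bodyProg : Prog :=
  .seq (setNatCell 8 (.const 0)) (.seq agentSweep (.seq goodSweep
    (.branch (.natLe (.cell 8) (.const 0))
      (.seq activeProg (.branch (.natLe (.cell 8) (.const 0)) completeProg newtonProg)) .skip)))

theorem wp_bodyProg (hu : I.Dichotomous) (hN : 2 * n + 2 ≤ N) (hc : ∀ i, 0 ≤ I.c i ∧ I.c i < 1)
    {s : State} (hs : Invariant I s) (h0 : (Config.ofState n s).count ≠ 0) :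
    bodyProg.wp N I.Short (fun t => Invariant I t ∧ (Config.ofState n t).rank (t.nat 9 0 0) <
      (Config.ofState n s).rank (s.nat 9 0 0)) s := by
  set C := Config.ofState n s with hC
  have hR := hs.running h0
  refine ⟨by simp [NatExp.eval], ?_⟩
  simp only [NatExp.eval]
  set s₀ := s.setNat 8 0 0 0 with hs₀
  have hC₀ : Config.ofState n s₀ = C := Config.ofState_setNat (by norm_num)
  have hI₀ : Reads I s₀ := ⟨by simpa [hs₀] using hs.reads.n_eq, hs.reads.u_eq, hs.reads.c_eq⟩
  have hS₀ : Sweep I C (s₀.nat 8 0 0) (Config.ofState n s₀) := by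
    rw [hC₀]
    exact ⟨hR.preflow, Keep.refl C, by simp [hs₀]⟩
  change agentSweep.wp N I.Short (goodSweep.wp N I.Short (Prog.wp N I.Short _ _)) s₀
  refine (wp_agentSweep hu hN hI₀ hS₀).agree.mono fun t ⟨hA, hS₁, ha⟩ => ?_
  have hI₁ := hI₀.agree hA (by decide) (by decide) (by decide)
  refine (wp_goodSweep hN hI₁ hS₁ ha).agree.mono fun r ⟨hB, hS₂, hab⟩ => ?_
  have hI₂ := hI₁.agree hB (by decide) (by decide) (by decide)
  have h9 : r.nat 9 0 0 = s.nat 9 0 0 := by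
    rw [hB.nat 9 (by decide), hA.nat 9 (by decide)]; simp [hs₀]
  have h10 : r.nat 10 0 0 = s.nat 10 0 0 := by
    rw [hB.nat 10 (by decide), hA.nat 10 (by decide)]; simp [hs₀]
  have hR₂ : Running I (Config.ofState n r) (r.nat 9 0 0) := by
    rw [h9]; exact hR.keep hS₂.preflow hS₂.keep
  have hcount := hS₂.keep.count
  have hstage := hS₂.keep.stage (s.nat 9 0 0)
  refine ⟨fun hb => ?_, fun hb => ?_⟩
  · simp only [Test.Holds, NatExp.eval, Nat.le_zero] at hb
    change activeProg.wp N I.Short (Prog.wp N I.Short _ _) r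
    refine (wp_activeProg hN hI₂ hb).agree.mono fun w ⟨hA', h1, h2⟩ => ?_
    have hw : Config.ofState n w = Config.ofState n r :=
      Config.ofState_agree hA' (by decide) (by decide)
    have hIw := hI₂.agree hA' (by decide) (by decide) (by decide)
    have hw9 : w.nat 9 0 0 = r.nat 9 0 0 := by rw [hA'.nat 9 (by decide)]
    have hRw : Running I (Config.ofState n w) (w.nat 9 0 0) := by rwa [hw, hw9]
    refine ⟨fun hb' => ?_, fun hb' => ?_⟩
    · simp only [Test.Holds, NatExp.eval, Nat.le_zero] at hb'
      refine (wp_completeProg hN hc hIw hRw (h1 hb')).mono fun v ⟨hv, hlt⟩ =>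
        ⟨hv, Config.rank_lt_of_count ?_⟩
      rwa [← hcount, ← hw]
    · simp only [Test.Holds, NatExp.eval, Nat.le_zero] at hb'
      refine (wp_newtonProg hN hc hIw hRw ?_ ?_ (h2 hb') ?_).agree.mono fun v ⟨hv, g1, g2, g3⟩ =>
        ⟨⟨hIw.agree hv (by decide) (by decide) (by decide), ?_, fun _ => g1, fun h => ?_⟩,
          Config.rank_lt_of_stage ?_ ?_⟩
      · rw [hw]; exact (hab hb).1
      · rw [hw]; exact (hab hb).2
      · rwa [hw, hcount]
      · rw [hv.nat 10 (by decide), hA'.nat 10 (by decide), h10, g2, hw, hcount, hs.count]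
      · rw [g2, hw, hcount] at h
        exact absurd h h0
      · rw [g2, hw, hcount]
      · rwa [hw9, h9, hw, hstage] at g3
  · simp only [Test.Holds, NatExp.eval, Nat.le_zero] at hb
    refine ⟨⟨hI₂, by rw [h10, hcount, hs.count], fun _ => hR₂, fun h => absurd (hcount ▸ h) h0⟩, ?_⟩
    have h1 := hS₂.potential
    have h2 : C.potential ≤ Config.potentialBound n := C.potential_le hR.preflow.labelSum_le
    have h3 : min (Config.ofState n r).potential (Config.potentialBound n) <
        min C.potential (Config.potentialBound n) := by
      rw [min_eq_left h2]
      exact (min_le_left _ _).trans_lt (by omega)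
    rw [h9]
    unfold Config.rank
    rw [hcount, hstage]
    omega

/-! ### The whole program -/

theorem Config.rank_le (C : Config n) (h : ℕ) :
    C.rank h ≤ (n * (n + 2) + (n + 1)) * (potentialBound n + 1) + potentialBound n := by
  unfold rank
  gcongr
  · exact C.card_uncapped_le Finset.univ
  · exact C.stage_le h
  · exact min_le_right _ _

theorem Config.rank_pos {h : ℕ} (hC : C.count ≠ 0) : 0 < C.rank h := by
  have := Nat.pos_of_ne_zero hC
  unfold rank
  positivity

/-- The program that computes an equilibrium whose allocation is a Nash-bargaining solution. -/
def nashProg : Prog :=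
  .seq levelProg (.seq (.loop (.natLe (.const 1) (.cell 10)) bodyProg) completionProg)

theorem Feasible.c_lt_one (hu : I.Dichotomous) (hF : I.Feasible) (i : Fin n) : I.c i < 1 := by
  obtain ⟨x, ⟨hx, hrow, -⟩, hlt⟩ := hF
  refine (hlt i).trans_le ?_
  rw [← hrow i]
  refine Finset.sum_le_sum fun j _ => ?_
  rcases hu i j with h | h <;> simp [h, hx i j]

theorem reads_input (I : Market n) : Reads I I.input := by
  refine ⟨by simp [input], fun i j => by simp [input], fun i => ?_⟩
  simp [input]

theorem wp_nashProg (hu : I.Dichotomous) (hc : ∀ i, 0 ≤ I.c i) (hF : I.Feasible)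
    (hN : 2 * n + 2 ≤ N)
    (hN' : (n * (n + 2) + (n + 1)) * (Config.potentialBound n + 1) + Config.potentialBound n ≤ N) :
    nashProg.wp N I.Short (fun t =>
      I.IsEquilibrium (outputAllocation n t) (outputPrices n t) (outputOffsets n t) ∧
        I.IsNashBargainingSolution (outputAllocation n t)) I.input := by
  have hc' : ∀ i, 0 ≤ I.c i ∧ I.c i < 1 := fun i => ⟨hc i, hF.c_lt_one hu i⟩
  have hst : ∀ i, (Config.ofState n I.input).st i = 0 := fun i => by simp [Config.ofState, input]
  have hg : ∀ i, (Config.ofState n I.input).g i = 0 := fun i => by simp [Config.ofState, input]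
  have hp : ∀ i, (Config.ofState n I.input).p i = 0 := fun i => by simp [Config.ofState, input]
  have hq : ∀ i, (Config.ofState n I.input).q i = 0 := fun i => by simp [Config.ofState, input]
  have hx : ∀ i j, (Config.ofState n I.input).x i j = 0 := fun i j => by
    simp [Config.ofState, input]
  have hP : Partial I (Config.ofState n I.input) :=
    ⟨fun i j => (hx i j).ge, fun i j h => absurd (hx i j) h.ne', fun i j h => absurd (hx i j) h.ne',
      fun i h => by rw [hst i] at h; omega, fun j h => absurd (hg j) h,
      fun j h => absurd (hg j) h, fun i j => by rw [hx]; exact zero_mem _⟩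
  obtain ⟨τ, hτ⟩ : ∃ τ, (Config.ofState n I.input).count ≠ 0 →
      Settled I (Config.ofState n I.input) τ := by
    -- without agents no level is feasible in the sense of `Settled`, but none is needed
    rcases Nat.eq_zero_or_pos n with h0 | h0
    · refine ⟨0, fun h => absurd (Nat.le_zero.1 ?_) h⟩
      exact (Config.card_uncapped_le _ Finset.univ).trans h0.le
    · obtain ⟨τ, hτ⟩ := hF.settled hu hc h0 hst hg hp hq
      exact ⟨τ, fun _ => hτ⟩
  have h0 : (Config.ofState n I.input).count = 0 → Solved I (Config.ofState n I.input) := by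
    intro h
    have hn : ∀ i : Fin n, False := fun i => by
      simp only [Config.count, Finset.card_eq_zero, Finset.filter_eq_empty_iff] at h
      exact h (Finset.mem_univ i) (hst i)
    exact ⟨fun i => (hn i).elim, fun i => (hn i).elim, fun i => (hn i).elim, fun i => (hn i).elim,
      fun i => (hn i).elim, fun i => (hn i).elim, fun i => (hn i).elim, fun i => (hn i).elim⟩
  change levelProg.wp N I.Short (Prog.wp N I.Short _ (completionProg.wp N I.Short _)) I.input
  refine (wp_levelProg_invariant hN hc' I.reads_input hP hτ h0).mono fun s ⟨hs, _⟩ => ?_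
  refine ⟨fun m t => Invariant I t ∧ (Config.ofState n t).rank (t.nat 9 0 0) ≤ m,
    ⟨_, (Config.rank_le _ _).trans hN', hs, le_rfl⟩, fun m t ⟨ht, hm⟩ => ⟨fun hb => ?_,
      fun hb => ?_⟩⟩
  · simp only [Test.Holds, NatExp.eval, not_le, Nat.lt_one_iff] at hb
    have hS := ht.solved (ht.count ▸ hb)
    refine (wp_completionProg hN ht.reads (x := (Config.ofState n t).x)
      (o := (Config.ofState n t).o) (fun _ _ => rfl) (fun _ => rfl) hS.x_nonneg (fun i => ?_)
      hS.x_mem hS.o_eq hS.o_le).agree.mono fun r ⟨hA, hr⟩ => ?_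
    · exact (hS.optimal i).le_one
    · have h3 : outputPrices n r = (Config.ofState n t).p := by
        funext j
        simp only [outputPrices, hA.num 3 (by decide)]
        rfl
      have h4 : outputOffsets n r = (Config.ofState n t).q := by
        funext j
        simp only [outputOffsets, hA.num 4 (by decide)]
        rfl
      rw [h3, h4]
      exact isEquilibrium_completion hu hS.x_nonneg hS.likes hS.o_eq hS.o_le (fun _ => rfl)
        hS.p_nonneg hS.p_free hS.optimal hr
  · simp only [Test.Holds, NatExp.eval] at hb
    have h0 : (Config.ofState n t).count ≠ 0 := by rw [← ht.count]; omega
    have := Config.rank_pos (h := t.nat 9 0 0) h0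
    exact ⟨m - 1, by omega, (wp_bodyProg hu hN hc' ht h0).mono
      fun r ⟨h1, h2⟩ => ⟨h1, by omega⟩⟩

/-- A bound for the counters in the memory and for the number of iterations of each loop. -/
noncomputable def counterBound : Polynomial ℕ :=
  let l : Polynomial ℕ := .X * (2 * (2 * .X + 1))
  let z : Polynomial ℕ := (l * (.X * .X + 1) + .X * .X) * (l + 1) + l
  (.X * (.X + 2) + (.X + 1)) * (z + 1) + z + (2 * .X + 2)

theorem eval_counterBound (n : ℕ) : counterBound.eval n =
    (n * (n + 2) + (n + 1)) * (Config.potentialBound n + 1) + Config.potentialBound n +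
      (2 * n + 2) := by
  simp [counterBound, Config.potentialBound, Config.labelBound]

theorem bounded_input (hu : I.Dichotomous) (hc : ∀ i, 0 ≤ I.c i ∧ I.c i < 1) (hN : n ≤ N) :
    I.input.Bounded N I.Short := by
  refine ⟨fun a i j => ?_, fun a i j => ?_⟩
  · simp only [input]
    split_ifs <;> omega
  · simp only [input]
    split_ifs with h1 h2
    · rcases hu ⟨i, h1.1⟩ ⟨j, h1.2.1⟩ with h | h <;> rw [h]
      · exact I.regular_zero.short
      · exact I.regular_one.short
    · refine Regular.short ⟨I.c_mem_lattice _ _, ?_⟩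
      have := hc ⟨i, h2.1⟩
      rw [abs_of_nonneg this.1]
      linarith [Nat.cast_nonneg (α := ℝ) n]
    · exact I.regular_zero.short

end Market

theorem mainTheorem3 :
    ∃ (prog : RealRAM.Prog) (P Q : Polynomial ℕ), ∀ (n : ℕ) (I : Market n),
      I.Dichotomous → (∀ i, 0 ≤ I.c i) → I.Feasible →
      ∃ (k : ℕ) (s : RealRAM.State),
        RealRAM.Exec (I.WithinSpace (P.eval n) Q) prog I.input k s ∧ k ≤ P.eval n ∧
        I.IsEquilibrium (outputAllocation n s) (outputPrices n s) (outputOffsets n s) ∧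
        I.IsNashBargainingSolution (outputAllocation n s) := by
  refine ⟨Market.nashProg, Market.nashProg.time.comp Market.counterBound + Market.counterBound,
    Market.bitBound, fun n I hu hc hF => ?_⟩
  have hN := Market.eval_counterBound n
  set N := Market.counterBound.eval n with hN'
  have hP : (Market.nashProg.time.comp Market.counterBound + Market.counterBound).eval n =
      Market.nashProg.time.eval N + N := by
    rw [Polynomial.eval_add, Polynomial.eval_comp]
  rw [hP]
  obtain ⟨k, t, h1, h2, h3, -⟩ := RealRAM.Prog.wp.sound
    (R := I.Short) (Ok := I.WithinSpace (Market.nashProg.time.eval N + N) Market.bitBound)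
    (fun s hs => ⟨fun a i j => (hs.1 a i j).trans (Nat.le_add_left _ _),
      fun c' hc' a i j => hs.2 a i j c' hc'⟩)
    (Market.bounded_input hu (fun i => ⟨hc i, hF.c_lt_one hu i⟩) (by omega))
    (Market.wp_nashProg hu hc hF (N := N) (by omega) (by omega))
  exact ⟨k, t, h1, h2.trans (Nat.le_add_right _ _), h3⟩
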